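/- Let $\mathbb{G}$ be an index $n$ toroidal grid diagram, $n \ge 1$: an $n\times n$ grid of squares on a torus cut out by $n$ horizontal circles $\alpha_i$ and $n$ vertical circles $\beta_i$, with markings $O_1,\dots,O_n$ and $X_1,\dots,X_n$ such that every row and every column of squares contains exactly one $O$ and one $X$; let $H_j$ and $V_j$ be the row and the column (annuli) through $O_j$. A generator is an $n$-tuple of intersection points with exactly one point on each $\alpha$- and each $\beta$-circle. A positive domain $D\in\mathscr D^+(x,y)$ from a generator $x$ to a generator $y$ is a linear combination of squares with nonnegative integer coefficients such that $\partial(\partial D\cap\alpha)=y-x$; $\mu(D)$ denotes its Maslov index $n_x(D)+n_y(D)$, where $n_z(D)$ is the sum over the points of $z$ of the average of the coefficients of $D$ in the four surrounding squares. For $D\in\mathscr D(x,y)$ and $E\in\mathscr D(y,z)$, $D*E\in\mathscr D(x,z)$ is their sum. A rectangle from $x$ to $y$ is an embedded rectangle whose bottom left and top right corners are points of $x$, whose other two corners are points of $y$, such that the remaining $n-2$ points of $x$ and $y$ agree and do not lie in it. The complex $\mathit{CDP}_*=\mathit{CDP}_*(\mathbb G;\mathbb Z/2)$ is freely generated over $\mathbb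 Z/2$ by the triples $(D,\vec N,\vec\lambda)$, where $D$ is a positive domain from some generator $x$ to some generator $y$ (these being part of the data), $\vec N=(N_1,\dots,N_n)\in\mathbb N^n$, and $\vec\lambda=(\lambda_1,\dots,\lambda_n)$ with $\lambda_j$ an ordered partition of $N_j$ into positive parts. The grading of the triple is $\mu(D)$ plus the total number of parts of $\lambda_1,\dots,\lambda_n$. The differential is $\partial=\partial_1+\partial_2+\partial_3+\partial_4$, where, all sums being taken with multiplicity, - $\partial_1(D,\vec N,\vec\lambda)=\sum_{R*E=D}(E,\vec N,\vec\lambda)+\sum_{E*R=D}(E,\vec N,\vec\lambda)$ with $R$ a rectangle and $E$ a positive domain; - $\partial_2$ is the sum, over $j$, over the decompositions $D=E*H_j$ and over the decompositions $D=E*V_j$ with $E$ a positive domain, and over the $l(\lambda_j)+1$ positions at which a part $1$ can be inserted into $\lambda_j$, of the triple obtained by replacing $D$ by $E$ and inserting that part; - $\partial_3$ is the sum over $j$ of all triples obtained by replacing two adjacent parts of $\lambda_j$ by their sum; - $\partial_4$ is the sum, over the $j$ with $\lambda_j\neq\emptyset$, of the triple obtained by deleting the first part of $\lambda_j$ and the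 triple obtained by deleting the last part of $\lambda_j$ (and $\vec N$ is adjusted accordingly). For a ring $R$ let $R^{2^n}$ denote the graded module with $R^{\binom nk}$ in degree $k$, and $R[U]$ the graded module with $R$ in every nonnegative even degree and $0$ in every odd degree. Then $(\mathit{CDP}_*,\partial)$ is a chain complex, and: 1. There is an increasing exhaustive filtration of $\mathit{CDP}_*$ by subcomplexes $F_p$, indexed by a well-ordered set, each $F_p$ being spanned in every degree by triples $(D,\vec N,\vec\lambda)$, such that the homology of the associated graded complex $\bigoplus_p F_p/\bigcup_{q<p}F_q$ is isomorphic, as a graded $\mathbb Z/2$-vector space, to $(\mathbb Z/2)^{2^n}\otimes(\mathbb Z/2)[U]$. 2. For every $k\ge 0$, the rank of $H_k(\mathit{CDP}_*;\mathbb Z/2)$ is at most $\displaystyle\sum_{l=0}^{\lfloor k/2\rfloor}\binom{n}{k-2l}$. -/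

import Mathlib

open CategoryTheory
open scoped TensorProduct DirectSum

/-! ### Grid diagrams, generators, domains -/

/-- An index `n` toroidal grid diagram. Columns and rows of squares are both indexed cyclically by
`Fin n`: column `i` lies between the vertical circles `β i` and `β (i + 1)`, row `j` between the
horizontal circles `α j` and `α (j + 1)`. The marking `O_t` lies in column `oCol t` and row
`oRow t`, and `X_t` in column `xCol t` and row `xRow t`; bijectivity says that every row and every
column contains exactly one `O` and exactly one `X`. -/
structure GridDiagram (n : ℕ) where
  oCol : Equiv.Perm (Fin n)
  oRow : Equiv.Perm (Fin n)
  xCol : Equiv.Perm (Fin n)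
  xRow : Equiv.Perm (Fin n)

namespace Grid

/-- A generator: the permutation `x` stands for the points `β i ∩ α (x i)`. -/
abbrev Generator (n : ℕ) : Type := Equiv.Perm (Fin n)

/-- An integral linear combination of squares; `D i j` is the coefficient of the square in column
`i` and row `j`. -/
abbrev TwoChain (n : ℕ) : Type := Fin n → Fin n → ℤ

variable {n : ℕ} [NeZero n]

/-- `D` is a domain from `x` to `y`, that is `∂(∂D ∩ α) = y - x`. The edge of `α j` from `β i` to
`β (i + 1)` has coefficient `D i j - D i (j - 1)` in `∂D`, so the left-hand side below is the
coefficient of the point `β i ∩ α j` in `∂(∂D ∩ α)`. -/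
def IsDomain (x y : Generator n) (D : TwoChain n) : Prop :=
  ∀ i j : Fin n,
    (D (i - 1) j - D (i - 1) (j - 1)) - (D i j - D i (j - 1)) =
      (if y i = j then 1 else 0) - (if x i = j then 1 else 0)

/-- `D` is a positive domain from `x` to `y`: no coefficient is negative. -/
def IsPosDomain (x y : Generator n) (D : TwoChain n) : Prop :=
  IsDomain x y D ∧ ∀ i j, 0 ≤ D i j

/-- The sum over the points `p` of the generator `x` of the average of the coefficients of `D` in
the four squares around `p`. -/
def pointMeasure (x : Generator n) (D : TwoChain n) : ℚ :=
  ∑ i : Fin n,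
    ((D i (x i) + D (i - 1) (x i) + D i (x i - 1) + D (i - 1) (x i - 1) : ℤ) : ℚ) / 4

/-- The Maslov index of a domain `D` from `x` to `y` on a torus grid, by Lipshitz's formula
`μ(D) = e(D) + n_x(D) + n_y(D)`; the Euler measure `e(D)` vanishes, since every square has Euler
measure zero. -/
def maslov (x y : Generator n) (D : TwoChain n) : ℚ :=
  pointMeasure x D + pointMeasure y D

/-- `InArc a b c`: the interval `[c, c + 1]` lies on the arc going in the positive direction from
`a` to `b` on the circle with `n` marked points. -/
def InArc (a b c : Fin n) : Prop := c - a < b - a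

open Classical in
/-- The embedded rectangle with bottom left corner `β a ∩ α (x a)` and top right corner
`β b ∩ α (x b)`, as a 2-chain. -/
noncomputable def rectChain (x : Generator n) (a b : Fin n) : TwoChain n :=
  fun i j => if InArc a b i ∧ InArc (x a) (x b) j then 1 else 0

/-- The rectangle `rectChain x a b` contains none of the other `n - 2` points of `x`; it is then a
rectangle from `x` to `x * Equiv.swap a b`. Every rectangle from `x` arises from exactly one such
ordered pair of distinct `a`, `b`. -/
def IsRect (x : Generator n) (a b : Fin n) : Prop :=
  a ≠ b ∧ ∀ i, i ≠ a → i ≠ b → ¬ (InArc a b i ∧ InArc (x a) (x b) (x i))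

/-- The horizontal annulus through `O_t`. -/
def hAnnulus (G : GridDiagram n) (t : Fin n) : TwoChain n :=
  fun _ j => if j = G.oRow t then 1 else 0

/-- The vertical annulus through `O_t`. -/
def vAnnulus (G : GridDiagram n) (t : Fin n) : TwoChain n :=
  fun i _ => if i = G.oCol t then 1 else 0

/-! ### Ordered partitions: lists of positive integers -/

/-- An ordered partition of `N` is a list of positive integers with sum `N`. -/
abbrev OrderedPartition : Type := List ℕ+

/-- The unit enlargements: insert a part `1` at one of the `l(λ) + 1` positions (listed by
position, so with multiplicity). -/
def unitEnlargements (l : OrderedPartition) : List OrderedPartition :=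
  (List.range (l.length + 1)).map fun k => l.insertIdx k 1

/-- The elementary coarsenings: replace two adjacent parts by their sum. -/
def coarsenings : OrderedPartition → List OrderedPartition
  | a :: b :: t => ((a + b) :: t) :: (coarsenings (b :: t)).map (fun m => a :: m)
  | _ => []

/-- The initial reduction (delete the first part) and the final reduction (delete the last part);
there are none if the partition is empty. -/
def reductions : OrderedPartition → List OrderedPartition
  | [] => []
  | a :: t => [t, (a :: t).dropLast]

/-! ### The complex of positive domains with partitions -/

/-- The triples `(D, N, λ)`: a positive domain `D` from `x` to `y`, and an `n`-tuple of ordered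
partitions; `N j` is the sum of the parts of `part j` and so is not recorded separately. -/
@[ext]
structure Triple (n : ℕ) [NeZero n] where
  x : Generator n
  y : Generator n
  D : TwoChain n
  pos : IsPosDomain x y D
  part : Fin n → OrderedPartition

/-- The grading: Maslov index of the domain plus total length of the partitions. -/
def Triple.degree (T : Triple n) : ℚ :=
  maslov T.x T.y T.D + ∑ j, ((T.part j).length : ℚ)

open Classical in
/-- The triple with the given entries as a basis element, or `0` if `D` is not a positive domain
from `x` to `y`. -/
noncomputable def basisElt (x y : Generator n) (D : TwoChain n) (l : Fin n → OrderedPartition) :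
    Triple n →₀ ZMod 2 :=
  if h : IsPosDomain x y D then Finsupp.single ⟨x, y, D, h, l⟩ 1 else 0

open Classical in
/-- Type I terms: decompositions `D = R * E` (where `R` goes from `T.x` to `T.x * swap a b`), and
decompositions `D = E * R` (where `R` goes from `T.y * swap a b` to `T.y`), `R` a rectangle. -/
noncomputable def boundaryI (T : Triple n) : Triple n →₀ ZMod 2 :=
  (∑ a : Fin n, ∑ b : Fin n,
    if IsRect T.x a b then
      basisElt (T.x * Equiv.swap a b) T.y (T.D - rectChain T.x a b) T.part else 0) +
  ∑ a : Fin n, ∑ b : Fin n,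
    if IsRect (T.y * Equiv.swap a b) a b then
      basisElt T.x (T.y * Equiv.swap a b) (T.D - rectChain (T.y * Equiv.swap a b) a b) T.part
    else 0

/-- Type II terms: remove a horizontal or vertical annulus through `O_j` and perform a unit
enlargement of the `j`-th partition. -/
noncomputable def boundaryII (G : GridDiagram n) (T : Triple n) : Triple n →₀ ZMod 2 :=
  ∑ j : Fin n,
    ((unitEnlargements (T.part j)).map fun l =>
      basisElt T.x T.y (T.D - hAnnulus G j) (Function.update T.part j l) +
      basisElt T.x T.y (T.D - vAnnulus G j) (Function.update T.part j l)).sum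

/-- Type III terms: elementary coarsenings. -/
noncomputable def boundaryIII (T : Triple n) : Triple n →₀ ZMod 2 :=
  ∑ j : Fin n,
    ((coarsenings (T.part j)).map fun l =>
      basisElt T.x T.y T.D (Function.update T.part j l)).sum

/-- Type IV terms: initial and final reductions. -/
noncomputable def boundaryIV (T : Triple n) : Triple n →₀ ZMod 2 :=
  ∑ j : Fin n,
    ((reductions (T.part j)).map fun l =>
      basisElt T.x T.y T.D (Function.update T.part j l)).sum

/-- The differential of a triple. -/
noncomputable def boundary (G : GridDiagram n) (T : Triple n) : Triple n →₀ ZMod 2 :=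
  boundaryI T + boundaryII G T + boundaryIII T + boundaryIV T

/-- The triples of grading `k`. -/
abbrev triplesOfDegree (n : ℕ) [NeZero n] (k : ℕ) : Set (Triple n) := {T | T.degree = k}

/-- `CDP_k`, freely generated over `ℤ/2` by the triples of grading `k`. -/
abbrev CDPModule (n : ℕ) [NeZero n] (k : ℕ) : Type := triplesOfDegree n k →₀ ZMod 2

/-- The differential `∂ : CDP_{k+1} → CDP_k`. -/
noncomputable def cdpD (G : GridDiagram n) (k : ℕ) : CDPModule n (k + 1) →ₗ[ZMod 2] CDPModule n k :=
  Finsupp.lsubtypeDomain (triplesOfDegree n k) ∘ₗ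
    Finsupp.linearCombination (ZMod 2) fun T : triplesOfDegree n (k + 1) => boundary G T.1

/-- The chain complex `CDP_*` of a grid diagram, given the fact that its differential squares to
zero. -/
noncomputable def CDP (G : GridDiagram n) (h : ∀ k, cdpD G k ∘ₗ cdpD G (k + 1) = 0) :
    ChainComplex (ModuleCat.{0} (ZMod 2)) ℕ :=
  ChainComplex.of (fun k => ModuleCat.of (ZMod 2) (CDPModule n k))
    (fun k => ModuleCat.ofHom (cdpD G k))
    (fun k => by rw [← ModuleCat.ofHom_comp, h k]; rfl)

end Grid

/-! ### Filtrations and associated graded complexes -/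

/-- An increasing exhaustive filtration of a chain complex by subcomplexes, indexed by a linearly
ordered type. -/
structure ChainFiltration {R : Type} [CommRing R] (C : ChainComplex (ModuleCat.{0} R) ℕ)
    (P : Type) [LinearOrder P] where
  sub : P → ∀ k, Submodule R (C.X k)
  mono : ∀ p q, p ≤ q → ∀ k, sub p k ≤ sub q k
  d_mem : ∀ p k, ∀ v ∈ sub p (k + 1), (C.d (k + 1) k).hom v ∈ sub p k
  exhaustive : ∀ k (v : C.X k), ∃ p, v ∈ sub p k

namespace ChainFiltration

variable {R : Type} [CommRing R] {C : ChainComplex (ModuleCat.{0} R) ℕ} {P : Type} [LinearOrder P]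
  (F : ChainFiltration C P)

/-- `F_{<p}`, the union of the `F_q` with `q < p` (zero if there are none). -/
def subLT (p : P) (k : ℕ) : Submodule R (C.X k) := ⨆ q : {q : P // q < p}, F.sub q.1 k

theorem d_mem_subLT (p : P) (k : ℕ) (v : C.X (k + 1)) (hv : v ∈ F.subLT p (k + 1)) :
    (C.d (k + 1) k).hom v ∈ F.subLT p k := by
  have h : F.subLT p (k + 1) ≤ (F.subLT p k).comap (C.d (k + 1) k).hom := by
    refine iSup_le fun q w hw => ?_
    exact Submodule.mem_iSup_of_mem (p := fun q : {q : P // q < p} => F.sub q.1 k) q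
      (F.d_mem q.1 k w hw)
  exact h hv

/-- The degree `k` part of `F_p / F_{<p}`. -/
abbrev GrPiece (p : P) (k : ℕ) : Type :=
  F.sub p k ⧸ (F.subLT p k).comap (F.sub p k).subtype

/-- The differential induced on `F_p / F_{<p}`. -/
def grD (p : P) (k : ℕ) : F.GrPiece p (k + 1) →ₗ[R] F.GrPiece p k :=
  Submodule.mapQ _ _ ((C.d (k + 1) k).hom.restrict (F.d_mem p k))
    (fun v hv => F.d_mem_subLT p k v.1 hv)

theorem grD_comp (p : P) (k : ℕ) : F.grD p k ∘ₗ F.grD p (k + 1) = 0 := by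
  ext v
  have h : (C.d (k + 1) k).hom ((C.d (k + 1 + 1) (k + 1)).hom v.1) = 0 := by
    rw [← LinearMap.comp_apply, ← ModuleCat.hom_comp, C.d_comp_d]; rfl
  have h' : (C.d (k + 1) k).hom.restrict (F.d_mem p k)
      ((C.d (k + 1 + 1) (k + 1)).hom.restrict (F.d_mem p (k + 1)) v) = 0 := Subtype.ext h
  change Submodule.Quotient.mk ((C.d (k + 1) k).hom.restrict (F.d_mem p k)
      ((C.d (k + 1 + 1) (k + 1)).hom.restrict (F.d_mem p (k + 1)) v)) = 0
  rw [h', Submodule.Quotient.mk_zero]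

/-- The associated graded complex, the direct sum over `p` of the complexes `F_p / F_{<p}`. -/
noncomputable def assocGraded : ChainComplex (ModuleCat.{0} R) ℕ :=
  ChainComplex.of (fun k => ModuleCat.of R (⨁ p, F.GrPiece p k))
    (fun k => ModuleCat.ofHom (DirectSum.lmap fun p => F.grD p k))
    (fun k => by
      rw [← ModuleCat.ofHom_comp, ← DirectSum.lmap_comp]
      simp only [F.grD_comp]
      congr 1
      ext p v q
      simp)

end ChainFiltration

/-- Every stage of the filtration of `CDP_*` is spanned by the triples `(D, N, λ)` it contains; in
other words, the filtration comes from assigning filtration levels to these triples. -/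
def Grid.SpannedByTriples {n : ℕ} [NeZero n] {G : GridDiagram n}
    {h : ∀ k, Grid.cdpD G k ∘ₗ Grid.cdpD G (k + 1) = 0} {P : Type} [LinearOrder P]
    (F : ChainFiltration (Grid.CDP G h) P) : Prop :=
  ∀ p k, F.sub p k = Submodule.span (ZMod 2)
    {v | v ∈ F.sub p k ∧
      ∃ T : Grid.triplesOfDegree n k, v = (Finsupp.single T 1 : Grid.CDPModule n k)}

/-! ### The graded module `(ℤ/2)^{2^n} ⊗ (ℤ/2)[U]` -/

/-- The degree `i` part `R ^ (n choose i)` of the graded module `R^{2^n}`. -/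
abbrev cubePiece (R : Type) (n i : ℕ) : Type := Fin (n.choose i) → R

/-- The degree `j` part of `R[U]`: one copy of `R` if `j` is even, and `0` otherwise. -/
abbrev polyUPiece (R : Type) (j : ℕ) : Type := Fin (if Even j then 1 else 0) → R

/-- The degree `k` part of the graded tensor product `R^{2^n} ⊗ R[U]`. -/
abbrev cubeTensorPolyU (R : Type) [CommRing R] (n k : ℕ) : Type :=
  ⨁ ij : Finset.HasAntidiagonal.antidiagonal k, cubePiece R n ij.1.1 ⊗[R] polyUPiece R ij.1.2

/-! Both assertions come from an acyclic matching (discrete Morse theory) on the basis of triples.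
Each triple gets a level in a well-ordered set. The differential of an `up` triple is its partner
plus terms of smaller level, and that of any other triple has only terms of smaller level. The
filtration by level therefore has the matching itself as its graded differential, and the homology
of the associated graded complex is free on the unmatched (critical) triples:
`nonempty_assocGraded_homology_equiv`. The rank bound `rank_homology_le` needs no spectral sequence:
modulo boundaries a cycle can be freed of `down` terms, and it is then determined by its critical
coefficients.

The matching removes or adds a rectangle of width or height one at the initial generator `x`. The
torus is cut along its last row and last column. The row or column of the thin rectangle
(`selector`) depends only on the last column of `D`, the last row of `D` and the final generator
`y`: a row where the last column of `D` increases; failing that, a column where the last row of `D`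
becomes nonzero; failing that, a descent of `y`. In each case positivity of `D` makes the thin
rectangle removable as soon as it avoids the relevant cut (`rectChain_le`), and its removal changes
neither the level nor the selector (`domLevel_rectChain`). Acyclicity holds because any other
rectangle at the start which keeps the level avoids the cuts that matter and keeps `x` of `up` type
(`isUp_of_isRect`), while all remaining faces of the same level and selector keep `x`. There is no
selector exactly when `x = y = 1` and `D` is a multiple of the last column (`eq_of_selector_none`,
`critTriple_sel`).

For these domains the partitions are matched: in the first `λ_j` other than `[]` and `[1]`, an
initial part `1` is merged with the next part. What remains is `m` copies of the last column
together with a choice, for each `j`, of `[]` or `[1]`. Such a triple has degree `2m` plus the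
number of parts, so degree `k` contains `∑ l, n.choose (k - 2 * l)` critical triples.

That `∂² = 0` is proved for operators on functions of the data of a triple (`funD_mul_funD`).
Removing two rectangles at the start gives, by the usual regrouping of two-rectangle domains, the
sum over all rows and columns; so does removing two at the end, and the two sums cancel over `ℤ/2`.
Inserting a part `1` commutes with coarsening and reduction, because the identity terms produced by
the initial and by the final reduction cancel each other. -/

set_option linter.unusedSectionVars false
set_option linter.unusedSimpArgs false

/-! ### Homology of complexes of free modules -/

namespace FreeComplex

variable {R : Type} [CommRing R] {S : ℕ → Type}

/-- The cycles in degree `k` of a sequence of differentials. -/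
noncomputable def cycles (d : ∀ k, (S (k + 1) →₀ R) →ₗ[R] (S k →₀ R)) :
    ∀ k, Submodule R (S k →₀ R)
  | 0 => ⊤
  | k + 1 => LinearMap.ker (d k)

/-- The boundaries in degree `k`. -/
noncomputable def boundaries (d : ∀ k, (S (k + 1) →₀ R) →ₗ[R] (S k →₀ R)) (k : ℕ) :
    Submodule R (S k →₀ R) :=
  LinearMap.range (d k)

/-- The quotient of a submodule `Z` by the elements of a submodule `B`. -/
abbrev Subquotient {V : Type} [AddCommGroup V] [Module R V] (Z B : Submodule R V) : Type :=
  Z ⧸ B.comap Z.subtype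

/-- The homology in degree `k`. -/
abbrev Homology (d : ∀ k, (S (k + 1) →₀ R) →ₗ[R] (S k →₀ R)) (k : ℕ) : Type :=
  Subquotient (cycles d k) (boundaries d k)

/-- The homology of a chain complex of modules as cycles modulo boundaries. -/
theorem nonempty_homology_equiv (K : ChainComplex (ModuleCat.{0} R) ℕ)
    (d : ∀ k, (S (k + 1) →₀ R) →ₗ[R] (S k →₀ R))
    (e : ∀ k, K.X k ≃ₗ[R] (S k →₀ R))
    (he : ∀ k v, e k ((K.d (k + 1) k).hom v) = d k (e (k + 1) v)) (k : ℕ) :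
    Nonempty (K.homology k ≃ₗ[R] Homology d k) := by
  obtain ⟨j, hj⟩ : ∃ j, (ComplexShape.down ℕ).next k = j := ⟨_, rfl⟩
  have hi : (ComplexShape.down ℕ).prev k = k + 1 := by simp
  have hker : ∀ v, v ∈ LinearMap.ker (K.d k j).hom ↔ e k v ∈ cycles d k := by
    intro v
    cases k with
    | zero =>
      -- In degree 0 the complex shape has no successor and `next` returns the index itself, so the
      -- outgoing map is `K.d 0 0 = 0` and everything is a cycle.
      have hj0 : j = 0 := by rw [← hj]; simp
      subst hj0
      have : K.d 0 0 = 0 := K.shape _ _ (by simp)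
      simp [cycles]
    | succ k =>
      have hj0 : j = k := by rw [← hj]; simp
      subst hj0
      rw [cycles, LinearMap.mem_ker, LinearMap.mem_ker, ← he, LinearEquiv.map_eq_zero_iff]
  let f : LinearMap.ker (K.d k j).hom ≃ₗ[R] cycles d k :=
    (e k).ofSubmodules _ _ (by
      ext w
      rw [Submodule.mem_map]
      constructor
      · rintro ⟨v, hv, rfl⟩
        exact (hker v).1 hv
      · intro hw
        exact ⟨(e k).symm w, (hker _).2 (by simpa using hw), by simp⟩)
  refine ⟨((K.homologyIsoSc' (k + 1) k j hi hj).toLinearEquiv.trans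
    (K.sc' (k + 1) k j).moduleCatHomologyIso.toLinearEquiv).trans
    (Submodule.Quotient.equiv _ _ f ?_)⟩
  ext w
  rw [Submodule.mem_map]
  constructor
  · rintro ⟨v, ⟨u, rfl⟩, rfl⟩
    exact ⟨e (k + 1) u, (he k u).symm⟩
  · rintro ⟨u, hu⟩
    refine ⟨f.symm w, ⟨(e (k + 1)).symm u, ?_⟩, f.apply_symm_apply w⟩
    apply f.injective
    apply Subtype.ext
    have h := he k ((e (k + 1)).symm u)
    rw [LinearEquiv.apply_symm_apply, hu] at h
    exact h.trans (congrArg Subtype.val (f.apply_symm_apply w)).symm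

end FreeComplex

/-! ### Acyclic matchings -/

/-- An acyclic matching on the bases `S k` of the chain modules: basis elements are matched in pairs
(`up` with its `partner`, which is `down`) of the same level, and the differential of a basis
element is, up to elements of lower level, its partner or zero. -/
structure AcyclicMatching {R : Type} [CommRing R] {S : ℕ → Type}
    (d : ∀ k, (S (k + 1) →₀ R) →ₗ[R] (S k →₀ R)) (P : Type) [LinearOrder P] where
  lev : ∀ k, S k → P
  up : ∀ k, S k → Prop
  down : ∀ k, S k → Prop
  partner : ∀ k, S (k + 1) → S k
  not_up_zero : ∀ s, ¬ up 0 s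
  not_down_of_up : ∀ k s, up k s → ¬ down k s
  down_partner : ∀ k s, up (k + 1) s → down k (partner k s)
  lev_partner : ∀ k s, up (k + 1) s → lev k (partner k s) = lev (k + 1) s
  partner_inj : ∀ k s t, up (k + 1) s → up (k + 1) t → partner k s = partner k t → s = t
  exists_partner : ∀ k t, down k t → ∃ s, up (k + 1) s ∧ partner k s = t
  d_up : ∀ k s, up (k + 1) s → d k (Finsupp.single s 1) - Finsupp.single (partner k s) 1 ∈
    Finsupp.supported R R {t | lev k t < lev (k + 1) s}
  d_not_up : ∀ k s, ¬ up (k + 1) s → d k (Finsupp.single s 1) ∈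
    Finsupp.supported R R {t | lev k t < lev (k + 1) s}

namespace AcyclicMatching

open FreeComplex

variable {R : Type} [CommRing R] {S : ℕ → Type}
  {d : ∀ k, (S (k + 1) →₀ R) →ₗ[R] (S k →₀ R)} {P : Type} [LinearOrder P]
  (M : AcyclicMatching d P)

/-- The unmatched basis elements. -/
def crit (k : ℕ) : Set (S k) := {s | ¬ M.up k s ∧ ¬ M.down k s}

/-- Modulo the boundary of its matched `up` element, a `down` element is a combination of elements
of smaller level; well-founded recursion on the level eliminates all of them. -/
theorem boundaries_sup_supported [WellFoundedLT P] (k : ℕ) :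
    boundaries d k ⊔ Finsupp.supported R R {s | ¬ M.down k s} = ⊤ := by
  have key : ∀ p, ∀ s, M.lev k s = p → Finsupp.single s (1 : R) ∈
      boundaries d k ⊔ Finsupp.supported R R {s | ¬ M.down k s} := by
    intro p
    induction p using WellFoundedLT.induction with
    | ind p ih =>
      intro s hs
      by_cases hd : M.down k s
      · obtain ⟨u, hu, rfl⟩ := M.exists_partner k s hd
        have h1 := M.d_up k u hu
        rw [Finsupp.supported_eq_span_single] at h1
        have h2 : Submodule.span R ((fun i => Finsupp.single i (1 : R)) ''
            {t | M.lev k t < M.lev (k + 1) u}) ≤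
            boundaries d k ⊔ Finsupp.supported R R {s | ¬ M.down k s} := by
          rw [Submodule.span_le]
          rintro _ ⟨t, ht, rfl⟩
          refine ih _ ?_ t rfl
          rw [← hs, M.lev_partner k u hu]
          exact ht
        have h3 := h2 h1
        have h4 : d k (Finsupp.single u 1) ∈
            boundaries d k ⊔ Finsupp.supported R R {s | ¬ M.down k s} :=
          Submodule.mem_sup_left ⟨_, rfl⟩
        simpa using Submodule.sub_mem _ h4 h3
      · exact Submodule.mem_sup_right (Finsupp.single_mem_supported _ _ hd)
  rw [eq_top_iff]
  rintro v -
  induction v using Finsupp.induction_linear with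
  | zero => exact Submodule.zero_mem _
  | add f g hf hg => exact Submodule.add_mem _ hf hg
  | single s c =>
    rw [← mul_one c, ← smul_eq_mul, ← Finsupp.smul_single]
    exact Submodule.smul_mem _ _ (key _ s rfl)

/-- Take `s` of maximal level in the support. The coefficient of its partner in `d w` is `w s`: any
other `t` in the support contributes a different partner and terms of level below that of `s`, which
is also the level of the partner. -/
theorem eq_zero_of_supported_up (k : ℕ) (w : S k →₀ R)
    (hw : w ∈ Finsupp.supported R R {s | M.up k s}) (hc : w ∈ cycles d k) : w = 0 := by
  classical
  rw [Finsupp.mem_supported] at hw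
  cases k with
  | zero =>
    ext s
    by_contra h
    exact M.not_up_zero s (hw (Finsupp.mem_support_iff.2 h))
  | succ k =>
    by_contra hne
    obtain ⟨s, hs, hmax⟩ := w.support.exists_max_image (M.lev (k + 1))
      (Finsupp.support_nonempty_iff.2 hne)
    have hd : d k w = 0 := hc
    have hsum : d k w = w.sum fun t c => c • d k (Finsupp.single t 1) := by
      conv_lhs => rw [← Finsupp.sum_single w]
      rw [Finsupp.sum, map_sum]
      refine Finset.sum_congr rfl fun t _ => ?_
      simp only [← map_smul, Finsupp.smul_single, smul_eq_mul, mul_one]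
    have hcoef : (d k w) (M.partner k s) = w s := by
      rw [hsum, Finsupp.sum, Finsupp.finsetSum_apply, Finset.sum_eq_single s]
      · have h := (Finsupp.mem_supported' R _).1 (M.d_up k s (hw hs)) (M.partner k s)
          (by simp [M.lev_partner k s (hw hs)])
        rw [Finsupp.sub_apply, Finsupp.single_eq_same, sub_eq_zero] at h
        simp [h]
      · intro t ht hts
        have h := (Finsupp.mem_supported' R _).1 (M.d_up k t (hw ht)) (M.partner k s)
          (by simp [M.lev_partner k s (hw hs), hmax t ht])
        rw [Finsupp.sub_apply, Finsupp.single_eq_of_ne, sub_zero] at h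
        · simp [h]
        · exact fun e => hts (M.partner_inj k s t (hw hs) (hw ht) e).symm
      · exact fun h => absurd hs h
    rw [hd] at hcoef
    exact Finsupp.mem_support_iff.1 hs hcoef.symm

/-- A cycle without `down` terms is determined by its critical terms. -/
theorem eq_zero_of_crit (k : ℕ) (w : S k →₀ R)
    (hw : w ∈ Finsupp.supported R R {s | ¬ M.down k s}) (hc : w ∈ cycles d k)
    (h0 : ∀ s ∈ M.crit k, w s = 0) : w = 0 := by
  refine M.eq_zero_of_supported_up k w ?_ hc
  rw [Finsupp.mem_supported'] at hw ⊢
  intro s hs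
  by_cases hd : M.down k s
  · exact hw s (by simpa using hd)
  · exact h0 s ⟨hs, hd⟩

/-- Restriction of a chain to its critical terms. -/
noncomputable def critPart (k : ℕ) : (S k →₀ R) →ₗ[R] (M.crit k →₀ R) :=
  Finsupp.lsubtypeDomain (M.crit k)

/-- The cycles without `down` terms surject onto the homology and inject into the free module on the
critical elements. -/
theorem rank_homology_le [Nontrivial R] [WellFoundedLT P] (k : ℕ)
    (hdd : boundaries d k ≤ cycles d k) :
    Module.rank R (Homology d k) ≤ Cardinal.mk (M.crit k) := by
  let Z : Submodule R (S k →₀ R) := cycles d k ⊓ Finsupp.supported R R {s | ¬ M.down k s}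
  let π : Z →ₗ[R] Homology d k :=
    (Submodule.mkQ _) ∘ₗ Submodule.inclusion (inf_le_left : Z ≤ cycles d k)
  have hπ : Function.Surjective π := by
    intro q
    obtain ⟨z, rfl⟩ := Submodule.mkQ_surjective _ q
    have hz : (z : S k →₀ R) ∈
        boundaries d k ⊔ Finsupp.supported R R {s | ¬ M.down k s} := by
      rw [M.boundaries_sup_supported k]; trivial
    obtain ⟨b, hb, w, hw, hbw⟩ := Submodule.mem_sup.1 hz
    have hwc : w ∈ cycles d k := by
      rw [show w = z - b by rw [← hbw]; abel]
      exact Submodule.sub_mem _ z.2 (hdd hb)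
    refine ⟨⟨w, hwc, hw⟩, ?_⟩
    change Submodule.Quotient.mk _ = Submodule.Quotient.mk _
    rw [eq_comm, Submodule.Quotient.eq]
    change (z : S k →₀ R) - w ∈ boundaries d k
    rw [← hbw, add_sub_cancel_right]
    exact hb
  have hinj : Function.Injective (M.critPart k ∘ₗ Z.subtype) := by
    refine (injective_iff_map_eq_zero _).2 fun w hw => ?_
    refine Subtype.ext (M.eq_zero_of_crit k w w.2.2 w.2.1 fun s hs => ?_)
    exact DFunLike.congr_fun hw (⟨s, hs⟩ : M.crit k)
  calc Module.rank R (Homology d k) ≤ Module.rank R Z := LinearMap.rank_le_of_surjective π hπ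
    _ ≤ Module.rank R (M.crit k →₀ R) := LinearMap.rank_le_of_injective _ hinj
    _ = Cardinal.mk (M.crit k) := by rw [rank_finsupp_self]; simp

/-- The differential of the matching: the partner on `up` elements, zero on the other ones. -/
noncomputable def gradedD (k : ℕ) : (S (k + 1) →₀ R) →ₗ[R] (S k →₀ R) :=
  open Classical in
  Finsupp.linearCombination R fun s =>
    if M.up (k + 1) s then Finsupp.single (M.partner k s) 1 else 0

theorem gradedD_single_of_up (k : ℕ) (s : S (k + 1)) (hs : M.up (k + 1) s) :
    M.gradedD k (Finsupp.single s 1) = Finsupp.single (M.partner k s) 1 := by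
  simp [gradedD, hs]

theorem gradedD_single_of_not_up (k : ℕ) (s : S (k + 1)) (hs : ¬ M.up (k + 1) s) :
    M.gradedD k (Finsupp.single s 1) = 0 := by
  simp [gradedD, hs]

/-- The matching as an acyclic matching of its own differential. -/
noncomputable def graded : AcyclicMatching M.gradedD P where
  lev := M.lev
  up := M.up
  down := M.down
  partner := M.partner
  not_up_zero := M.not_up_zero
  not_down_of_up := M.not_down_of_up
  down_partner := M.down_partner
  lev_partner := M.lev_partner
  partner_inj := M.partner_inj
  exists_partner := M.exists_partner
  d_up k s hs := by rw [M.gradedD_single_of_up k s hs, sub_self]; exact Submodule.zero_mem _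
  d_not_up k s hs := by rw [M.gradedD_single_of_not_up k s hs]; exact Submodule.zero_mem _

theorem range_gradedD (k : ℕ) :
    boundaries M.gradedD k = Finsupp.supported R R {s | M.down k s} := by
  apply le_antisymm
  · rintro _ ⟨v, rfl⟩
    induction v using Finsupp.induction_linear with
    | zero => simp
    | add f g hf hg => rw [map_add]; exact Submodule.add_mem _ hf hg
    | single s c =>
      rw [← mul_one c, ← smul_eq_mul, ← Finsupp.smul_single, map_smul]
      refine Submodule.smul_mem _ _ ?_
      by_cases hs : M.up (k + 1) s
      · rw [M.gradedD_single_of_up k s hs]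
        exact Finsupp.single_mem_supported _ _ (M.down_partner k s hs)
      · rw [M.gradedD_single_of_not_up k s hs]
        exact Submodule.zero_mem _
  · rw [Finsupp.supported_eq_span_single, Submodule.span_le]
    rintro _ ⟨t, ht, rfl⟩
    obtain ⟨s, hs, rfl⟩ := M.exists_partner k t ht
    exact ⟨_, M.gradedD_single_of_up k s hs⟩

theorem supported_not_up_le_cycles (k : ℕ) :
    Finsupp.supported R R {s | ¬ M.up k s} ≤ cycles M.gradedD k := by
  rw [Finsupp.supported_eq_span_single, Submodule.span_le]
  rintro _ ⟨t, ht, rfl⟩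
  cases k with
  | zero => trivial
  | succ k => exact M.gradedD_single_of_not_up k t ht

/-- The homology of the matching differential is free on the critical elements. -/
theorem nonempty_gradedD_homology_equiv (k : ℕ) :
    Nonempty (Homology M.gradedD k ≃ₗ[R] (M.crit k →₀ R)) := by
  classical
  let f : cycles M.gradedD k →ₗ[R] (M.crit k →₀ R) := M.critPart k ∘ₗ Submodule.subtype _
  have hf : Function.Surjective f := by
    intro w
    refine ⟨⟨Finsupp.lmapDomain R R Subtype.val w, ?_⟩, ?_⟩
    · apply M.supported_not_up_le_cycles k
      rw [Finsupp.mem_supported]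
      intro s hs
      have h := Finsupp.mapDomain_support hs
      obtain ⟨t, -, rfl⟩ := Finset.mem_image.1 h
      exact t.2.1
    · ext t
      exact Finsupp.mapDomain_apply Subtype.val_injective w t
  have hker : (boundaries M.gradedD k).comap (cycles M.gradedD k).subtype = LinearMap.ker f := by
    ext z
    rw [Submodule.mem_comap, M.range_gradedD, Submodule.subtype_apply, LinearMap.mem_ker]
    constructor
    · intro h
      ext t
      exact (Finsupp.mem_supported' R _).1 h t t.2.2
    · intro h
      -- The part `v` of `z` without `down` terms is again a cycle, since `down` elements are not
      -- `up` and so are killed by the graded differential. It has no critical terms, hence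
      -- vanishes.
      set v : S k →₀ R := z.1.filter fun s => ¬ M.down k s with hv
      have h2 : z.1.filter (fun s => M.down k s) + v = z.1 := Finsupp.filter_add_filter_not _ _
      have h1 : z.1.filter (fun s => M.down k s) ∈ Finsupp.supported R R {s | M.down k s} := by
        rw [Finsupp.mem_supported']
        intro s hs
        exact Finsupp.filter_apply_neg _ _ hs
      have h3 : v = 0 := by
        refine M.graded.eq_zero_of_crit k v ?_ ?_ ?_
        · rw [Finsupp.mem_supported']
          intro s hs
          exact Finsupp.filter_apply_neg _ _ hs
        · rw [eq_sub_of_add_eq' h2]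
          refine Submodule.sub_mem _ z.2 (M.supported_not_up_le_cycles k ?_)
          exact Finsupp.supported_mono (fun s hs hu => M.not_down_of_up k s hu hs) h1
        · intro s hs
          exact (Finsupp.filter_apply_pos (fun s => ¬ M.down k s) z.1 hs.2).trans
            (DFunLike.congr_fun h (⟨s, hs⟩ : M.crit k))
      rw [h3, add_zero] at h2
      rw [← h2]
      exact h1
  exact ⟨(Submodule.quotEquivOfEq _ _ hker).trans (f.quotKerEquivOfSurjective hf)⟩

end AcyclicMatching

/-! ### The filtration by level and its associated graded complex -/

namespace AcyclicMatching

open FreeComplex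

variable {R : Type} [CommRing R] {S : ℕ → Type}
  {d : ∀ k, (S (k + 1) →₀ R) →ₗ[R] (S k →₀ R)} {P : Type} [LinearOrder P]
  (M : AcyclicMatching d P)

theorem d_single_mem (k : ℕ) (s : S (k + 1)) : d k (Finsupp.single s 1) ∈
    Finsupp.supported R R {t | M.lev k t ≤ M.lev (k + 1) s} := by
  have hle : Finsupp.supported R R {t | M.lev k t < M.lev (k + 1) s} ≤
      Finsupp.supported R R {t | M.lev k t ≤ M.lev (k + 1) s} :=
    Finsupp.supported_mono fun t ht => le_of_lt ht
  by_cases hs : M.up (k + 1) s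
  · have h := Submodule.add_mem _ (hle (M.d_up k s hs))
      (Finsupp.single_mem_supported R (1 : R) (M.lev_partner k s hs).le)
    rwa [sub_add_cancel] at h
  · exact hle (M.d_not_up k s hs)

theorem d_mem_supported (p : P) (k : ℕ) (v : S (k + 1) →₀ R)
    (hv : v ∈ Finsupp.supported R R {s | M.lev (k + 1) s ≤ p}) :
    d k v ∈ Finsupp.supported R R {s | M.lev k s ≤ p} := by
  suffices h : Finsupp.supported R R {s | M.lev (k + 1) s ≤ p} ≤
      (Finsupp.supported R R {s | M.lev k s ≤ p}).comap (d k) from h hv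
  rw [Finsupp.supported_eq_span_single, Submodule.span_le]
  rintro _ ⟨s, hs, rfl⟩
  exact Finsupp.supported_mono (fun t ht => le_trans ht hs) (M.d_single_mem k s)

variable (K : ChainComplex (ModuleCat.{0} R) ℕ) (e : ∀ k, K.X k ≃ₗ[R] (S k →₀ R))
    (he : ∀ k v, e k ((K.d (k + 1) k).hom v) = d k (e (k + 1) v))

/-- The filtration by the level of a matching. -/
noncomputable def filtration [Nonempty P] : ChainFiltration K P where
  sub p k := (Finsupp.supported R R {s | M.lev k s ≤ p}).comap (e k).toLinearMap
  mono p q hpq k := Submodule.comap_mono (Finsupp.supported_mono fun _ hs => le_trans hs hpq)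
  d_mem p k v hv := by
    rw [Submodule.mem_comap, LinearEquiv.coe_coe, he]
    exact M.d_mem_supported p k _ hv
  exhaustive k v := by
    classical
    obtain ⟨p, hp⟩ := Finset.exists_le ((e k v).support.image (M.lev k))
    refine ⟨p, ?_⟩
    rw [Submodule.mem_comap, Finsupp.mem_supported]
    exact fun s hs => hp _ (Finset.mem_image_of_mem _ hs)

theorem mem_filtration_sub [Nonempty P] (p : P) (k : ℕ) (v : K.X k) :
    v ∈ (M.filtration K e he).sub p k ↔ e k v ∈ Finsupp.supported R R {s | M.lev k s ≤ p} :=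
  Iff.rfl

theorem mem_filtration_subLT [Nonempty P] (p : P) (k : ℕ) (v : K.X k) :
    v ∈ (M.filtration K e he).subLT p k ↔
      e k v ∈ Finsupp.supported R R {s | M.lev k s < p} := by
  have h : (M.filtration K e he).subLT p k =
      (Finsupp.supported R R {s | M.lev k s < p}).comap (e k).toLinearMap := by
    have hU : {s | M.lev k s < p} = ⋃ q : {q : P // q < p}, {s | M.lev k s ≤ q.1} := by
      ext s
      simp only [Set.mem_ofPred_eq, Set.mem_iUnion, Subtype.exists, exists_prop]
      exact ⟨fun h => ⟨_, h, le_rfl⟩, fun ⟨q, hq, hs⟩ => lt_of_le_of_lt hs hq⟩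
    have hcm : ∀ W : Submodule R (S k →₀ R), W.comap (e k).toLinearMap =
        W.map (e k).symm.toLinearMap := fun W =>
      (Submodule.map_equiv_eq_comap_symm (e k).symm W).symm
    rw [hU, Finsupp.supported_iUnion, hcm, Submodule.map_iSup]
    simp only [← hcm]
    rfl
  rw [h]
  rfl

/-- The part of level `p` of a chain. -/
noncomputable def levelPart (p : P) (k : ℕ) : (S k →₀ R) →ₗ[R] (S k →₀ R) :=
  open Classical in
  Submodule.subtype _ ∘ₗ Finsupp.restrictDom R R {s | M.lev k s = p}

theorem levelPart_single_of_eq {p : P} {k : ℕ} {s : S k} (h : M.lev k s = p) (c : R) :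
    M.levelPart p k (Finsupp.single s c) = Finsupp.single s c := by
  classical
  exact Finsupp.filter_single_of_pos _ h

theorem levelPart_of_lt {p : P} {k : ℕ} {v : S k →₀ R}
    (hv : v ∈ Finsupp.supported R R {s | M.lev k s < p}) : M.levelPart p k v = 0 := by
  classical
  refine Finsupp.filter_eq_zero_iff (fun s => M.lev k s = p) v |>.2 fun s hs => ?_
  exact (Finsupp.mem_supported' R v).1 hv s (by simp [hs])

theorem levelPart_single_of_lt {p : P} {k : ℕ} {s : S k} (h : M.lev k s < p) (c : R) :
    M.levelPart p k (Finsupp.single s c) = 0 :=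
  M.levelPart_of_lt (Finsupp.single_mem_supported _ _ h)

theorem supported_le_induction {p : P} {k : ℕ} {V : Type} [AddCommGroup V] [Module R V]
    (f g : Finsupp.supported R R {s | M.lev k s ≤ p} →ₗ[R] V)
    (h : ∀ s (hs : M.lev k s ≤ p), f ⟨Finsupp.single s 1, Finsupp.single_mem_supported _ _ hs⟩ =
      g ⟨Finsupp.single s 1, Finsupp.single_mem_supported _ _ hs⟩) : f = g := by
  let ε := Finsupp.supportedEquivFinsupp (M := R) (R := R) {s | M.lev k s ≤ p}
  suffices h' : f ∘ₗ ε.symm.toLinearMap = g ∘ₗ ε.symm.toLinearMap by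
    ext v
    have := LinearMap.congr_fun h' (ε v)
    simpa using this
  refine Finsupp.lhom_ext' fun s => LinearMap.ext_ring ?_
  have hε : ε.symm (Finsupp.single s 1) =
      ⟨Finsupp.single s.1 1, Finsupp.single_mem_supported _ _ s.2⟩ := by
    rw [LinearEquiv.symm_apply_eq]
    ext t
    change _ = (Finsupp.single s.1 (1 : R)) t.1
    classical
    simp [Finsupp.single_apply, Subtype.ext_iff]
  simpa [hε] using h s.1 s.2

section

variable [Nonempty P]

/-- A stage of the filtration as a space of chains. -/
noncomputable def subEquiv (p : P) (k : ℕ) : (M.filtration K e he).sub p k ≃ₗ[R]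
    Finsupp.supported R R {s | M.lev k s ≤ p} :=
  (e k).ofSubmodule' _

/-- The comparison map from a graded piece to the chains. -/
noncomputable def grPieceMap (p : P) (k : ℕ) :
    (M.filtration K e he).GrPiece p k →ₗ[R] (S k →₀ R) :=
  Submodule.liftQ _ (M.levelPart p k ∘ₗ (e k).toLinearMap ∘ₗ Submodule.subtype _)
    (fun v hv => M.levelPart_of_lt ((M.mem_filtration_subLT K e he p k v.1).1 hv))

/-- The comparison map from the associated graded complex to the chains. -/
noncomputable def assocGradedMap (k : ℕ) :
    (⨁ p, (M.filtration K e he).GrPiece p k) →ₗ[R] (S k →₀ R) :=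
  DirectSum.toModule R P _ fun p => M.grPieceMap K e he p k

/-- The class of a basis element in the graded piece of its level. -/
noncomputable def grClass (p : P) (k : ℕ) (s : S k) (hs : M.lev k s ≤ p) :
    (M.filtration K e he).GrPiece p k :=
  Submodule.Quotient.mk ((M.subEquiv K e he p k).symm
    ⟨Finsupp.single s 1, Finsupp.single_mem_supported _ _ hs⟩)

theorem grPieceMap_grClass (p : P) (k : ℕ) (s : S k) (hs : M.lev k s ≤ p) :
    M.grPieceMap K e he p k (M.grClass K e he p k s hs) =
      M.levelPart p k (Finsupp.single s 1) := by
  change M.levelPart p k (e k ((e k).symm _)) = _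
  rw [LinearEquiv.apply_symm_apply]
  rfl

theorem grPiece_hom_ext {p : P} {k : ℕ} {V : Type} [AddCommGroup V] [Module R V]
    (f g : (M.filtration K e he).GrPiece p k →ₗ[R] V)
    (h : ∀ s hs, f (M.grClass K e he p k s hs) = g (M.grClass K e he p k s hs)) : f = g := by
  refine Submodule.linearMap_qext _ ?_
  suffices h' : (f ∘ₗ Submodule.mkQ _) ∘ₗ (M.subEquiv K e he p k).symm.toLinearMap =
      (g ∘ₗ Submodule.mkQ _) ∘ₗ (M.subEquiv K e he p k).symm.toLinearMap by
    ext v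
    have := LinearMap.congr_fun h' (M.subEquiv K e he p k v)
    simpa using this
  exact M.supported_le_induction _ _ h

theorem grClass_of_lt (p : P) (k : ℕ) (s : S k) (hs : M.lev k s < p) :
    M.grClass K e he p k s hs.le = 0 := by
  refine (Submodule.Quotient.mk_eq_zero _).2 ?_
  rw [Submodule.mem_comap, M.mem_filtration_subLT]
  change e k ((e k).symm _) ∈ _
  rw [LinearEquiv.apply_symm_apply]
  exact Finsupp.single_mem_supported _ _ hs

/-- The inverse comparison map. -/
noncomputable def assocGradedInv (k : ℕ) :
    (S k →₀ R) →ₗ[R] (⨁ p, (M.filtration K e he).GrPiece p k) :=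
  Finsupp.linearCombination R fun s =>
    DirectSum.lof R P (fun p => (M.filtration K e he).GrPiece p k) (M.lev k s)
      (M.grClass K e he (M.lev k s) k s le_rfl)

/-- The associated graded complex has the basis `S k` in degree `k`. -/
noncomputable def assocGradedEquiv (k : ℕ) :
    (⨁ p, (M.filtration K e he).GrPiece p k) ≃ₗ[R] (S k →₀ R) :=
  LinearEquiv.ofLinearMap (M.assocGradedMap K e he k) (M.assocGradedInv K e he k)
    (by
      refine Finsupp.lhom_ext' fun s => LinearMap.ext_ring ?_
      simp [assocGradedInv, assocGradedMap, grPieceMap_grClass, levelPart_single_of_eq])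
    (by
      refine DirectSum.linearMap_ext _ fun p => ?_
      refine M.grPiece_hom_ext K e he (V := ⨁ p, (M.filtration K e he).GrPiece p k) _ _
        fun s hs => ?_
      simp only [LinearMap.comp_apply, LinearMap.id_apply, assocGradedMap,
        DirectSum.toModule_lof, grPieceMap_grClass]
      rcases hs.lt_or_eq with h | h
      · rw [M.levelPart_single_of_lt h, M.grClass_of_lt K e he p k s h, map_zero, map_zero]
      · subst h
        rw [M.levelPart_single_of_eq rfl]
        simp [assocGradedInv])

/-- Of the differential of a basis element of level `p`, only the partner has level `p`; every other
term lies below and dies in the graded piece. -/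
theorem assocGradedEquiv_d (k : ℕ) (v : ⨁ p, (M.filtration K e he).GrPiece p (k + 1)) :
    M.assocGradedEquiv K e he k
      (DirectSum.lmap (fun p => (M.filtration K e he).grD p k) v) =
      M.gradedD k (M.assocGradedEquiv K e he (k + 1) v) := by
  suffices h : M.assocGradedMap K e he k ∘ₗ
      (DirectSum.lmap fun p => (M.filtration K e he).grD p k) =
      M.gradedD k ∘ₗ M.assocGradedMap K e he (k + 1) from LinearMap.congr_fun h v
  refine DirectSum.linearMap_ext _ fun p => M.grPiece_hom_ext K e he _ _ fun s hs => ?_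
  simp only [LinearMap.comp_apply, assocGradedMap, DirectSum.lmap_lof,
    DirectSum.toModule_lof, grPieceMap_grClass]
  have h1 : M.grPieceMap K e he p k ((M.filtration K e he).grD p k
      (M.grClass K e he p (k + 1) s hs)) = M.levelPart p k (d k (Finsupp.single s 1)) := by
    change M.levelPart p k (e k ((K.d (k + 1) k).hom ((e (k + 1)).symm _))) = _
    rw [he, LinearEquiv.apply_symm_apply]
    rfl
  rw [h1]
  rcases hs.lt_or_eq with h | h
  · rw [M.levelPart_single_of_lt h, map_zero]
    exact M.levelPart_of_lt
      (Finsupp.supported_mono (fun t ht => lt_of_le_of_lt ht h) (M.d_single_mem k s))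
  · subst h
    rw [M.levelPart_single_of_eq rfl]
    by_cases hu : M.up (k + 1) s
    · rw [M.gradedD_single_of_up k s hu, ← sub_eq_zero,
        ← M.levelPart_single_of_eq (M.lev_partner k s hu), ← map_sub]
      exact M.levelPart_of_lt (M.d_up k s hu)
    · rw [M.gradedD_single_of_not_up k s hu]
      exact M.levelPart_of_lt (M.d_not_up k s hu)

/-- The homology of the associated graded complex is free on the critical elements. -/
theorem nonempty_assocGraded_homology_equiv (k : ℕ) :
    Nonempty ((M.filtration K e he).assocGraded.homology k ≃ₗ[R] (M.crit k →₀ R)) := by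
  obtain ⟨f⟩ := nonempty_homology_equiv (M.filtration K e he).assocGraded M.gradedD
    (fun k => M.assocGradedEquiv K e he k) (fun k v => by
      refine Eq.trans ?_ (M.assocGradedEquiv_d K e he k v)
      have h : (M.filtration K e he).assocGraded.d (k + 1) k =
          ModuleCat.ofHom (DirectSum.lmap fun p => (M.filtration K e he).grD p k) :=
        ChainComplex.of_d (fun k => ModuleCat.of R (⨁ p, (M.filtration K e he).GrPiece p k))
          (fun k => ModuleCat.ofHom (DirectSum.lmap fun p => (M.filtration K e he).grD p k)) k
      rw [h]
      rfl) k
  obtain ⟨g⟩ := M.nonempty_gradedD_homology_equiv k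
  exact ⟨f.trans g⟩

/-- The stages of the filtration are spanned by the basis elements they contain. -/
theorem filtration_sub_eq_span (p : P) (k : ℕ) :
    (M.filtration K e he).sub p k = Submodule.span R
      {v | v ∈ (M.filtration K e he).sub p k ∧ ∃ s, v = (e k).symm (Finsupp.single s 1)} := by
  apply le_antisymm
  · have h : (M.filtration K e he).sub p k =
        (Finsupp.supported R R {s | M.lev k s ≤ p}).map (e k).symm.toLinearMap :=
      (Submodule.map_equiv_eq_comap_symm (e k).symm _).symm
    conv_lhs => rw [h, Finsupp.supported_eq_span_single, Submodule.map_span]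
    refine Submodule.span_mono ?_
    rintro _ ⟨_, ⟨s, hs, rfl⟩, rfl⟩
    refine ⟨?_, s, rfl⟩
    rw [M.mem_filtration_sub]
    change e k ((e k).symm _) ∈ _
    rw [LinearEquiv.apply_symm_apply]
    exact Finsupp.single_mem_supported _ _ hs
  · rw [Submodule.span_le]
    exact fun v hv => hv.1

end

end AcyclicMatching

namespace Grid

variable {n : ℕ} [NeZero n]

/-! ### Arcs -/

theorem val_sub_one (i : Fin n) : ((i - 1 : Fin n) : ℕ) = if (i : ℕ) = 0 then n - 1 else (i : ℕ) - 1 := by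
  have hn := NeZero.pos n
  have hi := i.2
  rw [Fin.sub_def]
  change (n - (1 : Fin n).val + i) % n = _
  rw [Fin.val_one']
  rcases Nat.lt_or_ge 1 n with h | h
  · rw [Nat.mod_eq_of_lt h]
    split_ifs with h0
    · rw [h0, add_zero, Nat.mod_eq_of_lt (by omega)]
    · rw [show n - 1 + i = (i - 1) + n by omega, Nat.add_mod_right, Nat.mod_eq_of_lt (by omega)]
  · obtain rfl : n = 1 := by omega
    simp

theorem val_add_one (i : Fin n) :
    ((i + 1 : Fin n) : ℕ) = if (i : ℕ) + 1 = n then 0 else (i : ℕ) + 1 := by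
  have hn := NeZero.pos n
  have hi := i.2
  rw [Fin.val_add, Fin.val_one', Nat.add_mod_mod]
  split_ifs with h0
  · rw [h0, Nat.mod_self]
  · rw [Nat.mod_eq_of_lt (by omega)]

/-- Turns the cyclic condition into linear inequalities, which `omega` can decide. For `a = b` the
arc is empty. -/
theorem inArc_iff (a b c : Fin n) :
    InArc a b c ↔ (a < b ∧ a ≤ c ∧ c < b) ∨ (b < a ∧ (a ≤ c ∨ c < b)) := by
  have h1 : a ≤ c → ((c - a : Fin n) : ℕ) = c - a := Fin.coe_sub_iff_le.2
  have h2 : c < a → ((c - a : Fin n) : ℕ) = n + c - a := Fin.coe_sub_iff_lt.2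
  have h3 : a ≤ b → ((b - a : Fin n) : ℕ) = b - a := Fin.coe_sub_iff_le.2
  have h4 : b < a → ((b - a : Fin n) : ℕ) = n + b - a := Fin.coe_sub_iff_lt.2
  have ha := a.2
  have hb := b.2
  have hc := c.2
  rw [InArc, Fin.lt_def]
  simp only [Fin.lt_def, Fin.le_def] at *
  omega

theorem inArc_left {a b : Fin n} (h : a ≠ b) : InArc a b a := by
  rw [inArc_iff]; simp only [Fin.lt_def, Fin.le_def, ne_eq, Fin.ext_iff] at *; omega

theorem not_inArc_right (a b : Fin n) : ¬ InArc a b b := by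
  rw [inArc_iff]; simp only [Fin.lt_def, Fin.le_def] at *; omega

/-- The indicator function of an arc. -/
noncomputable def arcInd (a b c : Fin n) : ℤ :=
  open Classical in if InArc a b c then 1 else 0

/-- The jumps of an arc at its two ends; the corners of a rectangle are the products of such jumps
in the two directions. -/
theorem arcInd_sub (a b c : Fin n) :
    arcInd a b c - arcInd a b (c - 1) = (if c = a then 1 else 0) - (if c = b then 1 else 0) := by
  have h := val_sub_one c
  have ha := a.2
  have hb := b.2
  have hc := c.2
  simp only [arcInd, inArc_iff, Fin.lt_def, Fin.le_def, Fin.ext_iff]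
  generalize ((c - 1 : Fin n) : ℕ) = c' at *
  split_ifs at h <;> split_ifs <;> first | rfl | (exfalso; omega)

theorem arcInd_nonneg (a b c : Fin n) : 0 ≤ arcInd a b c := by
  rw [arcInd]; split_ifs <;> simp

/-- Consecutive arcs. -/
theorem arcInd_add {a b c : Fin n} (h : InArc a c b) (i : Fin n) :
    arcInd a b i + arcInd b c i = arcInd a c i := by
  have ha := a.2
  have hb := b.2
  have hc := c.2
  have hi := i.2
  simp only [arcInd, inArc_iff, Fin.lt_def, Fin.le_def] at *
  split_ifs <;> first | rfl | (exfalso; omega)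

/-- Complementary arcs. -/
theorem arcInd_add_swap {a b : Fin n} (h : a ≠ b) (i : Fin n) :
    arcInd a b i + arcInd b a i = 1 := by
  have ha := a.2
  have hb := b.2
  have hi := i.2
  simp only [arcInd, inArc_iff, Fin.lt_def, Fin.le_def, ne_eq, Fin.ext_iff] at *
  split_ifs <;> first | rfl | (exfalso; omega)

theorem rectChain_apply (x : Generator n) (a b i j : Fin n) :
    rectChain x a b i j = arcInd a b i * arcInd (x a) (x b) j := by
  simp only [rectChain, arcInd]
  split_ifs <;> simp_all

theorem rectChain_nonneg (x : Generator n) (a b i j : Fin n) : 0 ≤ rectChain x a b i j := by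
  rw [rectChain_apply]
  exact mul_nonneg (arcInd_nonneg _ _ _) (arcInd_nonneg _ _ _)

/-! ### Domains -/

theorem isDomain_rectChain (x : Generator n) {a b : Fin n} (h : a ≠ b) :
    IsDomain x (x * Equiv.swap a b) (rectChain x a b) := by
  intro i j
  simp only [rectChain_apply]
  have h1 := arcInd_sub a b i
  have h2 := arcInd_sub (x a) (x b) j
  have h3 : arcInd a b (i - 1) * arcInd (x a) (x b) j -
      arcInd a b (i - 1) * arcInd (x a) (x b) (j - 1) -
      (arcInd a b i * arcInd (x a) (x b) j - arcInd a b i * arcInd (x a) (x b) (j - 1)) =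
      -((arcInd a b i - arcInd a b (i - 1)) *
        (arcInd (x a) (x b) j - arcInd (x a) (x b) (j - 1))) := by ring
  rw [h3, h1, h2, Equiv.Perm.mul_apply]
  by_cases hia : i = a
  · subst hia
    simp [h, eq_comm (a := j)]
  · by_cases hib : i = b
    · subst hib
      simp [Ne.symm h, eq_comm (a := j)]
    · simp [hia, hib, Equiv.swap_apply_of_ne_of_ne hia hib]

theorem IsDomain.sub_left {x x' y : Generator n} {D E : TwoChain n} (hD : IsDomain x y D)
    (hE : IsDomain x x' E) : IsDomain x' y (D - E) := by
  intro i j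
  have h1 := hD i j
  have h2 := hE i j
  simp only [Pi.sub_apply]
  linarith

theorem IsDomain.sub_right {x y y' : Generator n} {D E : TwoChain n} (hD : IsDomain x y D)
    (hE : IsDomain y' y E) : IsDomain x y' (D - E) := by
  intro i j
  have h1 := hD i j
  have h2 := hE i j
  simp only [Pi.sub_apply]
  linarith

theorem IsDomain.add {x y z : Generator n} {D E : TwoChain n} (hD : IsDomain x y D)
    (hE : IsDomain y z E) : IsDomain x z (D + E) := by
  intro i j
  have h1 := hD i j
  have h2 := hE i j
  simp only [Pi.add_apply]
  linarith

/-- The chain of a row. -/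
def rowChain (r : Fin n) : TwoChain n := fun _ j => if j = r then 1 else 0

/-- The chain of a column. -/
def colChain (c : Fin n) : TwoChain n := fun i _ => if i = c then 1 else 0

theorem isDomain_rowChain (x : Generator n) (r : Fin n) : IsDomain x x (rowChain r) := by
  intro i j; simp [rowChain]

theorem isDomain_colChain (x : Generator n) (c : Fin n) : IsDomain x x (colChain c) := by
  intro i j; simp [colChain]

/-! ### The Maslov index -/

/-- Summation by parts on the circle. -/
theorem sum_shift_sub_mul (f g : Fin n → ℤ) :
    ∑ i, (f (i - 1) - f i) * (g i + g (i - 1)) =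
      ∑ i, (f (i - 1) * g i - f i * g (i - 1)) := by
  have h : ∑ i, f (i - 1) * g (i - 1) = ∑ i, f i * g i :=
    Equiv.sum_comp (Equiv.subRight (1 : Fin n)) fun i => f i * g i
  rw [← sub_eq_zero, ← Finset.sum_sub_distrib, ← sub_eq_zero.2 h, ← Finset.sum_sub_distrib]
  refine Finset.sum_congr rfl fun i _ => ?_
  ring

/-- The sum of the coefficients around a point. -/
def around (D : TwoChain n) (i j : Fin n) : ℤ :=
  D i j + D (i - 1) j + D i (j - 1) + D (i - 1) (j - 1)

/-- The coefficient of a point in `∂(∂D ∩ α)`. -/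
def corner (D : TwoChain n) (i j : Fin n) : ℤ :=
  (D (i - 1) j - D (i - 1) (j - 1)) - (D i j - D i (j - 1))

/-- In each direction the pairing of a difference with a sum of neighbours is antisymmetric, by
`sum_shift_sub_mul`. Both directions together give a symmetric pairing. -/
theorem sum_corner_mul_around (D E : TwoChain n) :
    ∑ i, ∑ j, corner D i j * around E i j = ∑ i, ∑ j, corner E i j * around D i j := by
  have key : ∀ D E : TwoChain n, ∑ i, ∑ j, corner D i j * around E i j =
      -∑ i, ∑ j, (D (i - 1) (j - 1) * E i j - D (i - 1) j * E i (j - 1)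
        - D i (j - 1) * E (i - 1) j + D i j * E (i - 1) (j - 1)) := by
    intro D E
    have h1 : ∀ i, ∑ j, corner D i j * around E i j =
        -∑ j, ((D (i - 1) (j - 1) - D i (j - 1)) * (E i j + E (i - 1) j)
          - (D (i - 1) j - D i j) * (E i (j - 1) + E (i - 1) (j - 1))) := by
      intro i
      have := sum_shift_sub_mul (fun j => D (i - 1) j - D i j) (fun j => E i j + E (i - 1) j)
      rw [← this, ← Finset.sum_neg_distrib]
      refine Finset.sum_congr rfl fun j _ => ?_
      simp only [corner, around]
      ring
    simp only [h1, Finset.sum_neg_distrib]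
    rw [Finset.sum_comm, Finset.sum_comm (s := Finset.univ (α := Fin n))
      (f := fun i j => (D (i - 1) (j - 1) * E i j - D (i - 1) j * E i (j - 1)
        - D i (j - 1) * E (i - 1) j + D i j * E (i - 1) (j - 1)))]
    congr 1
    refine Finset.sum_congr rfl fun j _ => ?_
    have h2 := sum_shift_sub_mul (fun i => D i (j - 1)) (fun i => E i j)
    have h3 := sum_shift_sub_mul (fun i => D i j) (fun i => E i (j - 1))
    rw [Finset.sum_sub_distrib, h2, h3, ← Finset.sum_sub_distrib]
    refine Finset.sum_congr rfl fun i _ => ?_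
    ring
  rw [key, key]
  congr 1
  exact Finset.sum_congr rfl fun i _ => Finset.sum_congr rfl fun j _ => by ring

theorem pointMeasure_eq (x : Generator n) (D : TwoChain n) :
    pointMeasure x D = ((∑ i, around D i (x i) : ℤ) : ℚ) / 4 := by
  rw [pointMeasure, Int.cast_sum, Finset.sum_div]
  rfl

theorem sum_corner_mul_around_of_isDomain {x y : Generator n} {D : TwoChain n}
    (hD : IsDomain x y D) (E : TwoChain n) :
    ((∑ i, ∑ j, corner D i j * around E i j : ℤ) : ℚ) / 4 =
      pointMeasure y E - pointMeasure x E := by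
  rw [pointMeasure_eq, pointMeasure_eq, ← sub_div, ← Int.cast_sub, ← Finset.sum_sub_distrib]
  congr 2
  refine Finset.sum_congr rfl fun i _ => ?_
  have h : ∀ j, corner D i j = (if y i = j then 1 else 0) - (if x i = j then 1 else 0) := hD i
  simp [h, sub_mul, Finset.sum_sub_distrib]

/-- The corners of a domain from `x` to `y` are `y - x`, so this is the symmetry of the pairing
above. It is what makes the Maslov index additive. -/
theorem pointMeasure_sub_comm {x y z w : Generator n} {D E : TwoChain n} (hD : IsDomain x y D)
    (hE : IsDomain z w E) :
    pointMeasure y E - pointMeasure x E = pointMeasure w D - pointMeasure z D := by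
  rw [← sum_corner_mul_around_of_isDomain hD, ← sum_corner_mul_around_of_isDomain hE,
    sum_corner_mul_around]

theorem pointMeasure_sub (x : Generator n) (D E : TwoChain n) :
    pointMeasure x (D - E) = pointMeasure x D - pointMeasure x E := by
  rw [pointMeasure_eq, pointMeasure_eq, pointMeasure_eq, ← sub_div, ← Int.cast_sub,
    ← Finset.sum_sub_distrib]
  congr 2
  refine Finset.sum_congr rfl fun i _ => ?_
  simp only [around, Pi.sub_apply]
  ring

/-- The Maslov index is additive: removing a domain at the start. -/
theorem maslov_sub_left {x x' y : Generator n} {D E : TwoChain n} (hD : IsDomain x y D)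
    (hE : IsDomain x x' E) : maslov x' y (D - E) = maslov x y D - maslov x x' E := by
  have h := pointMeasure_sub_comm (hD.sub_left hE) hE
  rw [pointMeasure_sub, pointMeasure_sub] at h
  rw [maslov, maslov, maslov, pointMeasure_sub, pointMeasure_sub]
  linarith

/-- The Maslov index is additive: removing a domain at the end. -/
theorem maslov_sub_right {x y y' : Generator n} {D E : TwoChain n} (hD : IsDomain x y D)
    (hE : IsDomain y' y E) : maslov x y' (D - E) = maslov x y D - maslov y' y E := by
  have h := pointMeasure_sub_comm (hD.sub_right hE) hE
  rw [pointMeasure_sub, pointMeasure_sub] at h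
  rw [maslov, maslov, maslov, pointMeasure_sub, pointMeasure_sub]
  linarith

theorem maslov_rowChain (x : Generator n) (r : Fin n) : maslov x x (rowChain r) = 2 := by
  have h : pointMeasure x (rowChain r) = 1 := by
    rw [pointMeasure_eq]
    have h1 : ∑ i, around (rowChain r) i (x i) = 4 := by
      have h2 : ∀ i, around (rowChain r) i (x i) =
          2 * (if x i = r then 1 else 0) + 2 * (if x i - 1 = r then 1 else 0) := by
        intro i; simp only [around, rowChain]; ring
      simp only [h2, Finset.sum_add_distrib, ← Finset.mul_sum]
      rw [Equiv.sum_comp x fun k => if k = r then (1 : ℤ) else 0,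
        Equiv.sum_comp x fun k => if k - 1 = r then (1 : ℤ) else 0]
      simp [sub_eq_iff_eq_add]
    rw [h1]; norm_num
  rw [maslov, h]; norm_num

theorem maslov_colChain (x : Generator n) (c : Fin n) : maslov x x (colChain c) = 2 := by
  have h : pointMeasure x (colChain c) = 1 := by
    rw [pointMeasure_eq]
    have h1 : ∑ i, around (colChain c) i (x i) = 4 := by
      have h2 : ∀ i, around (colChain c) i (x i) =
          2 * (if i = c then 1 else 0) + 2 * (if i - 1 = c then 1 else 0) := by
        intro i; simp only [around, colChain]; ring
      simp only [h2, Finset.sum_add_distrib, ← Finset.mul_sum]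
      simp [sub_eq_iff_eq_add]
    rw [h1]; norm_num
  rw [maslov, h]; norm_num

theorem around_rectChain (x : Generator n) (a b i j : Fin n) :
    around (rectChain x a b) i j = (arcInd a b i + arcInd a b (i - 1)) *
      (arcInd (x a) (x b) j + arcInd (x a) (x b) (j - 1)) := by
  simp only [around, rectChain_apply]; ring

theorem arcInd_left {a b : Fin n} (h : a ≠ b) : arcInd a b a = 1 := by
  simp [arcInd, inArc_left h]

theorem arcInd_right (a b : Fin n) : arcInd a b b = 0 := by
  simp [arcInd, not_inArc_right]

theorem arcInd_left_pred {a b : Fin n} (h : a ≠ b) : arcInd a b (a - 1) = 0 := by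
  have := arcInd_sub a b a
  rw [arcInd_left h] at this
  simp [h] at this
  exact this

theorem arcInd_right_pred {a b : Fin n} (h : a ≠ b) : arcInd a b (b - 1) = 1 := by
  have := arcInd_sub a b b
  rw [arcInd_right] at this
  simp [h.symm] at this
  exact this

theorem arcInd_pred {a b c : Fin n} (ha : c ≠ a) (hb : c ≠ b) :
    arcInd a b (c - 1) = arcInd a b c := by
  have := arcInd_sub a b c
  simp [ha, hb] at this
  linarith

/-- Each of the four corners has one of its four surrounding squares in the rectangle and
contributes 1/4. The other points lie outside, and no side of the rectangle starts or ends in their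
row or column, so they contribute 0. -/
theorem maslov_rectChain {x : Generator n} {a b : Fin n} (h : IsRect x a b) :
    maslov x (x * Equiv.swap a b) (rectChain x a b) = 1 := by
  have hx : x a ≠ x b := fun e => h.1 (x.injective e)
  have hout : ∀ i, i ≠ a → i ≠ b → around (rectChain x a b) i (x i) = 0 := by
    intro i ha hb
    have h1 : x i ≠ x a := fun e => ha (x.injective e)
    have h2 : x i ≠ x b := fun e => hb (x.injective e)
    rw [around_rectChain, arcInd_pred ha hb, arcInd_pred h1 h2]
    have h3 := h.2 i ha hb
    rw [not_and_or] at h3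
    rcases h3 with h3 | h3 <;> simp [arcInd, h3]
  have hxm : ∑ i, around (rectChain x a b) i (x i) = 2 := by
    rw [← Finset.sum_subset (Finset.subset_univ {a, b}), Finset.sum_pair h.1]
    · simp only [around_rectChain, arcInd_left h.1, arcInd_left hx, arcInd_right,
        arcInd_left_pred h.1, arcInd_left_pred hx, arcInd_right_pred h.1, arcInd_right_pred hx]
      norm_num
    · intro i _ hi
      rw [Finset.mem_insert, Finset.mem_singleton, not_or] at hi
      exact hout i hi.1 hi.2
  have hym : ∑ i, around (rectChain x a b) i ((x * Equiv.swap a b) i) = 2 := by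
    rw [← Finset.sum_subset (Finset.subset_univ {a, b}), Finset.sum_pair h.1]
    · simp only [around_rectChain, Equiv.Perm.mul_apply, Equiv.swap_apply_left,
        Equiv.swap_apply_right, arcInd_left h.1, arcInd_left hx, arcInd_right,
        arcInd_left_pred h.1, arcInd_left_pred hx, arcInd_right_pred h.1, arcInd_right_pred hx]
      norm_num
    · intro i _ hi
      rw [Finset.mem_insert, Finset.mem_singleton, not_or] at hi
      rw [Equiv.Perm.mul_apply, Equiv.swap_apply_of_ne_of_ne hi.1 hi.2]
      exact hout i hi.1 hi.2
  rw [maslov, pointMeasure_eq, pointMeasure_eq, hxm, hym]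
  norm_num

end Grid

namespace Grid

variable {n : ℕ} [NeZero n]

/-! ### Cyclic order -/

/-- The cyclic orders of three points in terms of one of them. -/
theorem inArc_cases {a b c : Fin n} (hab : a ≠ b) (hbc : b ≠ c) (hac : a ≠ c) :
    (InArc b c a ↔ InArc a b c) ∧ (InArc c a b ↔ InArc a b c) ∧ (InArc a c b ↔ ¬ InArc a b c) ∧
      (InArc b a c ↔ ¬ InArc a b c) ∧ (InArc c b a ↔ ¬ InArc a b c) := by
  simp only [inArc_iff, Fin.lt_def, Fin.le_def, ne_eq, Fin.ext_iff] at *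
  omega

theorem inArc_right_of_exit {a b c d : Fin n} (h1 : InArc c d a) (h2 : ¬ InArc c d b)
    (h3 : b ≠ d) : InArc a b d := by
  simp only [inArc_iff, Fin.lt_def, Fin.le_def, ne_eq, Fin.ext_iff] at *
  omega

theorem inArc_left_of_entry {a b c d : Fin n} (h1 : InArc c d b) (h2 : ¬ InArc c d a)
    (h3 : b ≠ c) : InArc a b c := by
  simp only [inArc_iff, Fin.lt_def, Fin.le_def, ne_eq, Fin.ext_iff] at *
  omega

/-- This forces an annulus composed of two empty rectangles to be a single row or column. -/
theorem forall_not_inArc_iff {a b : Fin n} (hab : a ≠ b) :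
    (∀ i, i ≠ a → i ≠ b → ¬ InArc a b i) ↔ b = a + 1 := by
  have hv := val_add_one a
  have hb := b.2
  have ha := a.2
  constructor
  · intro h
    by_contra hne
    have h1 : a + 1 ≠ a := by
      intro e
      rw [e] at hv
      rw [ne_eq, Fin.ext_iff] at hab
      split_ifs at hv <;> omega
    have h2 := h (a + 1) h1 (Ne.symm hne)
    rw [inArc_iff] at h2
    simp only [Fin.lt_def, Fin.le_def, ne_eq, Fin.ext_iff] at *
    split_ifs at hv <;> omega
  · rintro rfl i hia hib hi
    rw [inArc_iff] at hi
    have hi' := i.2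
    simp only [Fin.lt_def, Fin.le_def, ne_eq, Fin.ext_iff] at *
    split_ifs at hv <;> omega

theorem rectChain_eq_zero_iff (x : Generator n) (a b i j : Fin n) :
    rectChain x a b i j = 0 ↔ ¬ (InArc a b i ∧ InArc (x a) (x b) j) := by
  rw [rectChain]; split_ifs with h <;> simp [h]

/-! ### Pairs of rectangles -/

/-- Two consecutive rectangles. -/
def IsRectPair (x : Generator n) (a b c d : Fin n) : Prop :=
  IsRect x a b ∧ IsRect (x * Equiv.swap a b) c d

/-- The domain of two consecutive rectangles. -/
noncomputable def pairChain (x : Generator n) (a b c d : Fin n) : TwoChain n :=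
  rectChain x a b + rectChain (x * Equiv.swap a b) c d

/-- Emptiness of a rectangle with respect to the points in a set `s` of columns. -/
def EmptyOn (s : Set (Fin n)) (x : Generator n) (a b : Fin n) : Prop :=
  a ≠ b ∧ ∀ i ∈ s, i ≠ a → i ≠ b → ¬ (InArc a b i ∧ InArc (x a) (x b) (x i))

/-- Points in columns outside `s` are not moved, and coefficients are nonnegative, so both
rectangles miss such a point exactly when their sum does. Emptiness there depends only on the total
chain, and only the columns in `s` need a case check. -/
theorem isRectPair_iff (s : Set (Fin n)) (x : Generator n) {a b c d : Fin n} (ha : a ∈ s)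
    (hb : b ∈ s) (hc : c ∈ s) (hd : d ∈ s) :
    IsRectPair x a b c d ↔ EmptyOn s x a b ∧ EmptyOn s (x * Equiv.swap a b) c d ∧
      ∀ i ∉ s, pairChain x a b c d i (x i) = 0 := by
  have hx : ∀ i ∉ s, (x * Equiv.swap a b) i = x i := by
    intro i hi
    rw [Equiv.Perm.mul_apply, Equiv.swap_apply_of_ne_of_ne]
    · rintro rfl; exact hi ha
    · rintro rfl; exact hi hb
  have hz : ∀ i j, pairChain x a b c d i j = 0 ↔
      rectChain x a b i j = 0 ∧ rectChain (x * Equiv.swap a b) c d i j = 0 := by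
    intro i j
    have h1 := rectChain_nonneg x a b i j
    have h2 := rectChain_nonneg (x * Equiv.swap a b) c d i j
    simp only [pairChain, Pi.add_apply]
    omega
  constructor
  · rintro ⟨h1, h2⟩
    refine ⟨⟨h1.1, fun i _ => h1.2 i⟩, ⟨h2.1, fun i _ => h2.2 i⟩, fun i hi => (hz _ _).2 ⟨?_, ?_⟩⟩
    · exact (rectChain_eq_zero_iff _ _ _ _ _).2
        (h1.2 i (fun e => hi (e ▸ ha)) (fun e => hi (e ▸ hb)))
    · rw [← hx i hi]
      exact (rectChain_eq_zero_iff _ _ _ _ _).2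
        (h2.2 i (fun e => hi (e ▸ hc)) (fun e => hi (e ▸ hd)))
  · rintro ⟨h1, h2, h3⟩
    refine ⟨⟨h1.1, fun i hia hib => ?_⟩, ⟨h2.1, fun i hic hid => ?_⟩⟩
    · by_cases hi : i ∈ s
      · exact h1.2 i hi hia hib
      · exact (rectChain_eq_zero_iff _ _ _ _ _).1 ((hz _ _).1 (h3 i hi)).1
    · by_cases hi : i ∈ s
      · exact h2.2 i hi hic hid
      · rw [hx i hi]
        exact (rectChain_eq_zero_iff _ _ _ _ _).1 ((hz _ _).1 (h3 i hi)).2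

/-- If a corner moved by one rectangle lay inside the other one in the new order, an arc entering or
leaving the other would put one of the remaining corners inside a rectangle that was assumed empty.
-/
theorem isRectPair_disjoint {x : Generator n} {a b c d : Fin n} (hac : a ≠ c) (had : a ≠ d)
    (hbc : b ≠ c) (hbd : b ≠ d) (h : IsRectPair x a b c d) : IsRectPair x c d a b := by
  obtain ⟨h1, h2⟩ := h
  have hab := h1.1
  have hcd := h2.1
  have e1 : (x * Equiv.swap a b) c = x c := by
    rw [Equiv.Perm.mul_apply, Equiv.swap_apply_of_ne_of_ne hac.symm hbc.symm]
  have e2 : (x * Equiv.swap a b) d = x d := by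
    rw [Equiv.Perm.mul_apply, Equiv.swap_apply_of_ne_of_ne had.symm hbd.symm]
  have e3 : (x * Equiv.swap c d) a = x a := by
    rw [Equiv.Perm.mul_apply, Equiv.swap_apply_of_ne_of_ne hac had]
  have e4 : (x * Equiv.swap c d) b = x b := by
    rw [Equiv.Perm.mul_apply, Equiv.swap_apply_of_ne_of_ne hbc hbd]
  have p1 := h1.2 c hac.symm hbc.symm
  have p2 := h1.2 d had.symm hbd.symm
  have p3 := h2.2 a hac had
  have p4 := h2.2 b hbc hbd
  rw [e1, e2] at p3 p4
  rw [Equiv.Perm.mul_apply, Equiv.swap_apply_left] at p3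
  rw [Equiv.Perm.mul_apply, Equiv.swap_apply_right] at p4
  have hne : ∀ {i j}, i ≠ j → x i ≠ x j := fun h e => h (x.injective e)
  refine ⟨⟨hcd, fun i hic hid => ?_⟩, ⟨hab, fun i hia hib => ?_⟩⟩
  · by_cases hia : i = a
    · subst hia
      rintro ⟨q1, q2⟩
      have r1 : ¬ InArc (x c) (x d) (x b) := fun r => p3 ⟨q1, r⟩
      have r2 : ¬ InArc c d b := fun r => p4 ⟨r, q2⟩
      exact p2 ⟨inArc_right_of_exit q1 r2 hbd, inArc_right_of_exit q2 r1 (hne hbd)⟩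
    · by_cases hib : i = b
      · subst hib
        rintro ⟨q1, q2⟩
        have r1 : ¬ InArc (x c) (x d) (x a) := fun r => p4 ⟨q1, r⟩
        have r2 : ¬ InArc c d a := fun r => p3 ⟨r, q2⟩
        exact p1 ⟨inArc_left_of_entry q1 r2 hbc, inArc_left_of_entry q2 r1 (hne hbc)⟩
      · have := h2.2 i hic hid
        rwa [e1, e2, Equiv.Perm.mul_apply, Equiv.swap_apply_of_ne_of_ne hia hib] at this
  · rw [e3, e4]
    by_cases hic : i = c
    · subst hic
      rw [Equiv.Perm.mul_apply, Equiv.swap_apply_left]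
      rintro ⟨q1, q2⟩
      have r1 : ¬ InArc (x a) (x b) (x i) := fun r => p1 ⟨q1, r⟩
      have r2 : ¬ InArc a b d := fun r => p2 ⟨r, q2⟩
      exact p4 ⟨inArc_right_of_exit q1 r2 hbd.symm, inArc_left_of_entry q2 r1 (hne had.symm)⟩
    · by_cases hid : i = d
      · subst hid
        rw [Equiv.Perm.mul_apply, Equiv.swap_apply_right]
        rintro ⟨q1, q2⟩
        have r1 : ¬ InArc (x a) (x b) (x i) := fun r => p2 ⟨q1, r⟩
        have r2 : ¬ InArc a b c := fun r => p1 ⟨r, q2⟩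
        exact p3 ⟨inArc_left_of_entry q1 r2 had.symm, inArc_right_of_exit q2 r1 (hne hbd.symm)⟩
      · rw [Equiv.Perm.mul_apply, Equiv.swap_apply_of_ne_of_ne hic hid]
        exact h1.2 i hia hib

/-! ### Regrouping two rectangles with no or one common column -/

section

variable {M : Type} [AddCommGroup M] (f : Generator n → TwoChain n → M)

/-- The contribution of a pair of rectangles to a sum over their ends and domains. -/
noncomputable def pairTerm (x : Generator n) (a b c d : Fin n) : M :=
  open Classical in
  if IsRectPair x a b c d then
    f (x * Equiv.swap a b * Equiv.swap c d) (pairChain x a b c d) else 0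

theorem pairTerm_disjoint (x : Generator n) {a b c d : Fin n} (hac : a ≠ c) (had : a ≠ d)
    (hbc : b ≠ c) (hbd : b ≠ d) : pairTerm f x a b c d = pairTerm f x c d a b := by
  have hiff : IsRectPair x a b c d ↔ IsRectPair x c d a b :=
    ⟨isRectPair_disjoint hac had hbc hbd,
      isRectPair_disjoint hac.symm hbc.symm had.symm hbd.symm⟩
  have hz : x * Equiv.swap a b * Equiv.swap c d = x * Equiv.swap c d * Equiv.swap a b := by
    rw [mul_assoc, mul_assoc]
    congr 1
    ext i
    simp only [Equiv.Perm.mul_apply, Equiv.swap_apply_def]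
    split_ifs <;> simp_all
  have hc : pairChain x a b c d = pairChain x c d a b := by
    funext i j
    simp only [pairChain, Pi.add_apply, rectChain_apply, Equiv.Perm.mul_apply,
      Equiv.swap_apply_of_ne_of_ne hac.symm hbc.symm, Equiv.swap_apply_of_ne_of_ne had.symm hbd.symm,
      Equiv.swap_apply_of_ne_of_ne hac had, Equiv.swap_apply_of_ne_of_ne hbc hbd]
    ring
  rw [pairTerm, pairTerm, hz, hc]
  by_cases h : IsRectPair x a b c d
  · rw [if_pos h, if_pos (hiff.1 h)]
  · rw [if_neg h, if_neg fun h' => h (hiff.2 h')]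

/-- Two decompositions of the same chain with the same end contribute equally once the emptiness
conditions on the columns in `s` match; the other columns see only the common chain. -/
theorem pairTerm_congr (x : Generator n) {a b c d a' b' c' d' : Fin n} {p q : Prop}
    [Decidable p] [Decidable q] (s : Set (Fin n))
    (ha : a ∈ s) (hb : b ∈ s) (hc : c ∈ s) (hd : d ∈ s)
    (ha' : a' ∈ s) (hb' : b' ∈ s) (hc' : c' ∈ s) (hd' : d' ∈ s)
    (hiff : (p ∧ EmptyOn s x a b ∧ EmptyOn s (x * Equiv.swap a b) c d) ↔
      (q ∧ EmptyOn s x a' b' ∧ EmptyOn s (x * Equiv.swap a' b') c' d'))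
    (hz : Equiv.swap a b * Equiv.swap c d = Equiv.swap a' b' * Equiv.swap c' d')
    (hchain : p → EmptyOn s x a b → EmptyOn s (x * Equiv.swap a b) c d →
      pairChain x a b c d = pairChain x a' b' c' d') :
    (if p then pairTerm f x a b c d else 0) = if q then pairTerm f x a' b' c' d' else 0 := by
  have key : (p ∧ IsRectPair x a b c d) ↔ (q ∧ IsRectPair x a' b' c' d') := by
    rw [isRectPair_iff s x ha hb hc hd, isRectPair_iff s x ha' hb' hc' hd']
    constructor
    · rintro ⟨h1, h2, h3, h4⟩
      obtain ⟨h1', h2', h3'⟩ := hiff.1 ⟨h1, h2, h3⟩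
      exact ⟨h1', h2', h3', hchain h1 h2 h3 ▸ h4⟩
    · rintro ⟨h1', h2', h3', h4⟩
      obtain ⟨h1, h2, h3⟩ := hiff.2 ⟨h1', h2', h3'⟩
      exact ⟨h1, h2, h3, hchain h1 h2 h3 ▸ h4⟩
  by_cases hp : p ∧ IsRectPair x a b c d
  · have hq := key.1 hp
    obtain ⟨h1, h2, h3⟩ : p ∧ EmptyOn s x a b ∧ EmptyOn s (x * Equiv.swap a b) c d :=
      ⟨hp.1, ((isRectPair_iff s x ha hb hc hd).1 hp.2).1,
        ((isRectPair_iff s x ha hb hc hd).1 hp.2).2.1⟩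
    rw [if_pos hp.1, if_pos hq.1, pairTerm, pairTerm, if_pos hp.2, if_pos hq.2,
      hchain h1 h2 h3, mul_assoc, mul_assoc, hz]
  · have hq : ¬ (q ∧ IsRectPair x a' b' c' d') := fun h => hp (key.2 h)
    rw [not_and] at hp hq
    have e1 : (if p then pairTerm f x a b c d else 0) = 0 := by
      split_ifs with h
      · rw [pairTerm, if_neg (hp h)]
      · rfl
    have e2 : (if q then pairTerm f x a' b' c' d' else 0) = 0 := by
      split_ifs with h
      · rw [pairTerm, if_neg (hq h)]
      · rfl
    rw [e1, e2]

open Classical in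
-- An L-shaped domain has two decompositions, by the vertical and by the horizontal cut through its
-- reflex corner. Here the missing corner is at the top left. On the three columns the claim is
-- propositional in one cyclic order of columns and one of rows (`inArc_cases`).
theorem pairTerm_bottom (x : Generator n) {a b c : Fin n} (hab : a ≠ b) (hbc : b ≠ c)
    (hac : a ≠ c) :
    (if InArc (x a) (x c) (x b) then pairTerm f x a b b c else 0) =
      if ¬ InArc b c a then pairTerm f x b c a c else 0 := by
  have hne : ∀ {i j}, i ≠ j → x i ≠ x j := fun h e => h (x.injective e)
  obtain ⟨r1, r2, r3, r4, r5⟩ := inArc_cases hab hbc hac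
  obtain ⟨t1, t2, t3, t4, t5⟩ := inArc_cases (hne hab) (hne hbc) (hne hac)
  have e1 := Equiv.swap_apply_of_ne_of_ne hac.symm hbc.symm
  have e2 := Equiv.swap_apply_of_ne_of_ne hab hac
  have e3 := Equiv.swap_apply_of_ne_of_ne hab.symm hbc
  have e4 := Equiv.swap_apply_of_ne_of_ne hac hab
  have e5 := Equiv.swap_apply_of_ne_of_ne hbc hab.symm
  have e6 := Equiv.swap_apply_of_ne_of_ne hbc.symm hac.symm
  have core : InArc (x a) (x c) (x b) → EmptyOn {a, b, c} x a b →
      EmptyOn {a, b, c} (x * Equiv.swap a b) b c → InArc a c b ∧ InArc (x a) (x c) (x b) := by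
    simp only [EmptyOn, Equiv.Perm.mul_apply, Set.mem_insert_iff, Set.mem_singleton_iff,
      forall_eq_or_imp, forall_eq, Equiv.swap_apply_left, Equiv.swap_apply_right,
      e1, e2, e3, e4, e5, e6]
    simp only [ne_eq, hab, hbc, hac, hab.symm, hbc.symm, hac.symm, not_true_eq_false,
      not_false_eq_true, false_implies, true_implies, true_and, and_true, r1, r2, r3, r4, r5,
      t1, t2, t3, t4, t5]
    clear hne r1 r2 r3 r4 r5 t1 t2 t3 t4 t5 e1 e2 e3 e4 e5 e6 hab hbc hac
    tauto
  refine pairTerm_congr f x {a, b, c} (by simp) (by simp) (by simp) (by simp) (by simp) (by simp)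
    (by simp) (by simp) ?_ ?_ ?_
  · simp only [EmptyOn, Equiv.Perm.mul_apply, Set.mem_insert_iff, Set.mem_singleton_iff,
      forall_eq_or_imp, forall_eq, Equiv.swap_apply_left, Equiv.swap_apply_right,
      e1, e2, e3, e4, e5, e6]
    simp only [ne_eq, hab, hbc, hac, hab.symm, hbc.symm, hac.symm, not_true_eq_false,
      not_false_eq_true, false_implies, true_implies, true_and, and_true, r1, r2, r3, r4, r5,
      t1, t2, t3, t4, t5]
    clear hne r1 r2 r3 r4 r5 t1 t2 t3 t4 t5 e1 e2 e3 e4 e5 e6 hab hbc hac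
    tauto
  · ext i
    simp only [Equiv.Perm.mul_apply, Equiv.swap_apply_def]
    split_ifs <;> simp_all
  · intro h1 h2 h3
    obtain ⟨hA, hB⟩ := core h1 h2 h3
    funext i j
    simp only [pairChain, Pi.add_apply, rectChain_apply, Equiv.Perm.mul_apply,
      Equiv.swap_apply_left, Equiv.swap_apply_right, e1, e2, e3, e4, e5, e6,
      ← arcInd_add hA, ← arcInd_add hB]
    ring

open Classical in
-- The L-shape with the missing corner at the top right.
theorem pairTerm_left (x : Generator n) {a b c : Fin n} (hab : a ≠ b) (hbc : b ≠ c)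
    (hac : a ≠ c) :
    (if ¬ InArc (x a) (x c) (x b) then pairTerm f x a b b c else 0) =
      if InArc a c b then pairTerm f x a c a b else 0 := by
  have hne : ∀ {i j}, i ≠ j → x i ≠ x j := fun h e => h (x.injective e)
  obtain ⟨r1, r2, r3, r4, r5⟩ := inArc_cases hab hbc hac
  obtain ⟨t1, t2, t3, t4, t5⟩ := inArc_cases (hne hab) (hne hbc) (hne hac)
  have e1 := Equiv.swap_apply_of_ne_of_ne hac.symm hbc.symm
  have e2 := Equiv.swap_apply_of_ne_of_ne hab hac
  have e3 := Equiv.swap_apply_of_ne_of_ne hab.symm hbc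
  have e4 := Equiv.swap_apply_of_ne_of_ne hac hab
  have e5 := Equiv.swap_apply_of_ne_of_ne hbc hab.symm
  have e6 := Equiv.swap_apply_of_ne_of_ne hbc.symm hac.symm
  have core : ¬ InArc (x a) (x c) (x b) → EmptyOn {a, b, c} x a b →
      EmptyOn {a, b, c} (x * Equiv.swap a b) b c → InArc a c b ∧ InArc (x a) (x b) (x c) := by
    simp only [EmptyOn, Equiv.Perm.mul_apply, Set.mem_insert_iff, Set.mem_singleton_iff,
      forall_eq_or_imp, forall_eq, Equiv.swap_apply_left, Equiv.swap_apply_right,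
      e1, e2, e3, e4, e5, e6]
    simp only [ne_eq, hab, hbc, hac, hab.symm, hbc.symm, hac.symm, not_true_eq_false,
      not_false_eq_true, false_implies, true_implies, true_and, and_true, r1, r2, r3, r4, r5,
      t1, t2, t3, t4, t5]
    clear hne r1 r2 r3 r4 r5 t1 t2 t3 t4 t5 e1 e2 e3 e4 e5 e6 hab hbc hac
    tauto
  refine pairTerm_congr f x {a, b, c} (by simp) (by simp) (by simp) (by simp) (by simp) (by simp)
    (by simp) (by simp) ?_ ?_ ?_
  · simp only [EmptyOn, Equiv.Perm.mul_apply, Set.mem_insert_iff, Set.mem_singleton_iff,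
      forall_eq_or_imp, forall_eq, Equiv.swap_apply_left, Equiv.swap_apply_right,
      e1, e2, e3, e4, e5, e6]
    simp only [ne_eq, hab, hbc, hac, hab.symm, hbc.symm, hac.symm, not_true_eq_false,
      not_false_eq_true, false_implies, true_implies, true_and, and_true, r1, r2, r3, r4, r5,
      t1, t2, t3, t4, t5]
    clear hne r1 r2 r3 r4 r5 t1 t2 t3 t4 t5 e1 e2 e3 e4 e5 e6 hab hbc hac
    tauto
  · ext i
    simp only [Equiv.Perm.mul_apply, Equiv.swap_apply_def]
    split_ifs <;> simp_all
  · intro h1 h2 h3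
    obtain ⟨hA, hB⟩ := core h1 h2 h3
    funext i j
    simp only [pairChain, Pi.add_apply, rectChain_apply, Equiv.Perm.mul_apply,
      Equiv.swap_apply_left, Equiv.swap_apply_right, e1, e2, e3, e4, e5, e6,
      ← arcInd_add hA, ← arcInd_add hB]
    ring

open Classical in
-- The L-shape with the missing corner at the bottom left.
theorem pairTerm_right (x : Generator n) {a b c : Fin n} (hab : a ≠ b) (hbc : b ≠ c)
    (hac : a ≠ c) :
    (if InArc a b c then pairTerm f x a b c b else 0) =
      if InArc (x c) (x b) (x a) then pairTerm f x c b a c else 0 := by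
  have hne : ∀ {i j}, i ≠ j → x i ≠ x j := fun h e => h (x.injective e)
  obtain ⟨r1, r2, r3, r4, r5⟩ := inArc_cases hab hbc hac
  obtain ⟨t1, t2, t3, t4, t5⟩ := inArc_cases (hne hab) (hne hbc) (hne hac)
  have e1 := Equiv.swap_apply_of_ne_of_ne hac.symm hbc.symm
  have e2 := Equiv.swap_apply_of_ne_of_ne hab hac
  have e3 := Equiv.swap_apply_of_ne_of_ne hab.symm hbc
  have e4 := Equiv.swap_apply_of_ne_of_ne hac hab
  have e5 := Equiv.swap_apply_of_ne_of_ne hbc hab.symm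
  have e6 := Equiv.swap_apply_of_ne_of_ne hbc.symm hac.symm
  have core : InArc a b c → EmptyOn {a, b, c} x a b →
      EmptyOn {a, b, c} (x * Equiv.swap a b) c b → InArc a b c ∧ InArc (x c) (x b) (x a) := by
    simp only [EmptyOn, Equiv.Perm.mul_apply, Set.mem_insert_iff, Set.mem_singleton_iff,
      forall_eq_or_imp, forall_eq, Equiv.swap_apply_left, Equiv.swap_apply_right,
      e1, e2, e3, e4, e5, e6]
    simp only [ne_eq, hab, hbc, hac, hab.symm, hbc.symm, hac.symm, not_true_eq_false,
      not_false_eq_true, false_implies, true_implies, true_and, and_true, r1, r2, r3, r4, r5,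
      t1, t2, t3, t4, t5]
    clear hne r1 r2 r3 r4 r5 t1 t2 t3 t4 t5 e1 e2 e3 e4 e5 e6 hab hbc hac
    tauto
  refine pairTerm_congr f x {a, b, c} (by simp) (by simp) (by simp) (by simp) (by simp) (by simp)
    (by simp) (by simp) ?_ ?_ ?_
  · simp only [EmptyOn, Equiv.Perm.mul_apply, Set.mem_insert_iff, Set.mem_singleton_iff,
      forall_eq_or_imp, forall_eq, Equiv.swap_apply_left, Equiv.swap_apply_right,
      e1, e2, e3, e4, e5, e6]
    simp only [ne_eq, hab, hbc, hac, hab.symm, hbc.symm, hac.symm, not_true_eq_false,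
      not_false_eq_true, false_implies, true_implies, true_and, and_true, r1, r2, r3, r4, r5,
      t1, t2, t3, t4, t5]
    clear hne r1 r2 r3 r4 r5 t1 t2 t3 t4 t5 e1 e2 e3 e4 e5 e6 hab hbc hac
    tauto
  · ext i
    simp only [Equiv.Perm.mul_apply, Equiv.swap_apply_def]
    split_ifs <;> simp_all
  · intro h1 h2 h3
    obtain ⟨hA, hB⟩ := core h1 h2 h3
    funext i j
    simp only [pairChain, Pi.add_apply, rectChain_apply, Equiv.Perm.mul_apply,
      Equiv.swap_apply_left, Equiv.swap_apply_right, e1, e2, e3, e4, e5, e6,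
      ← arcInd_add hA, ← arcInd_add hB]
    ring

open Classical in
-- The L-shape with the missing corner at the bottom right.
theorem pairTerm_top (x : Generator n) {a b c : Fin n} (hab : a ≠ b) (hbc : b ≠ c)
    (hac : a ≠ c) :
    (if ¬ InArc a b c then pairTerm f x a b a c else 0) =
      if ¬ InArc (x b) (x c) (x a) then pairTerm f x b c a b else 0 := by
  have hne : ∀ {i j}, i ≠ j → x i ≠ x j := fun h e => h (x.injective e)
  obtain ⟨r1, r2, r3, r4, r5⟩ := inArc_cases hab hbc hac
  obtain ⟨t1, t2, t3, t4, t5⟩ := inArc_cases (hne hab) (hne hbc) (hne hac)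
  have e1 := Equiv.swap_apply_of_ne_of_ne hac.symm hbc.symm
  have e2 := Equiv.swap_apply_of_ne_of_ne hab hac
  have e3 := Equiv.swap_apply_of_ne_of_ne hab.symm hbc
  have e4 := Equiv.swap_apply_of_ne_of_ne hac hab
  have e5 := Equiv.swap_apply_of_ne_of_ne hbc hab.symm
  have e6 := Equiv.swap_apply_of_ne_of_ne hbc.symm hac.symm
  have core : ¬ InArc a b c → EmptyOn {a, b, c} x a b →
      EmptyOn {a, b, c} (x * Equiv.swap a b) a c → InArc a c b ∧ InArc (x a) (x c) (x b) := by
    simp only [EmptyOn, Equiv.Perm.mul_apply, Set.mem_insert_iff, Set.mem_singleton_iff,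
      forall_eq_or_imp, forall_eq, Equiv.swap_apply_left, Equiv.swap_apply_right,
      e1, e2, e3, e4, e5, e6]
    simp only [ne_eq, hab, hbc, hac, hab.symm, hbc.symm, hac.symm, not_true_eq_false,
      not_false_eq_true, false_implies, true_implies, true_and, and_true, r1, r2, r3, r4, r5,
      t1, t2, t3, t4, t5]
    clear hne r1 r2 r3 r4 r5 t1 t2 t3 t4 t5 e1 e2 e3 e4 e5 e6 hab hbc hac
    tauto
  refine pairTerm_congr f x {a, b, c} (by simp) (by simp) (by simp) (by simp) (by simp) (by simp)
    (by simp) (by simp) ?_ ?_ ?_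
  · simp only [EmptyOn, Equiv.Perm.mul_apply, Set.mem_insert_iff, Set.mem_singleton_iff,
      forall_eq_or_imp, forall_eq, Equiv.swap_apply_left, Equiv.swap_apply_right,
      e1, e2, e3, e4, e5, e6]
    simp only [ne_eq, hab, hbc, hac, hab.symm, hbc.symm, hac.symm, not_true_eq_false,
      not_false_eq_true, false_implies, true_implies, true_and, and_true, r1, r2, r3, r4, r5,
      t1, t2, t3, t4, t5]
    clear hne r1 r2 r3 r4 r5 t1 t2 t3 t4 t5 e1 e2 e3 e4 e5 e6 hab hbc hac
    tauto
  · ext i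
    simp only [Equiv.Perm.mul_apply, Equiv.swap_apply_def]
    split_ifs <;> simp_all
  · intro h1 h2 h3
    obtain ⟨hA, hB⟩ := core h1 h2 h3
    funext i j
    simp only [pairChain, Pi.add_apply, rectChain_apply, Equiv.Perm.mul_apply,
      Equiv.swap_apply_left, Equiv.swap_apply_right, e1, e2, e3, e4, e5, e6,
      ← arcInd_add hA, ← arcInd_add hB]
    ring

end

end Grid

/-! ### Annuli, and the sum over all pairs of rectangles -/

namespace Grid

variable {n : ℕ} [NeZero n]

section

variable {M : Type} [AddCommGroup M] (f : Generator n → TwoChain n → M)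

/-- After the exchange, the second rectangle over the same columns occupies the complementary rows.
The two fill a vertical annulus, which meets every column between `a` and `b` in a point of `x`, so
its width must be one. -/
theorem pairTerm_same_order (x : Generator n) (a b : Fin n) :
    pairTerm f x a b a b = if b = a + 1 ∧ a ≠ b then f x (colChain a) else 0 := by
  have hiff : IsRectPair x a b a b ↔ b = a + 1 ∧ a ≠ b := by
    constructor
    · rintro ⟨h1, h2⟩
      refine ⟨(forall_not_inArc_iff h1.1).1 fun i hia hib hi => ?_, h1.1⟩
      have p1 := h1.2 i hia hib
      have p2 := h2.2 i hia hib
      simp only [Equiv.Perm.mul_apply, Equiv.swap_apply_left, Equiv.swap_apply_right,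
        Equiv.swap_apply_of_ne_of_ne hia hib] at p2
      have h := arcInd_add_swap (fun e => h1.1 (x.injective e) : x a ≠ x b) (x i)
      have q1 : ¬ InArc (x a) (x b) (x i) := fun r => p1 ⟨hi, r⟩
      have q2 : ¬ InArc (x b) (x a) (x i) := fun r => p2 ⟨hi, r⟩
      simp [arcInd, q1, q2] at h
    · rintro ⟨h, hab⟩
      have h' := (forall_not_inArc_iff hab).2 h
      exact ⟨⟨hab, fun i hia hib r => h' i hia hib r.1⟩, ⟨hab, fun i hia hib r => h' i hia hib r.1⟩⟩
  rw [pairTerm]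
  by_cases h : IsRectPair x a b a b
  · rw [if_pos h, if_pos (hiff.1 h), mul_assoc, Equiv.swap_mul_self, mul_one]
    congr 1
    funext i j
    have hab := h.1.1
    simp only [pairChain, Pi.add_apply, rectChain_apply, Equiv.Perm.mul_apply,
      Equiv.swap_apply_left, Equiv.swap_apply_right]
    rw [← mul_add, arcInd_add_swap (fun e => hab (x.injective e) : x a ≠ x b), mul_one, arcInd,
      colChain]
    have h' := (forall_not_inArc_iff hab).2 (hiff.1 h).1 i
    by_cases hia : i = a
    · subst hia; simp [inArc_left hab]
    · by_cases hib : i = b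
      · subst hib; simp [not_inArc_right, hia]
      · simp [h' hia hib, hia]
  · rw [if_neg h, if_neg fun h' => h (hiff.2 h')]

/-- The same with rows and columns exchanged: the two rectangles fill a horizontal annulus. -/
theorem pairTerm_opposite_order (x : Generator n) (a b : Fin n) :
    pairTerm f x a b b a = if x b = x a + 1 ∧ a ≠ b then f x (rowChain (x a)) else 0 := by
  have hiff : IsRectPair x a b b a ↔ x b = x a + 1 ∧ a ≠ b := by
    constructor
    · rintro ⟨h1, h2⟩
      have hx : x a ≠ x b := fun e => h1.1 (x.injective e)
      refine ⟨(forall_not_inArc_iff hx).1 fun j hja hjb hj => ?_, h1.1⟩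
      obtain ⟨i, rfl⟩ := x.surjective j
      have hia : i ≠ a := fun e => hja (e ▸ rfl)
      have hib : i ≠ b := fun e => hjb (e ▸ rfl)
      have p1 := h1.2 i hia hib
      have p2 := h2.2 i hib hia
      simp only [Equiv.Perm.mul_apply, Equiv.swap_apply_left, Equiv.swap_apply_right,
        Equiv.swap_apply_of_ne_of_ne hia hib] at p2
      have h := arcInd_add_swap h1.1 i
      have q1 : ¬ InArc a b i := fun r => p1 ⟨r, hj⟩
      have q2 : ¬ InArc b a i := fun r => p2 ⟨r, hj⟩
      simp [arcInd, q1, q2] at h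
    · rintro ⟨h, hab⟩
      have hx : x a ≠ x b := fun e => hab (x.injective e)
      have h' := (forall_not_inArc_iff hx).2 h
      have h'' : ∀ i, i ≠ a → i ≠ b → ¬ InArc (x a) (x b) (x i) := fun i hia hib =>
        h' (x i) (fun e => hia (x.injective e)) (fun e => hib (x.injective e))
      refine ⟨⟨hab, fun i hia hib r => h'' i hia hib r.2⟩, ⟨hab.symm, fun i hib hia r => ?_⟩⟩
      simp only [Equiv.Perm.mul_apply, Equiv.swap_apply_left, Equiv.swap_apply_right,
        Equiv.swap_apply_of_ne_of_ne hia hib] at r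
      exact h'' i hia hib r.2
  rw [pairTerm]
  by_cases h : IsRectPair x a b b a
  · rw [if_pos h, if_pos (hiff.1 h), mul_assoc, Equiv.swap_comm b a, Equiv.swap_mul_self, mul_one]
    congr 1
    funext i j
    have hab := h.1.1
    have hx : x a ≠ x b := fun e => hab (x.injective e)
    simp only [pairChain, Pi.add_apply, rectChain_apply, Equiv.Perm.mul_apply,
      Equiv.swap_apply_left, Equiv.swap_apply_right]
    rw [← add_mul, arcInd_add_swap hab, one_mul, arcInd, rowChain]
    have h' := (forall_not_inArc_iff hx).2 (hiff.1 h).1 j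
    by_cases hia : j = x a
    · subst hia; simp [inArc_left hx]
    · by_cases hib : j = x b
      · subst hib; simp [not_inArc_right, hia]
      · simp [h' hia hib, hia]
  · rw [if_neg h, if_neg fun h' => h (hiff.2 h')]

theorem pairTerm_self_left (x : Generator n) (a c d : Fin n) : pairTerm f x a a c d = 0 :=
  if_neg fun h => h.1.1 rfl

theorem pairTerm_self_right (x : Generator n) (a b c : Fin n) : pairTerm f x a b c c = 0 :=
  if_neg fun h => h.2.1 rfl

/-- Splitting a double sum by the position of the summation indices relative to two indices. -/
theorem sum_sum_split (G : Fin n → Fin n → M) (hG : ∀ c, G c c = 0) {a b : Fin n} (hab : a ≠ b) :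
    ∑ c, ∑ d, G c d = ∑ c, ∑ d, (if c ≠ a ∧ c ≠ b ∧ d ≠ a ∧ d ≠ b then G c d else 0) +
      ∑ e, (if b ≠ e ∧ a ≠ e then G b e + G e b + G a e + G e a else 0) + (G a b + G b a) := by
  have key : ∀ c d, G c d = (if c ≠ a ∧ c ≠ b ∧ d ≠ a ∧ d ≠ b then G c d else 0) +
      ((if c = b then (if b ≠ d ∧ a ≠ d then G b d else 0) else 0) +
      (if d = b then (if b ≠ c ∧ a ≠ c then G c b else 0) else 0) +
      (if c = a then (if b ≠ d ∧ a ≠ d then G a d else 0) else 0) +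
      (if d = a then (if b ≠ c ∧ a ≠ c then G c a else 0) else 0)) +
      ((if c = a then (if d = b then G a b else 0) else 0) +
      (if c = b then (if d = a then G b a else 0) else 0)) := by
    intro c d
    by_cases h1 : c = a
    · subst h1
      by_cases h3 : d = c
      · subst h3; simp [hab, hG]
      · by_cases h4 : d = b
        · subst h4; simp [hab, hab.symm]
        · simp [hab, h3, h4, Ne.symm h3, Ne.symm h4]
    · by_cases h2 : c = b
      · subst h2
        by_cases h3 : d = a
        · subst h3; simp [hab, hab.symm]
        · by_cases h4 : d = c
          · subst h4; simp [hab, h1, h3, hG]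
          · simp [hab, h1, h3, h4, Ne.symm h3, Ne.symm h4]
      · by_cases h3 : d = a
        · subst h3; simp [hab, h1, h2, Ne.symm h1, Ne.symm h2]
        · by_cases h4 : d = b
          · subst h4; simp [h1, h2, h3, Ne.symm h1, Ne.symm h2]
          · simp [h1, h2, h3, h4]
  have hs : ∑ e, (if b ≠ e ∧ a ≠ e then G b e + G e b + G a e + G e a else 0) =
      ∑ e, (if b ≠ e ∧ a ≠ e then G b e else 0) + ∑ e, (if b ≠ e ∧ a ≠ e then G e b else 0) +
      ∑ e, (if b ≠ e ∧ a ≠ e then G a e else 0) + ∑ e, (if b ≠ e ∧ a ≠ e then G e a else 0) := by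
    simp only [← Finset.sum_add_distrib]
    refine Finset.sum_congr rfl fun e _ => ?_
    split_ifs <;> simp
  rw [hs]
  calc ∑ c, ∑ d, G c d = _ := Finset.sum_congr rfl fun c _ => Finset.sum_congr rfl fun d _ => key c d
    _ = _ := by
      simp only [Finset.sum_add_distrib]
      congr 1
      · congr 1
        simp only [Finset.sum_ite_eq', Finset.mem_univ, if_true, Finset.sum_ite_irrel,
          Finset.sum_const_zero]
      · simp only [Finset.sum_ite_eq', Finset.mem_univ, if_true, Finset.sum_ite_irrel,
          Finset.sum_const_zero]

theorem sum_rotate (H : Fin n → Fin n → Fin n → M) :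
    ∑ a, ∑ b, ∑ c, H b c a = ∑ a, ∑ b, ∑ c, H a b c := by
  rw [Finset.sum_comm]
  exact Finset.sum_congr rfl fun b _ => Finset.sum_comm

theorem sum_swap (H : Fin n → Fin n → Fin n → M) :
    ∑ a, ∑ b, ∑ c, H a c b = ∑ a, ∑ b, ∑ c, H a b c :=
  Finset.sum_congr rfl fun _ _ => Finset.sum_comm

theorem sum_reverse (H : Fin n → Fin n → Fin n → M) :
    ∑ a, ∑ b, ∑ c, H c b a = ∑ a, ∑ b, ∑ c, H a b c := 
  (sum_swap fun a b c => H b c a).trans (sum_rotate H)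

open Classical in
-- The four ways of sharing one column are each split in two by a cyclic order. The four L-shape
-- lemmas identify the eight resulting sums in pairs, which cancel in characteristic two.
theorem sum_pairTerm_triples (hM : ∀ m : M, m + m = 0) (x : Generator n) :
    ∑ a, ∑ b, ∑ e, (if a ≠ b ∧ b ≠ e ∧ a ≠ e then
      pairTerm f x a b b e + pairTerm f x a b e b + pairTerm f x a b a e + pairTerm f x a b e a
      else 0) = 0 := by
  let T : (Fin n → Fin n → Fin n → Prop) → (Fin n → Fin n → Fin n → M) →
      Fin n → Fin n → Fin n → M := fun p F a b e =>
    if a ≠ b ∧ b ≠ e ∧ a ≠ e then if p a b e then F a b e else 0 else 0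
  let S : (Fin n → Fin n → Fin n → M) → M := fun F => ∑ a, ∑ b, ∑ e, F a b e
  let p : Fin n → Fin n → Fin n → Prop := fun a b e => InArc a b e
  let q : Fin n → Fin n → Fin n → Prop := fun a b e => InArc (x a) (x b) (x e)
  let q' : Fin n → Fin n → Fin n → Prop := fun a b e => InArc (x a) (x e) (x b)
  let A := fun a b e => pairTerm f x a b b e
  let B := fun a b e => pairTerm f x a b e b
  let C := fun a b e => pairTerm f x a b a e
  let E := fun a b e => pairTerm f x a b e a
  have hA1 : S (T q' A) = S (T (fun a b e => ¬ p a b e) B) := by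
    refine Eq.trans ?_ (sum_rotate (T (fun a b e => ¬ p a b e) B))
    refine Finset.sum_congr rfl fun a _ => Finset.sum_congr rfl fun b _ =>
      Finset.sum_congr rfl fun c _ => ?_
    by_cases h : a ≠ b ∧ b ≠ c ∧ a ≠ c
    · have h' : b ≠ c ∧ c ≠ a ∧ b ≠ a := ⟨h.2.1, h.2.2.symm, h.1.symm⟩
      simp only [T, if_pos h, if_pos h', q', A, B, p]
      exact pairTerm_bottom f x h.1 h.2.1 h.2.2
    · have h' : ¬ (b ≠ c ∧ c ≠ a ∧ b ≠ a) := fun r => h ⟨r.2.2.symm, r.1, r.2.1.symm⟩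
      simp only [T, if_neg h, if_neg h']
  have hA2 : S (T (fun a b e => ¬ q' a b e) A) = S (T p C) := by
    refine Eq.trans ?_ (sum_swap (T p C))
    refine Finset.sum_congr rfl fun a _ => Finset.sum_congr rfl fun b _ =>
      Finset.sum_congr rfl fun c _ => ?_
    by_cases h : a ≠ b ∧ b ≠ c ∧ a ≠ c
    · have h' : a ≠ c ∧ c ≠ b ∧ a ≠ b := ⟨h.2.2, h.2.1.symm, h.1⟩
      simp only [T, if_pos h, if_pos h', q', A, C, p]
      exact pairTerm_left f x h.1 h.2.1 h.2.2
    · have h' : ¬ (a ≠ c ∧ c ≠ b ∧ a ≠ b) := fun r => h ⟨r.2.2, r.2.1.symm, r.1⟩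
      simp only [T, if_neg h, if_neg h']
  have hB1 : S (T p B) = S (T q E) := by
    refine Eq.trans ?_ (sum_reverse (T q E))
    refine Finset.sum_congr rfl fun a _ => Finset.sum_congr rfl fun b _ =>
      Finset.sum_congr rfl fun c _ => ?_
    by_cases h : a ≠ b ∧ b ≠ c ∧ a ≠ c
    · have h' : c ≠ b ∧ b ≠ a ∧ c ≠ a := ⟨h.2.1.symm, h.1.symm, h.2.2.symm⟩
      simp only [T, if_pos h, if_pos h', q, E, B, p]
      exact pairTerm_right f x h.1 h.2.1 h.2.2
    · have h' : ¬ (c ≠ b ∧ b ≠ a ∧ c ≠ a) := fun r => h ⟨r.2.1.symm, r.1.symm, r.2.2.symm⟩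
      simp only [T, if_neg h, if_neg h']
  have hC2 : S (T (fun a b e => ¬ p a b e) C) = S (T (fun a b e => ¬ q a b e) E) := by
    refine Eq.trans ?_ (sum_rotate (T (fun a b e => ¬ q a b e) E))
    refine Finset.sum_congr rfl fun a _ => Finset.sum_congr rfl fun b _ =>
      Finset.sum_congr rfl fun c _ => ?_
    by_cases h : a ≠ b ∧ b ≠ c ∧ a ≠ c
    · have h' : b ≠ c ∧ c ≠ a ∧ b ≠ a := ⟨h.2.1, h.2.2.symm, h.1.symm⟩
      simp only [T, if_pos h, if_pos h', q, C, E, p]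
      exact pairTerm_top f x h.1 h.2.1 h.2.2
    · have h' : ¬ (b ≠ c ∧ c ≠ a ∧ b ≠ a) := fun r => h ⟨r.2.2.symm, r.1, r.2.1.symm⟩
      simp only [T, if_neg h, if_neg h']
  have hsplit : ∑ a, ∑ b, ∑ e, (if a ≠ b ∧ b ≠ e ∧ a ≠ e then
      pairTerm f x a b b e + pairTerm f x a b e b + pairTerm f x a b a e + pairTerm f x a b e a
      else 0) = (S (T q' A) + S (T (fun a b e => ¬ q' a b e) A)) +
        (S (T p B) + S (T (fun a b e => ¬ p a b e) B)) +
        (S (T p C) + S (T (fun a b e => ¬ p a b e) C)) +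
        (S (T q E) + S (T (fun a b e => ¬ q a b e) E)) := by
    simp only [S, ← Finset.sum_add_distrib]
    refine Finset.sum_congr rfl fun a _ => Finset.sum_congr rfl fun b _ =>
      Finset.sum_congr rfl fun c _ => ?_
    by_cases h : a ≠ b ∧ b ≠ c ∧ a ≠ c
    · have hs : ∀ (r : Prop) [Decidable r] [Decidable (¬ r)] (m : M), (if r then m else 0) + (if ¬ r then m else 0) = m := by
        intro r _ _ m; by_cases hr : r <;> simp [hr]
      simp only [T, if_pos h, hs]
      rfl
    · simp only [T, if_neg h, add_zero]
  rw [hsplit, hA1, hA2, hB1, hC2]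
  have := hM (S (T (fun a b e => ¬ p a b e) B) + S (T p C) + S (T q E) +
    S (T (fun a b e => ¬ q a b e) E))
  rw [← this]
  abel

theorem sum_pairTerm_disjoint (hM : ∀ m : M, m + m = 0) (x : Generator n) :
    ∑ a, ∑ b, ∑ c, ∑ d, (if c ≠ a ∧ c ≠ b ∧ d ≠ a ∧ d ≠ b then pairTerm f x a b c d else 0) = 0 := by
  let F : (Fin n × Fin n) × (Fin n × Fin n) → M := fun p =>
    if p.2.1 ≠ p.1.1 ∧ p.2.1 ≠ p.1.2 ∧ p.2.2 ≠ p.1.1 ∧ p.2.2 ≠ p.1.2 then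
      pairTerm f x p.1.1 p.1.2 p.2.1 p.2.2 else 0
  have hF : ∑ a, ∑ b, ∑ c, ∑ d, (if c ≠ a ∧ c ≠ b ∧ d ≠ a ∧ d ≠ b then
      pairTerm f x a b c d else 0) = ∑ p, F p := by
    rw [Fintype.sum_prod_type, Fintype.sum_prod_type]
    refine Finset.sum_congr rfl fun a _ => Finset.sum_congr rfl fun b _ => ?_
    rw [Fintype.sum_prod_type]
  rw [hF]
  refine Finset.sum_involution (fun p _ => (p.2, p.1)) ?_ ?_ (fun _ _ => Finset.mem_univ _)
    (fun _ _ => rfl)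
  · rintro ⟨⟨a, b⟩, ⟨c, d⟩⟩ -
    simp only [F]
    by_cases h : c ≠ a ∧ c ≠ b ∧ d ≠ a ∧ d ≠ b
    · rw [if_pos h, if_pos ⟨h.1.symm, h.2.2.1.symm, h.2.1.symm, h.2.2.2.symm⟩,
        pairTerm_disjoint f x h.1.symm h.2.2.1.symm h.2.1.symm h.2.2.2.symm, hM]
    · rw [if_neg h, if_neg fun r => h ⟨r.1.symm, r.2.2.1.symm, r.2.1.symm, r.2.2.2.symm⟩, add_zero]
  · rintro ⟨⟨a, b⟩, ⟨c, d⟩⟩ - h0 he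
    simp only [Prod.mk.injEq] at he
    refine h0 (if_neg fun h => h.1 ?_)
    exact he.1.1

/-- The square of the rectangle-counting operator: pairs of rectangles cancel, apart from those
which form an annulus. -/
theorem sum_pairTerm (hM : ∀ m : M, m + m = 0) (x : Generator n) :
    ∑ a, ∑ b, ∑ c, ∑ d, pairTerm f x a b c d =
      ∑ r : Fin n, if r = r + 1 then 0 else f x (colChain r) + f x (rowChain r) := by
  have h1 : ∀ a b, ∑ c, ∑ d, pairTerm f x a b c d =
      ∑ c, ∑ d, (if c ≠ a ∧ c ≠ b ∧ d ≠ a ∧ d ≠ b then pairTerm f x a b c d else 0) +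
      ∑ e, (if a ≠ b ∧ b ≠ e ∧ a ≠ e then pairTerm f x a b b e + pairTerm f x a b e b +
        pairTerm f x a b a e + pairTerm f x a b e a else 0) +
      (pairTerm f x a b a b + pairTerm f x a b b a) := by
    intro a b
    by_cases hab : a = b
    · subst hab; simp [pairTerm_self_left]
    · rw [sum_sum_split _ (fun c => pairTerm_self_right f x a b c) hab]
      simp [hab]
  simp only [h1, Finset.sum_add_distrib, sum_pairTerm_disjoint f hM, sum_pairTerm_triples f hM,
    zero_add]
  -- The case `a = a + 1` occurs only for `n = 1`, where there are no rectangles at all.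
  have h2 : ∀ a, ∑ b, pairTerm f x a b a b = if a = a + 1 then 0 else f x (colChain a) := by
    intro a
    simp only [pairTerm_same_order]
    rw [Finset.sum_eq_single (a + 1)]
    · by_cases h : a = a + 1
      · rw [if_pos h, if_neg fun r => r.2 h]
      · rw [if_neg h, if_pos ⟨rfl, h⟩]
    · intro b _ hb; simp [hb]
    · simp
  have h3 : ∀ a, ∑ b, pairTerm f x a b b a =
      if x a = x a + 1 then 0 else f x (rowChain (x a)) := by
    intro a
    simp only [pairTerm_opposite_order]
    rw [Finset.sum_eq_single (x.symm (x a + 1))]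
    · by_cases h : x a = x a + 1
      · rw [if_pos h, if_neg]; rintro ⟨-, h'⟩; apply h'; rw [← h]; simp
      · rw [if_neg h, if_pos]
        refine ⟨by simp, fun e => h ?_⟩
        conv_lhs => rw [e]
        simp
    · intro b _ hb
      rw [if_neg]
      rintro ⟨h, -⟩
      exact hb (by rw [← h]; simp)
    · simp
  simp only [h2, h3]
  rw [Equiv.sum_comp x fun r => if r = r + 1 then (0 : M) else f x (rowChain r),
    ← Finset.sum_add_distrib]
  refine Finset.sum_congr rfl fun r _ => ?_
  split_ifs <;> simp

end

end Grid

namespace Grid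

/-! ### Operations on ordered partitions -/

section

variable {M : Type} [AddCommGroup M]

/-- The sum of a function over a list. -/
def listSum {α : Type} (L : List α) (g : α → M) : M := (L.map g).sum

@[simp] theorem listSum_nil {α : Type} (g : α → M) : listSum [] g = 0 := rfl

@[simp] theorem listSum_cons {α : Type} (a : α) (L : List α) (g : α → M) :
    listSum (a :: L) g = g a + listSum L g := by simp [listSum]

theorem listSum_append {α : Type} (L L' : List α) (g : α → M) :
    listSum (L ++ L') g = listSum L g + listSum L' g := by simp [listSum]

theorem listSum_map {α β : Type} (L : List α) (h : α → β) (g : β → M) :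
    listSum (L.map h) g = listSum L fun a => g (h a) := by simp [listSum, Function.comp_def]

theorem listSum_congr {α : Type} {L : List α} {g h : α → M} (H : ∀ a ∈ L, g a = h a) :
    listSum L g = listSum L h := by
  rw [listSum, listSum, List.map_congr_left H]

theorem listSum_add {α : Type} (L : List α) (g h : α → M) :
    listSum L (fun a => g a + h a) = listSum L g + listSum L h := by
  simp [listSum, List.sum_map_add]

theorem listSum_zero {α : Type} (L : List α) : listSum L (fun _ => (0 : M)) = 0 := by
  simp [listSum]

theorem listSum_sum {α ι : Type} (L : List α) (s : Finset ι) (g : ι → α → M) :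
    listSum L (fun a => ∑ i ∈ s, g i a) = ∑ i ∈ s, listSum L (g i) := by
  induction L with
  | nil => simp
  | cons a L ih => simp [ih, Finset.sum_add_distrib]

theorem listSum_comm {α β : Type} (L : List α) (L' : List β) (g : α → β → M) :
    listSum L (fun a => listSum L' (g a)) = listSum L' fun b => listSum L fun a => g a b := by
  induction L with
  | nil => simp [listSum_zero]
  | cons a L ih => simp [ih, listSum_add]

theorem listSum_coarsenings_cons_cons (a b : ℕ+) (t : OrderedPartition)
    (g : OrderedPartition → M) : listSum (coarsenings (a :: b :: t)) g =
      g ((a + b) :: t) + listSum (coarsenings (b :: t)) fun m => g (a :: m) := by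
  rw [coarsenings, listSum_cons, listSum_map]

theorem unitEnlargements_nil : unitEnlargements [] = [[1]] := rfl

theorem unitEnlargements_cons (a : ℕ+) (t : OrderedPartition) :
    unitEnlargements (a :: t) = (1 :: a :: t) :: (unitEnlargements t).map (a :: ·) := by
  rw [unitEnlargements, unitEnlargements, List.length_cons, List.range_succ_eq_map]
  simp [Function.comp_def]

theorem listSum_unitEnlargements_cons (a : ℕ+) (t : OrderedPartition)
    (g : OrderedPartition → M) : listSum (unitEnlargements (a :: t)) g =
      g (1 :: a :: t) + listSum (unitEnlargements t) fun m => g (a :: m) := by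
  rw [unitEnlargements_cons, listSum_cons, listSum_map]

/-- The initial reduction. -/
def initialReduction : OrderedPartition → List OrderedPartition
  | [] => []
  | _ :: t => [t]

/-- The final reduction. -/
def finalReduction : OrderedPartition → List OrderedPartition
  | [] => []
  | a :: t => [(a :: t).dropLast]

theorem listSum_reductions (l : OrderedPartition) (g : OrderedPartition → M) :
    listSum (reductions l) g = listSum (initialReduction l) g + listSum (finalReduction l) g := by
  cases l <;> simp [reductions, initialReduction, finalReduction]

theorem listSum_finalReduction_cons (a : ℕ+) {t : OrderedPartition} (ht : t ≠ [])
    (g : OrderedPartition → M) : listSum (finalReduction (a :: t)) g =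
      listSum (finalReduction t) fun m => g (a :: m) := by
  cases t with
  | nil => exact absurd rfl ht
  | cons b t => simp [finalReduction]

theorem ne_nil_of_mem_coarsenings {l m : OrderedPartition} (h : m ∈ coarsenings l) : m ≠ [] := by
  match l, h with
  | a :: b :: t, h =>
    rw [coarsenings, List.mem_cons, List.mem_map] at h
    rcases h with rfl | ⟨m', -, rfl⟩ <;> simp

theorem ne_nil_of_mem_unitEnlargements {l m : OrderedPartition} (h : m ∈ unitEnlargements l) :
    m ≠ [] := by
  cases l with
  | nil => rw [unitEnlargements_nil, List.mem_singleton] at h; simp [h]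
  | cons a t =>
    rw [unitEnlargements_cons, List.mem_cons, List.mem_map] at h
    rcases h with rfl | ⟨m', -, rfl⟩ <;> simp

end

section

variable {M : Type} [AddCommGroup M]

/-- Two merges can be made in either order with the same result, by associativity of addition when
they overlap, so every term occurs twice. -/
theorem listSum_coarsenings_coarsenings (hM : ∀ m : M, m + m = 0) (l : OrderedPartition)
    (g : OrderedPartition → M) :
    listSum (coarsenings l) (fun m => listSum (coarsenings m) g) = 0 := by
  induction l generalizing g with
  | nil => rfl
  | cons a l ih =>
    match l with
    | [] => rfl
    | [b] => simp [coarsenings]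
    | b :: c :: t =>
      have h := ih fun m => g (a :: m)
      rw [listSum_coarsenings_cons_cons] at h
      rw [listSum_coarsenings_cons_cons, listSum_coarsenings_cons_cons,
        listSum_coarsenings_cons_cons, listSum_coarsenings_cons_cons,
        listSum_congr (fun m _ => listSum_coarsenings_cons_cons a b m g), listSum_add, ← add_assoc a]
      rw [eq_neg_of_add_eq_zero_right h]
      have h1 := hM (g ((a + b + c) :: t))
      have h2 := hM (listSum (coarsenings (c :: t)) fun m => g ((a + b) :: m))
      linear_combination (norm := abel) h1 + h2

/-- Merging the first two parts and deleting the result equals deleting two first parts; the other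
merges commute with the deletion. -/
theorem listSum_coarsenings_initial (hM : ∀ m : M, m + m = 0) (l : OrderedPartition)
    (g : OrderedPartition → M) :
    listSum (coarsenings l) (fun m => listSum (initialReduction m) g) +
      listSum (initialReduction l) (fun m => listSum (coarsenings m) g) +
      listSum (initialReduction l) (fun m => listSum (initialReduction m) g) = 0 := by
  match l with
  | [] => simp [coarsenings, initialReduction]
  | [a] => simp [coarsenings, initialReduction]
  | a :: b :: t =>
    rw [listSum_coarsenings_cons_cons]
    simp only [initialReduction, listSum_cons, listSum_nil, add_zero]
    have h1 := hM (g t)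
    have h2 := hM (listSum (coarsenings (b :: t)) g)
    linear_combination (norm := abel) h1 + h2

/-- Mirror image of the previous identity; it needs an induction because lists grow at the front. -/
theorem listSum_coarsenings_final (hM : ∀ m : M, m + m = 0) (l : OrderedPartition)
    (g : OrderedPartition → M) :
    listSum (coarsenings l) (fun m => listSum (finalReduction m) g) +
      listSum (finalReduction l) (fun m => listSum (coarsenings m) g) +
      listSum (finalReduction l) (fun m => listSum (finalReduction m) g) = 0 := by
  induction l generalizing g with
  | nil => simp [coarsenings, finalReduction]
  | cons a l ih =>
    match l with
    | [] => simp [coarsenings, finalReduction]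
    | [b] => simp [coarsenings, finalReduction, hM]
    | b :: c :: t =>
      have h := ih fun m => g (a :: m)
      rw [listSum_coarsenings_cons_cons,
        listSum_congr (fun m hm => listSum_finalReduction_cons a (ne_nil_of_mem_coarsenings hm) g)]
      have e1 : listSum (finalReduction (a :: b :: c :: t)) (fun m => listSum (coarsenings m) g) =
          listSum (finalReduction ((a + b) :: c :: t)) g +
          listSum (finalReduction (b :: c :: t))
            (fun m => listSum (coarsenings m) fun m => g (a :: m)) := by
        simp [finalReduction, listSum_coarsenings_cons_cons]
      have e2 : listSum (finalReduction (a :: b :: c :: t)) (fun m => listSum (finalReduction m) g) =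
          listSum (finalReduction (b :: c :: t))
            (fun m => listSum (finalReduction m) fun m => g (a :: m)) := by
        simp [finalReduction]
      rw [e1, e2]
      have h1 := hM (listSum (finalReduction ((a + b) :: c :: t)) g)
      linear_combination (norm := abel) h + h1

theorem listSum_initial_final (l : OrderedPartition) (g : OrderedPartition → M) :
    listSum (initialReduction l) (fun m => listSum (finalReduction m) g) =
      listSum (finalReduction l) fun m => listSum (initialReduction m) g := by
  match l with
  | [] => rfl
  | [a] => rfl
  | a :: b :: t => rfl

theorem listSum_unit_unit (hM : ∀ m : M, m + m = 0) (l : OrderedPartition)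
    (g : OrderedPartition → M) :
    listSum (unitEnlargements l) (fun m => listSum (unitEnlargements m) g) = 0 := by
  induction l generalizing g with
  | nil => simp [unitEnlargements_nil, unitEnlargements_cons, hM]
  | cons a t ih =>
    rw [listSum_unitEnlargements_cons, listSum_unitEnlargements_cons, listSum_unitEnlargements_cons,
      listSum_congr (fun m _ => listSum_unitEnlargements_cons a m g), listSum_add,
      ih fun m => g (a :: m)]
    have h1 := hM (g (1 :: 1 :: a :: t))
    have h2 := hM (listSum (unitEnlargements t) fun m => g (1 :: a :: m))
    linear_combination (norm := abel) h1 + h2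

/-- The only term that does not cancel inserts a `1` in front and deletes it again. -/
theorem listSum_unit_initial (hM : ∀ m : M, m + m = 0) (l : OrderedPartition)
    (g : OrderedPartition → M) :
    listSum (unitEnlargements l) (fun m => listSum (initialReduction m) g) +
      listSum (initialReduction l) (fun m => listSum (unitEnlargements m) g) = g l := by
  cases l with
  | nil => simp [unitEnlargements_nil, initialReduction]
  | cons a t =>
    rw [listSum_unitEnlargements_cons]
    simp only [initialReduction, listSum_cons, listSum_nil, add_zero]
    rw [add_assoc, hM, add_zero]

theorem listSum_unit_final (hM : ∀ m : M, m + m = 0) (l : OrderedPartition)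
    (g : OrderedPartition → M) :
    listSum (unitEnlargements l) (fun m => listSum (finalReduction m) g) +
      listSum (finalReduction l) (fun m => listSum (unitEnlargements m) g) = g l := by
  induction l generalizing g with
  | nil => simp [unitEnlargements_nil, finalReduction]
  | cons a l ih =>
    match l with
    | [] =>
      have h1 := hM (g [1])
      simp only [unitEnlargements_nil, unitEnlargements_cons, finalReduction, listSum_cons,
        listSum_nil, List.dropLast, List.map_cons, List.map_nil, add_zero]
      linear_combination (norm := abel) h1
    | b :: t =>
      have h := ih fun m => g (a :: m)
      rw [listSum_unitEnlargements_cons, listSum_congr (fun m hm =>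
        listSum_finalReduction_cons a (ne_nil_of_mem_unitEnlargements hm) g)]
      have e1 : listSum (finalReduction (a :: b :: t)) (fun m => listSum (unitEnlargements m) g) =
          listSum (finalReduction (1 :: a :: b :: t)) g +
          listSum (finalReduction (b :: t))
            (fun m => listSum (unitEnlargements m) fun m => g (a :: m)) := by
        simp [finalReduction, listSum_unitEnlargements_cons]
      rw [e1]
      have h1 := hM (listSum (finalReduction (1 :: a :: b :: t)) g)
      linear_combination (norm := abel) h + h1

/-- A part `a` becomes `a + 1` in two ways, from a `1` inserted before it or after it; these cancel,
and all other merges commute with the insertion. -/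
theorem listSum_unit_coarsenings (hM : ∀ m : M, m + m = 0) (l : OrderedPartition)
    (g : OrderedPartition → M) :
    listSum (unitEnlargements l) (fun m => listSum (coarsenings m) g) +
      listSum (coarsenings l) (fun m => listSum (unitEnlargements m) g) = 0 := by
  induction l generalizing g with
  | nil => simp [unitEnlargements_nil, coarsenings]
  | cons a l ih =>
    match l with
    | [] => simp [unitEnlargements_nil, unitEnlargements_cons, coarsenings, add_comm a 1, hM]
    | b :: t =>
      have h := ih fun m => g (a :: m)
      rw [listSum_unitEnlargements_cons] at h
      rw [listSum_unitEnlargements_cons, listSum_unitEnlargements_cons,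
        listSum_coarsenings_cons_cons 1, listSum_coarsenings_cons_cons a b t,
        listSum_coarsenings_cons_cons a b t, listSum_coarsenings_cons_cons a 1,
        listSum_congr (fun m _ => listSum_coarsenings_cons_cons a b m g), listSum_add,
        listSum_unitEnlargements_cons,
        listSum_congr (L := coarsenings (b :: t)) (fun m _ => listSum_unitEnlargements_cons a m g),
        listSum_add, add_comm a 1]
      have h1 := hM (g ((1 + a) :: b :: t))
      have h2 := hM (g (1 :: (a + b) :: t))
      have h3 := hM (listSum (coarsenings (b :: t)) fun m => g (1 :: a :: m))
      have h4 := hM (listSum (unitEnlargements t) fun m => g ((a + b) :: m))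
      linear_combination (norm := abel) h + h1 + h2 + h3 + h4

/-- The coarsenings and reductions of an ordered partition. -/
def shortenings (l : OrderedPartition) : List OrderedPartition := coarsenings l ++ reductions l

theorem listSum_shortenings (l : OrderedPartition) (g : OrderedPartition → M) :
    listSum (shortenings l) g = listSum (coarsenings l) g + listSum (initialReduction l) g +
      listSum (finalReduction l) g := by
  rw [shortenings, listSum_append, listSum_reductions, add_assoc]

theorem listSum_shortenings_shortenings (hM : ∀ m : M, m + m = 0) (l : OrderedPartition)
    (g : OrderedPartition → M) :
    listSum (shortenings l) (fun m => listSum (shortenings m) g) = 0 := by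
  simp only [listSum_shortenings, listSum_add]
  have h1 := listSum_coarsenings_coarsenings hM l g
  have h2 := listSum_coarsenings_initial hM l g
  have h3 := listSum_coarsenings_final hM l g
  have h4 := listSum_initial_final l g
  have h5 := hM (listSum (finalReduction l) fun m => listSum (initialReduction m) g)
  rw [h4]
  linear_combination (norm := abel) h1 + h2 + h3 + h5

/-- The initial and the final reduction each leave a copy of `g l`, and the two copies cancel. This
is where both ends of the partition are needed. -/
theorem listSum_unit_shortenings (hM : ∀ m : M, m + m = 0) (l : OrderedPartition)
    (g : OrderedPartition → M) :
    listSum (unitEnlargements l) (fun m => listSum (shortenings m) g) =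
      listSum (shortenings l) fun m => listSum (unitEnlargements m) g := by
  simp only [listSum_shortenings, listSum_add]
  have h1 := listSum_unit_coarsenings hM l g
  have h2 := listSum_unit_initial hM l g
  have h3 := listSum_unit_final hM l g
  have h4 := hM (g l)
  have h5 := hM (listSum (coarsenings l) fun m => listSum (unitEnlargements m) g)
  have h6 := hM (listSum (initialReduction l) fun m => listSum (unitEnlargements m) g)
  have h7 := hM (listSum (finalReduction l) fun m => listSum (unitEnlargements m) g)
  linear_combination (norm := abel) h1 + h2 + h3 + h4 - h5 - h6 - h7

end

end Grid

namespace Grid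

variable {n : ℕ} [NeZero n]

/-! ### The differential on functions -/

/-- Functions of the ends of a domain, the domain, and the ordered partitions. -/
abbrev TripleFun (n : ℕ) (M : Type) : Type :=
  Generator n → Generator n → TwoChain n → (Fin n → OrderedPartition) → M

/-- The pairs of columns which span a rectangle starting at `x`. -/
noncomputable def rectsFrom (x : Generator n) : Finset (Fin n × Fin n) :=
  open Classical in Finset.univ.filter fun p => IsRect x p.1 p.2

/-- The pairs of columns which span a rectangle ending at `y`. -/
noncomputable def rectsTo (y : Generator n) : Finset (Fin n × Fin n) :=
  open Classical in Finset.univ.filter fun p => IsRect (y * Equiv.swap p.1 p.2) p.1 p.2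

theorem mem_rectsFrom {x : Generator n} {p : Fin n × Fin n} :
    p ∈ rectsFrom x ↔ IsRect x p.1 p.2 := by simp [rectsFrom]

theorem mem_rectsTo {y : Generator n} {p : Fin n × Fin n} :
    p ∈ rectsTo y ↔ IsRect (y * Equiv.swap p.1 p.2) p.1 p.2 := by simp [rectsTo]

section

variable (M : Type) [AddCommGroup M]

/-- Removal of a rectangle at the start. -/
noncomputable def startOp : TripleFun n M →+ TripleFun n M where
  toFun g x y D l := ∑ p ∈ rectsFrom x,
    g (x * Equiv.swap p.1 p.2) y (D - rectChain x p.1 p.2) l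
  map_zero' := by funext; simp
  map_add' g h := by funext; simp [Finset.sum_add_distrib]

/-- Removal of a rectangle at the end. -/
noncomputable def endOp : TripleFun n M →+ TripleFun n M where
  toFun g x y D l := ∑ p ∈ rectsTo y,
    g x (y * Equiv.swap p.1 p.2) (D - rectChain (y * Equiv.swap p.1 p.2) p.1 p.2) l
  map_zero' := by funext; simp
  map_add' g h := by funext; simp [Finset.sum_add_distrib]

/-- Removal of one of the annuli through a marking. -/
def annulusOp (G : GridDiagram n) (j : Fin n) : TripleFun n M →+ TripleFun n M where
  toFun g x y D l := g x y (D - hAnnulus G j) l + g x y (D - vAnnulus G j) l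
  map_zero' := by funext; simp
  map_add' g h := by funext; simp; abel

/-- An operation on the `j`-th ordered partition. -/
def partOp (O : OrderedPartition → List OrderedPartition) (j : Fin n) :
    TripleFun n M →+ TripleFun n M where
  toFun g x y D l := listSum (O (l j)) fun m => g x y D (Function.update l j m)
  map_zero' := by funext; simp [listSum_zero]
  map_add' g h := by funext; simp [listSum_add]

variable {M}

theorem partOp_comm (O O' : OrderedPartition → List OrderedPartition) {j k : Fin n} (h : j ≠ k)
    (g : TripleFun n M) : partOp M O j (partOp M O' k g) = partOp M O' k (partOp M O j g) := by
  funext x y D l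
  simp only [partOp, AddMonoidHom.coe_mk, ZeroHom.coe_mk, Function.update_of_ne h,
    Function.update_of_ne h.symm]
  rw [listSum_comm]
  refine listSum_congr fun m _ => listSum_congr fun m' _ => ?_
  rw [Function.update_comm h]

theorem partOp_same (O O' : OrderedPartition → List OrderedPartition) (j : Fin n)
    (g : TripleFun n M) (x y : Generator n) (D : TwoChain n) (l : Fin n → OrderedPartition) :
    partOp M O j (partOp M O' j g) x y D l =
      listSum (O (l j)) fun m => listSum (O' m) fun m' => g x y D (Function.update l j m') := by
  simp [partOp]

theorem startOp_partOp (O : OrderedPartition → List OrderedPartition) (j : Fin n)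
    (g : TripleFun n M) : startOp M (partOp M O j g) = partOp M O j (startOp M g) := by
  funext x y D l
  exact (listSum_sum _ _ _).symm

theorem endOp_partOp (O : OrderedPartition → List OrderedPartition) (j : Fin n)
    (g : TripleFun n M) : endOp M (partOp M O j g) = partOp M O j (endOp M g) := by
  funext x y D l
  exact (listSum_sum _ _ _).symm

theorem annulusOp_partOp (G : GridDiagram n) (i : Fin n)
    (O : OrderedPartition → List OrderedPartition) (j : Fin n) (g : TripleFun n M) :
    annulusOp M G i (partOp M O j g) = partOp M O j (annulusOp M G i g) := by
  funext x y D l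
  exact (listSum_add _ _ _).symm

theorem annulusOp_comm (G : GridDiagram n) (i j : Fin n) (g : TripleFun n M) :
    annulusOp M G i (annulusOp M G j g) = annulusOp M G j (annulusOp M G i g) := by
  funext x y D l
  simp only [annulusOp, AddMonoidHom.coe_mk, ZeroHom.coe_mk, sub_right_comm D (hAnnulus G i),
    sub_right_comm D (vAnnulus G i)]
  abel

theorem startOp_annulusOp (G : GridDiagram n) (j : Fin n) (g : TripleFun n M) :
    startOp M (annulusOp M G j g) = annulusOp M G j (startOp M g) := by
  funext x y D l
  simp only [annulusOp, startOp, AddMonoidHom.coe_mk, ZeroHom.coe_mk, Finset.sum_add_distrib,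
    sub_right_comm D]

theorem endOp_annulusOp (G : GridDiagram n) (j : Fin n) (g : TripleFun n M) :
    endOp M (annulusOp M G j g) = annulusOp M G j (endOp M g) := by
  funext x y D l
  simp only [annulusOp, endOp, AddMonoidHom.coe_mk, ZeroHom.coe_mk, Finset.sum_add_distrib,
    sub_right_comm D]

theorem startOp_endOp (g : TripleFun n M) : startOp M (endOp M g) = endOp M (startOp M g) := by
  funext x y D l
  simp only [startOp, endOp, AddMonoidHom.coe_mk, ZeroHom.coe_mk]
  rw [Finset.sum_comm]
  simp only [sub_right_comm D]

theorem startOp_startOp (hM : ∀ m : M, m + m = 0) (g : TripleFun n M) (x y : Generator n)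
    (D : TwoChain n) (l : Fin n → OrderedPartition) :
    startOp M (startOp M g) x y D l = ∑ r : Fin n, if r = r + 1 then 0 else
      g x y (D - colChain r) l + g x y (D - rowChain r) l := by
  classical
  rw [← sum_pairTerm (fun z C => g z y (D - C) l) hM x]
  simp only [startOp, AddMonoidHom.coe_mk, ZeroHom.coe_mk, rectsFrom, Finset.sum_filter,
    Fintype.sum_prod_type]
  refine Finset.sum_congr rfl fun a _ => Finset.sum_congr rfl fun b _ => ?_
  split_ifs with h
  · refine Finset.sum_congr rfl fun c _ => Finset.sum_congr rfl fun d _ => ?_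
    rw [pairTerm]
    by_cases h' : IsRect (x * Equiv.swap a b) c d
    · rw [if_pos h', if_pos ⟨h, h'⟩, pairChain, sub_sub]
    · rw [if_neg h', if_neg fun r => h' r.2]
  · symm
    exact Finset.sum_eq_zero fun c _ => Finset.sum_eq_zero fun d _ => if_neg fun r => h r.1

theorem endOp_endOp (hM : ∀ m : M, m + m = 0) (g : TripleFun n M) (x y : Generator n)
    (D : TwoChain n) (l : Fin n → OrderedPartition) :
    endOp M (endOp M g) x y D l = ∑ r : Fin n, if r = r + 1 then 0 else
      g x y (D - colChain r) l + g x y (D - rowChain r) l := by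
  classical
  -- The count of pairs from a fixed start is applied at every start `w`, keeping only the pairs
  -- that end at `y`; annuli return to their start, so `w = y` survives.
  let f : Generator n → Generator n → TwoChain n → M := fun w z C =>
    if z = y then g x w (D - C) l else 0
  have h1 : ∑ w, ∑ a, ∑ b, ∑ c, ∑ d, pairTerm (f w) w a b c d =
      ∑ r : Fin n, if r = r + 1 then 0 else
        g x y (D - colChain r) l + g x y (D - rowChain r) l := by
    simp only [sum_pairTerm _ hM]
    rw [Finset.sum_comm]
    refine Finset.sum_congr rfl fun r _ => ?_
    by_cases hr : r = r + 1
    · simp only [if_pos hr, Finset.sum_const_zero]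
    · simp only [if_neg hr, f, Finset.sum_add_distrib, Finset.sum_ite_eq', Finset.mem_univ, if_true]
  rw [← h1]
  have h2 : ∀ c d a b, ∑ w, pairTerm (f w) w c d a b =
      if IsRect (y * Equiv.swap a b) a b ∧
        IsRect (y * Equiv.swap a b * Equiv.swap c d) c d then
      g x (y * Equiv.swap a b * Equiv.swap c d) (D - rectChain (y * Equiv.swap a b) a b -
        rectChain (y * Equiv.swap a b * Equiv.swap c d) c d) l else 0 := by
    intro c d a b
    have e1 : y * Equiv.swap a b * Equiv.swap c d * Equiv.swap c d = y * Equiv.swap a b := by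
      rw [mul_assoc _ (Equiv.swap c d), Equiv.swap_mul_self, mul_one]
    have e2 : y * Equiv.swap a b * Equiv.swap a b = y := by
      rw [mul_assoc, Equiv.swap_mul_self, mul_one]
    rw [Finset.sum_eq_single (y * Equiv.swap a b * Equiv.swap c d)]
    · rw [pairTerm, IsRectPair, pairChain, e1, e2, sub_sub, add_comm (rectChain _ a b)]
      simp only [f, if_true]
      by_cases hc : IsRect (y * Equiv.swap a b * Equiv.swap c d) c d ∧
        IsRect (y * Equiv.swap a b) a b
      · rw [if_pos hc, if_pos hc.symm]
      · rw [if_neg hc, if_neg fun r => hc r.symm]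
    · intro w _ hw
      rw [pairTerm]
      split_ifs
      · refine if_neg fun e => hw ?_
        rw [← e, Equiv.mul_swap_mul_self, Equiv.mul_swap_mul_self]
      · rfl
    · simp
  have h3 : ∑ w, ∑ c, ∑ d, ∑ a, ∑ b, pairTerm (f w) w c d a b =
      ∑ a, ∑ b, ∑ c, ∑ d, ∑ w, pairTerm (f w) w c d a b := by
    have e : ∀ F : Generator n → Fin n → Fin n → Fin n → Fin n → M,
        ∑ w, ∑ c, ∑ d, ∑ a, ∑ b, F w c d a b =
          ∑ q : Generator n × (Fin n × Fin n) × (Fin n × Fin n),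
            F q.1 q.2.1.1 q.2.1.2 q.2.2.1 q.2.2.2 := by
      intro F; simp only [Fintype.sum_prod_type]
    have e' : ∀ F : Fin n → Fin n → Fin n → Fin n → Generator n → M,
        ∑ a, ∑ b, ∑ c, ∑ d, ∑ w, F a b c d w =
          ∑ q : (Fin n × Fin n) × (Fin n × Fin n) × Generator n,
            F q.1.1 q.1.2 q.2.1.1 q.2.1.2 q.2.2 := by
      intro F; simp only [Fintype.sum_prod_type]
    rw [e, e']
    exact Fintype.sum_equiv ⟨fun q => (q.2.2, q.2.1, q.1), fun q => (q.2.2, q.2.1, q.1),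
      fun _ => rfl, fun _ => rfl⟩ _ _ fun _ => rfl
  rw [h3]
  simp only [h2]
  simp only [endOp, AddMonoidHom.coe_mk, ZeroHom.coe_mk, rectsTo, Finset.sum_filter,
    Fintype.sum_prod_type]
  refine Finset.sum_congr rfl fun a _ => Finset.sum_congr rfl fun b _ => ?_
  by_cases h : IsRect (y * Equiv.swap a b) a b
  · rw [if_pos h]
    refine Finset.sum_congr rfl fun c _ => Finset.sum_congr rfl fun d _ => ?_
    by_cases h' : IsRect (y * Equiv.swap a b * Equiv.swap c d) c d
    · rw [if_pos h', if_pos ⟨h, h'⟩]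
    · rw [if_neg h', if_neg fun r => h' r.2]
  · rw [if_neg h]
    symm
    exact Finset.sum_eq_zero fun c _ => Finset.sum_eq_zero fun d _ => if_neg fun r => h r.1

/-- In characteristic two, a sum of commuting endomorphisms of square zero has square zero. -/
theorem sum_sq_eq_zero {E ι : Type} [Ring E] (hE : ∀ e : E, e + e = 0) (s : Finset ι) (b : ι → E)
    (hcomm : ∀ i j, i ≠ j → b i * b j = b j * b i) (hsq : ∀ i, b i * b i = 0) :
    (∑ i ∈ s, b i) * ∑ i ∈ s, b i = 0 := by
  classical
  induction s using Finset.induction_on with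
  | empty => simp
  | insert i s hi ih =>
    have h : b i * ∑ j ∈ s, b j = (∑ j ∈ s, b j) * b i := by
      rw [Finset.mul_sum, Finset.sum_mul]
      exact Finset.sum_congr rfl fun j hj => hcomm i j fun e => hi (e ▸ hj)
    rw [Finset.sum_insert hi, add_mul, mul_add, mul_add, hsq, ih, h, zero_add, add_zero, hE]

variable (M)

/-- The differential on functions. -/
noncomputable def funD (G : GridDiagram n) : AddMonoid.End (TripleFun n M) :=
  let L : AddMonoid.End (TripleFun n M) := startOp M
  let R : AddMonoid.End (TripleFun n M) := endOp M
  let P : Fin n → AddMonoid.End (TripleFun n M) := fun j => annulusOp M G j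
  let I : Fin n → AddMonoid.End (TripleFun n M) := fun j => partOp M unitEnlargements j
  let Q : Fin n → AddMonoid.End (TripleFun n M) := fun j => partOp M shortenings j
  L + R + ∑ j, I j * P j + ∑ j, Q j

/-- The rectangle part `L + R`, the annulus part and the partition part commute and each has square
zero. For the first, `L * L = R * R` is the sum over all annuli, and `L` commutes with `R`. -/
theorem funD_mul_funD (hM : ∀ m : M, m + m = 0) (G : GridDiagram n) :
    funD M G * funD M G = 0 := by
  have hE : ∀ e : AddMonoid.End (TripleFun n M), e + e = 0 := by
    intro e
    ext g x y D l
    exact hM _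
  let L : AddMonoid.End (TripleFun n M) := startOp M
  let R : AddMonoid.End (TripleFun n M) := endOp M
  let P : Fin n → AddMonoid.End (TripleFun n M) := fun j => annulusOp M G j
  let I : Fin n → AddMonoid.End (TripleFun n M) := fun j => partOp M unitEnlargements j
  let Q : Fin n → AddMonoid.End (TripleFun n M) := fun j => partOp M shortenings j
  have hLR : L * R = R * L := by ext1 g; exact startOp_endOp g
  have hLL : L * L = R * R := by
    refine AddMonoidHom.ext fun g => ?_
    funext x y D l
    exact (startOp_startOp hM g x y D l).trans (endOp_endOp hM g x y D l).symm
  have hAI : ∀ j, (L + R) * I j = I j * (L + R) := by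
    intro j
    rw [add_mul, mul_add]
    exact congrArg₂ _ (AddMonoidHom.ext fun g => startOp_partOp _ j g)
      (AddMonoidHom.ext fun g => endOp_partOp _ j g)
  have hAQ : ∀ j, (L + R) * Q j = Q j * (L + R) := by
    intro j
    rw [add_mul, mul_add]
    exact congrArg₂ _ (AddMonoidHom.ext fun g => startOp_partOp _ j g)
      (AddMonoidHom.ext fun g => endOp_partOp _ j g)
  have hAP : ∀ j, (L + R) * P j = P j * (L + R) := by
    intro j
    rw [add_mul, mul_add]
    exact congrArg₂ _ (AddMonoidHom.ext fun g => startOp_annulusOp G j g)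
      (AddMonoidHom.ext fun g => endOp_annulusOp G j g)
  have hPI : ∀ i j, P i * I j = I j * P i := fun i j =>
    AddMonoidHom.ext fun g => annulusOp_partOp G i _ j g
  have hPQ : ∀ i j, P i * Q j = Q j * P i := fun i j =>
    AddMonoidHom.ext fun g => annulusOp_partOp G i _ j g
  have hPP : ∀ i j, P i * P j = P j * P i := fun i j =>
    AddMonoidHom.ext fun g => annulusOp_comm G i j g
  have hII : ∀ i j, i ≠ j → I i * I j = I j * I i := fun i j h =>
    AddMonoidHom.ext fun g => partOp_comm _ _ h g
  have hQQ : ∀ i j, i ≠ j → Q i * Q j = Q j * Q i := fun i j h =>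
    AddMonoidHom.ext fun g => partOp_comm _ _ h g
  have hIsq : ∀ j, I j * I j = 0 := by
    intro j
    refine AddMonoidHom.ext fun g => ?_
    funext x y D l
    exact (partOp_same _ _ j g x y D l).trans (listSum_unit_unit hM _ _)
  have hQsq : ∀ j, Q j * Q j = 0 := by
    intro j
    refine AddMonoidHom.ext fun g => ?_
    funext x y D l
    exact (partOp_same _ _ j g x y D l).trans (listSum_shortenings_shortenings hM _ _)
  have hIQ : ∀ i j, I i * Q j = Q j * I i := by
    intro i j
    refine AddMonoidHom.ext fun g => ?_
    by_cases h : i = j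
    · subst h
      funext x y D l
      exact (partOp_same _ _ i g x y D l).trans ((listSum_unit_shortenings hM _ _).trans
        (partOp_same _ _ i g x y D l).symm)
    · exact partOp_comm _ _ h g
  have hIP : ∀ i j, I i * P i * (I j * P j) = I i * I j * (P i * P j) := by
    intro i j
    rw [mul_assoc, ← mul_assoc (P i), hPI, mul_assoc (I j), ← mul_assoc]
  have hA2 : (L + R) * (L + R) = 0 := by
    rw [add_mul, mul_add, mul_add, hLL, hLR]
    rw [show R * R + R * L + (R * L + R * R) = (R * R + R * L) + (R * R + R * L) by abel, hE]
  have hB2 : (∑ j, I j * P j) * ∑ j, I j * P j = 0 := by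
    refine sum_sq_eq_zero hE _ _ (fun i j h => ?_) fun i => ?_
    · rw [hIP, hIP, hII i j h, hPP]
    · rw [hIP, hIsq, zero_mul]
  have hC2 : (∑ j, Q j) * ∑ j, Q j = 0 := sum_sq_eq_zero hE _ _ hQQ hQsq
  have hAB : (L + R) * (∑ j, I j * P j) = (∑ j, I j * P j) * (L + R) := by
    rw [Finset.mul_sum, Finset.sum_mul]
    refine Finset.sum_congr rfl fun j _ => ?_
    rw [← mul_assoc, hAI, mul_assoc, hAP, mul_assoc]
  have hAC : (L + R) * (∑ j, Q j) = (∑ j, Q j) * (L + R) := by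
    rw [Finset.mul_sum, Finset.sum_mul]
    exact Finset.sum_congr rfl fun j _ => hAQ j
  have hBC : (∑ j, I j * P j) * (∑ j, Q j) = (∑ j, Q j) * ∑ j, I j * P j := by
    rw [Finset.mul_sum, Finset.sum_mul]
    refine Finset.sum_congr rfl fun j _ => ?_
    rw [Finset.mul_sum, Finset.sum_mul]
    refine Finset.sum_congr rfl fun i _ => ?_
    rw [mul_assoc, hPQ, ← mul_assoc, hIQ, mul_assoc]
  change ((L + R) + (∑ j, I j * P j) + ∑ j, Q j) * ((L + R) + (∑ j, I j * P j) + ∑ j, Q j) = 0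
  generalize L + R = A at *
  generalize (∑ j, I j * P j) = B at *
  generalize (∑ j, Q j) = C at *
  rw [add_mul, add_mul, mul_add, mul_add, mul_add, mul_add, mul_add, mul_add, hA2, hB2, hC2, hAB,
    hAC, hBC]
  have h1 := hE (B * A)
  have h2 := hE (C * A)
  have h3 := hE (C * B)
  linear_combination (norm := abel) h1 + h2 + h3

end

end Grid

namespace Grid

variable {n : ℕ} [NeZero n]

/-! ### The differential squares to zero -/

section

variable {M : Type} [AddCommGroup M]

theorem funD_apply (G : GridDiagram n) (g : TripleFun n M) (x y : Generator n) (D : TwoChain n)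
    (l : Fin n → OrderedPartition) : funD M G g x y D l =
      startOp M g x y D l + endOp M g x y D l +
      ∑ j, partOp M unitEnlargements j (annulusOp M G j g) x y D l +
      ∑ j, partOp M shortenings j g x y D l := by
  have h : ∀ F : Fin n → AddMonoid.End (TripleFun n M),
      (∑ j, F j) g x y D l = ∑ j, F j g x y D l := by
    intro F
    have : (∑ j, F j) g = ∑ j, F j g := AddMonoidHom.finsetSum_apply _ _ _
    rw [this]
    simp only [Finset.sum_apply]
  let P : Fin n → AddMonoid.End (TripleFun n M) := fun j => annulusOp M G j
  let I : Fin n → AddMonoid.End (TripleFun n M) := fun j => partOp M unitEnlargements j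
  have h1 := h fun j => I j * P j
  have h2 := h fun j => (partOp M shortenings j : AddMonoid.End (TripleFun n M))
  exact congrArg₂ (· + ·) (congrArg₂ (· + ·) rfl h1) h2

theorem map_listSum {N α : Type} [AddCommGroup N] (φ : M →+ N) (L : List α) (g : α → M) :
    φ (listSum L g) = listSum L fun a => φ (g a) := by
  induction L with
  | nil => simp
  | cons a L ih => simp [ih]

/-- Naturality in the values: with `φ` the differential on chains and `g = basisElt` it turns the
square of the differential into the square of `funD`. -/
theorem map_funD {N : Type} [AddCommGroup N] (φ : M →+ N) (G : GridDiagram n) (g : TripleFun n M)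
    (x y : Generator n) (D : TwoChain n) (l : Fin n → OrderedPartition) :
    φ (funD M G g x y D l) = funD N G (fun x y D l => φ (g x y D l)) x y D l := by
  rw [funD_apply, funD_apply]
  simp only [map_add, map_sum, startOp, endOp, partOp, annulusOp, AddMonoidHom.coe_mk,
    ZeroHom.coe_mk, map_listSum]

end

theorem basisElt_of_pos {x y : Generator n} {D : TwoChain n} (h : IsPosDomain x y D)
    (l : Fin n → OrderedPartition) : basisElt x y D l = Finsupp.single ⟨x, y, D, h, l⟩ 1 :=
  dif_pos h

theorem basisElt_of_not_pos {x y : Generator n} {D : TwoChain n} (h : ¬ IsPosDomain x y D)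
    (l : Fin n → OrderedPartition) : basisElt x y D l = 0 :=
  dif_neg h

theorem boundary_eq_funD (G : GridDiagram n) (T : Triple n) :
    boundary G T = funD _ G basisElt T.x T.y T.D T.part := by
  rw [funD_apply, boundary]
  have h1 : boundaryI T = startOp _ basisElt T.x T.y T.D T.part +
      endOp _ basisElt T.x T.y T.D T.part := by
    simp only [boundaryI, startOp, endOp, AddMonoidHom.coe_mk, ZeroHom.coe_mk, rectsFrom, rectsTo,
      Finset.sum_filter, Fintype.sum_prod_type]
  have h2 : boundaryII G T =
      ∑ j, partOp _ unitEnlargements j (annulusOp _ G j basisElt) T.x T.y T.D T.part := rfl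
  have h3 : boundaryIII T + boundaryIV T = ∑ j, partOp _ shortenings j basisElt T.x T.y T.D T.part := by
    rw [boundaryIII, boundaryIV, ← Finset.sum_add_distrib]
    exact Finset.sum_congr rfl fun j _ => (listSum_append _ _ _).symm
  rw [h1, h2, add_assoc, h3]

theorem IsPosDomain.of_sub_left {x x' y : Generator n} {D E : TwoChain n}
    (h : IsPosDomain x' y (D - E)) (hE : IsDomain x x' E) (hE0 : ∀ i j, 0 ≤ E i j) :
    IsPosDomain x y D := by
  refine ⟨?_, fun i j => ?_⟩
  · have := hE.add h.1
    rwa [add_sub_cancel] at this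
  · have h1 := h.2 i j
    have h2 := hE0 i j
    simp only [Pi.sub_apply] at h1
    linarith

theorem IsPosDomain.of_sub_right {x y y' : Generator n} {D E : TwoChain n}
    (h : IsPosDomain x y' (D - E)) (hE : IsDomain y' y E) (hE0 : ∀ i j, 0 ≤ E i j) :
    IsPosDomain x y D := by
  refine ⟨?_, fun i j => ?_⟩
  · have := h.1.add hE
    rwa [sub_add_cancel] at this
  · have h1 := h.2 i j
    have h2 := hE0 i j
    simp only [Pi.sub_apply] at h1
    linarith

theorem isDomain_rect_to (y : Generator n) {a b : Fin n} (h : a ≠ b) :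
    IsDomain (y * Equiv.swap a b) y (rectChain (y * Equiv.swap a b) a b) := by
  have := isDomain_rectChain (y * Equiv.swap a b) h
  rwa [Equiv.mul_swap_mul_self] at this

theorem rowChain_nonneg (r i j : Fin n) : 0 ≤ rowChain r i j := by
  rw [rowChain]; split_ifs <;> simp

theorem colChain_nonneg (r i j : Fin n) : 0 ≤ colChain r i j := by
  rw [colChain]; split_ifs <;> simp

/-- Subtracting a nonnegative domain cannot make a chain a positive domain, so extending `basisElt`
by zero to all chains is compatible with `funD`. -/
theorem funD_basisElt_of_not_pos (G : GridDiagram n) {x y : Generator n} {D : TwoChain n}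
    (h : ¬ IsPosDomain x y D) (l : Fin n → OrderedPartition) :
    funD _ G basisElt x y D l = 0 := by
  rw [funD_apply]
  have h1 : startOp _ basisElt x y D l = 0 :=
    Finset.sum_eq_zero fun p hp => basisElt_of_not_pos (fun h' => h (h'.of_sub_left
      (isDomain_rectChain x (mem_rectsFrom.1 hp).1) (rectChain_nonneg _ _ _))) _
  have h2 : endOp _ basisElt x y D l = 0 :=
    Finset.sum_eq_zero fun p hp => basisElt_of_not_pos (fun h' => h (h'.of_sub_right
      (isDomain_rect_to y (mem_rectsTo.1 hp).1) (rectChain_nonneg _ _ _))) _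
  have h3 : ∀ j, partOp _ unitEnlargements j (annulusOp _ G j basisElt) x y D l = 0 := by
    intro j
    refine Eq.trans (listSum_congr fun m _ => ?_) (listSum_zero _)
    change basisElt x y (D - hAnnulus G j) _ + basisElt x y (D - vAnnulus G j) _ = 0
    rw [basisElt_of_not_pos, basisElt_of_not_pos, add_zero]
    · exact fun h' => h (h'.of_sub_left (isDomain_colChain x _) (colChain_nonneg _))
    · exact fun h' => h (h'.of_sub_left (isDomain_rowChain x _) (rowChain_nonneg _))
  have h4 : ∀ j, partOp _ shortenings j basisElt x y D l = 0 := by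
    intro j
    exact Eq.trans (listSum_congr fun m _ => basisElt_of_not_pos h _) (listSum_zero _)
  rw [h1, h2]
  simp only [h3, h4, Finset.sum_const_zero, add_zero]

/-- The differential on the free module on all triples. -/
noncomputable def totalD (G : GridDiagram n) : (Triple n →₀ ZMod 2) →ₗ[ZMod 2] (Triple n →₀ ZMod 2) :=
  Finsupp.linearCombination (ZMod 2) (boundary G)

theorem totalD_basisElt (G : GridDiagram n) (x y : Generator n) (D : TwoChain n)
    (l : Fin n → OrderedPartition) :
    totalD G (basisElt x y D l) = funD _ G basisElt x y D l := by
  by_cases h : IsPosDomain x y D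
  · rw [basisElt_of_pos h, totalD, Finsupp.linearCombination_single, one_smul, boundary_eq_funD]
  · rw [basisElt_of_not_pos h, funD_basisElt_of_not_pos G h, map_zero]

theorem totalD_boundary (G : GridDiagram n) (T : Triple n) : totalD G (boundary G T) = 0 := by
  have h2 : ∀ m : Triple n →₀ ZMod 2, m + m = 0 := fun m => by
    ext t; exact CharTwo.add_self_eq_zero _
  rw [boundary_eq_funD]
  have h := map_funD (totalD G).toAddMonoidHom G basisElt T.x T.y T.D T.part
  refine h.trans ?_
  have h3 : (fun x y D l => (totalD G).toAddMonoidHom (basisElt x y D l)) =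
      funD (Triple n →₀ ZMod 2) G basisElt := by
    funext x y D l
    exact totalD_basisElt G x y D l
  rw [h3]
  have h4 := DFunLike.congr_fun (funD_mul_funD (Triple n →₀ ZMod 2) h2 G) basisElt
  exact congrFun (congrFun (congrFun (congrFun h4 T.x) T.y) T.D) T.part

/-! ### Degrees -/

theorem basisElt_mem_supported {x y : Generator n} {D : TwoChain n}
    {l : Fin n → OrderedPartition} {s : Set (Triple n)}
    (h : ∀ hD : IsPosDomain x y D, (⟨x, y, D, hD, l⟩ : Triple n) ∈ s) :
    basisElt x y D l ∈ Finsupp.supported (ZMod 2) (ZMod 2) s := by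
  by_cases hD : IsPosDomain x y D
  · rw [basisElt_of_pos hD]
    exact Finsupp.single_mem_supported _ _ (h hD)
  · rw [basisElt_of_not_pos hD]
    exact Submodule.zero_mem _

theorem listSum_mem {α M : Type} [AddCommGroup M] [Module (ZMod 2) M]
    (W : Submodule (ZMod 2) M) (L : List α) (g : α → M) (h : ∀ a ∈ L, g a ∈ W) :
    listSum L g ∈ W := by
  induction L with
  | nil => exact W.zero_mem
  | cons a L ih =>
    rw [listSum_cons]
    exact W.add_mem (h a (by simp)) (ih fun b hb => h b (by simp [hb]))

/-! ### The faces of a triple -/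

/-- `IsStartFace T T'`: the triple `T'` arises from `T` by removing the rectangle `(a, b)` at the
start. -/
def IsStartFace (T T' : Triple n) (a b : Fin n) : Prop :=
  IsRect T.x a b ∧ T'.x = T.x * Equiv.swap a b ∧ T'.y = T.y ∧ T'.D = T.D - rectChain T.x a b ∧
    T'.part = T.part

/-- The triple `T'` arises from `T` by removing the rectangle `(a, b)` at the end. -/
def IsEndFace (T T' : Triple n) (a b : Fin n) : Prop :=
  IsRect (T.y * Equiv.swap a b) a b ∧ T'.x = T.x ∧ T'.y = T.y * Equiv.swap a b ∧
    T'.D = T.D - rectChain (T.y * Equiv.swap a b) a b ∧ T'.part = T.part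

/-- The triple `T'` arises from `T` by removing a row or a column and a unit enlargement. -/
def IsAnnulusFace (T T' : Triple n) : Prop :=
  T'.x = T.x ∧ T'.y = T.y ∧ (∃ r, T'.D = T.D - rowChain r ∨ T'.D = T.D - colChain r) ∧
    ∃ j, ∃ m ∈ unitEnlargements (T.part j), T'.part = Function.update T.part j m

/-- The triple `T'` arises from `T` by a coarsening or a reduction of an ordered partition. -/
def IsPartFace (T T' : Triple n) (j : Fin n) (m : OrderedPartition) : Prop :=
  T'.x = T.x ∧ T'.y = T.y ∧ T'.D = T.D ∧ m ∈ shortenings (T.part j) ∧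
    T'.part = Function.update T.part j m

section

variable (G : GridDiagram n) (T : Triple n) (s : Set (Triple n))

/-- The part of the differential which changes neither end by a rectangle at the start nor the
ordered partitions by a shortening. -/
noncomputable def boundaryRest : Triple n →₀ ZMod 2 :=
  endOp _ basisElt T.x T.y T.D T.part +
    ∑ j, partOp _ unitEnlargements j (annulusOp _ G j basisElt) T.x T.y T.D T.part

theorem boundary_eq : boundary G T = startOp _ basisElt T.x T.y T.D T.part + boundaryRest G T +
    ∑ j, partOp _ shortenings j basisElt T.x T.y T.D T.part := by
  rw [boundary_eq_funD, funD_apply, boundaryRest, add_assoc (startOp _ _ _ _ _ _)]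

theorem boundaryRest_mem (hend : ∀ T' a b, IsEndFace T T' a b → T' ∈ s)
    (hann : ∀ T', IsAnnulusFace T T' → T' ∈ s) :
    boundaryRest G T ∈ Finsupp.supported (ZMod 2) (ZMod 2) s := by
  refine Submodule.add_mem _ (Submodule.sum_mem _ fun p hp => ?_)
    (Submodule.sum_mem _ fun j _ => listSum_mem _ _ _ fun m hm => Submodule.add_mem _ ?_ ?_)
  · exact basisElt_mem_supported fun hD =>
      hend _ p.1 p.2 ⟨mem_rectsTo.1 hp, rfl, rfl, rfl, rfl⟩
  · exact basisElt_mem_supported fun hD => hann _ ⟨rfl, rfl, ⟨_, Or.inl rfl⟩, j, m, hm, rfl⟩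
  · exact basisElt_mem_supported fun hD => hann _ ⟨rfl, rfl, ⟨_, Or.inr rfl⟩, j, m, hm, rfl⟩

theorem startOp_mem (hstart : ∀ T' a b, IsStartFace T T' a b → T' ∈ s) :
    startOp _ basisElt T.x T.y T.D T.part ∈ Finsupp.supported (ZMod 2) (ZMod 2) s :=
  Submodule.sum_mem _ fun p hp => basisElt_mem_supported fun _ =>
    hstart _ p.1 p.2 ⟨mem_rectsFrom.1 hp, rfl, rfl, rfl, rfl⟩

theorem shortenings_mem (hpart : ∀ T' j m, IsPartFace T T' j m → T' ∈ s) :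
    ∑ j, partOp _ shortenings j basisElt T.x T.y T.D T.part ∈
      Finsupp.supported (ZMod 2) (ZMod 2) s :=
  Submodule.sum_mem _ fun j _ => listSum_mem _ _ _ fun m hm => basisElt_mem_supported fun _ =>
    hpart _ j m ⟨rfl, rfl, rfl, hm, rfl⟩

theorem boundary_mem (hstart : ∀ T' a b, IsStartFace T T' a b → T' ∈ s)
    (hend : ∀ T' a b, IsEndFace T T' a b → T' ∈ s) (hann : ∀ T', IsAnnulusFace T T' → T' ∈ s)
    (hpart : ∀ T' j m, IsPartFace T T' j m → T' ∈ s) :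
    boundary G T ∈ Finsupp.supported (ZMod 2) (ZMod 2) s := by
  rw [boundary_eq]
  exact Submodule.add_mem _ (Submodule.add_mem _ (startOp_mem T s hstart)
    (boundaryRest_mem G T s hend hann)) (shortenings_mem T s hpart)

theorem boundary_sub_start_mem (T₀ : Triple n) (a b : Fin n) (h₀ : IsStartFace T T₀ a b)
    (hstart : ∀ T' a' b', IsStartFace T T' a' b' → (a', b') ≠ (a, b) → T' ∈ s)
    (hend : ∀ T' a b, IsEndFace T T' a b → T' ∈ s) (hann : ∀ T', IsAnnulusFace T T' → T' ∈ s)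
    (hpart : ∀ T' j m, IsPartFace T T' j m → T' ∈ s) :
    boundary G T - Finsupp.single T₀ 1 ∈ Finsupp.supported (ZMod 2) (ZMod 2) s := by
  have h1 : startOp _ basisElt T.x T.y T.D T.part - Finsupp.single T₀ 1 ∈
      Finsupp.supported (ZMod 2) (ZMod 2) s := by
    have h2 : (a, b) ∈ rectsFrom T.x := mem_rectsFrom.2 h₀.1
    have h3 : basisElt (T.x * Equiv.swap a b) T.y (T.D - rectChain T.x a b) T.part =
        Finsupp.single T₀ 1 := by
      obtain ⟨x, y, D, pos, l⟩ := T₀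
      obtain ⟨-, rfl, rfl, rfl, rfl⟩ := h₀
      exact basisElt_of_pos pos _
    change ∑ p ∈ rectsFrom T.x, basisElt (T.x * Equiv.swap p.1 p.2) T.y
      (T.D - rectChain T.x p.1 p.2) T.part - _ ∈ _
    rw [← Finset.add_sum_erase _ _ h2, h3, add_sub_cancel_left]
    exact Submodule.sum_mem _ fun p hp => basisElt_mem_supported fun _ =>
      hstart _ p.1 p.2 ⟨mem_rectsFrom.1 (Finset.mem_of_mem_erase hp), rfl, rfl, rfl, rfl⟩
        (Finset.ne_of_mem_erase hp)
  have h2 := Submodule.add_mem _ (Submodule.add_mem _ h1 (boundaryRest_mem G T s hend hann))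
    (shortenings_mem T s hpart)
  rw [boundary_eq]
  convert h2 using 1
  abel

theorem boundary_sub_part_mem (T₀ : Triple n) (j : Fin n) (a b : ℕ+) (t : OrderedPartition)
    (hj : T.part j = a :: b :: t) (hx : T₀.x = T.x) (hy : T₀.y = T.y) (hD : T₀.D = T.D)
    (hl : T₀.part = Function.update T.part j ((a + b) :: t))
    (hstart : ∀ T' a b, IsStartFace T T' a b → T' ∈ s)
    (hend : ∀ T' a b, IsEndFace T T' a b → T' ∈ s) (hann : ∀ T', IsAnnulusFace T T' → T' ∈ s)
    (hpart : ∀ T' i m, IsPartFace T T' i m → i ≠ j → T' ∈ s)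
    (hpart' : ∀ T' m, IsPartFace T T' j m →
      (m ∈ reductions (a :: b :: t) ∨ ∃ m' ∈ coarsenings (b :: t), m = a :: m') → T' ∈ s) :
    boundary G T - Finsupp.single T₀ 1 ∈ Finsupp.supported (ZMod 2) (ZMod 2) s := by
  have h1 : ∑ j, partOp _ shortenings j basisElt T.x T.y T.D T.part - Finsupp.single T₀ 1 ∈
      Finsupp.supported (ZMod 2) (ZMod 2) s := by
    have h3 : basisElt T.x T.y T.D (Function.update T.part j ((a + b) :: t)) =
        Finsupp.single T₀ 1 := by
      obtain ⟨x, y, D, pos, l⟩ := T₀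
      obtain rfl := hx
      obtain rfl := hy
      obtain rfl := hD
      obtain rfl := hl
      exact basisElt_of_pos pos _
    have h4 : partOp _ shortenings j basisElt T.x T.y T.D T.part - Finsupp.single T₀ 1 ∈
        Finsupp.supported (ZMod 2) (ZMod 2) s := by
      change listSum (shortenings (T.part j)) (fun m => basisElt T.x T.y T.D
        (Function.update T.part j m)) - _ ∈ _
      rw [hj, shortenings, coarsenings, List.cons_append, listSum_cons, h3, add_sub_cancel_left]
      refine listSum_mem _ _ _ fun m hm => basisElt_mem_supported fun _ =>
        hpart' _ m ⟨rfl, rfl, rfl, ?_, rfl⟩ ?_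
      · rw [hj, shortenings, coarsenings, List.cons_append]
        exact List.mem_cons_of_mem _ hm
      · rw [List.mem_append, List.mem_map] at hm
        rcases hm with ⟨m', hm', rfl⟩ | hm
        · exact Or.inr ⟨m', hm', rfl⟩
        · exact Or.inl hm
    rw [← Finset.add_sum_erase _ _ (Finset.mem_univ j)]
    have h5 : ∑ i ∈ Finset.univ.erase j, partOp _ shortenings i basisElt T.x T.y T.D T.part ∈
        Finsupp.supported (ZMod 2) (ZMod 2) s :=
      Submodule.sum_mem _ fun i hi => listSum_mem _ _ _ fun m hm => basisElt_mem_supported fun _ =>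
        hpart _ i m ⟨rfl, rfl, rfl, hm, rfl⟩ (Finset.ne_of_mem_erase hi)
    convert Submodule.add_mem _ h4 h5 using 1
    abel
  have h2 := Submodule.add_mem _ (Submodule.add_mem _ (startOp_mem T s hstart)
    (boundaryRest_mem G T s hend hann)) h1
  rw [boundary_eq]
  convert h2 using 1
  abel

end

theorem length_of_mem_coarsenings {l m : OrderedPartition} (h : m ∈ coarsenings l) :
    m.length + 1 = l.length := by
  induction l generalizing m with
  | nil => simp [coarsenings] at h
  | cons a l ih =>
    match l with
    | [] => simp [coarsenings] at h
    | b :: t =>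
      rw [coarsenings, List.mem_cons, List.mem_map] at h
      rcases h with rfl | ⟨m', hm', rfl⟩
      · simp
      · simp [ih hm']

theorem length_of_mem_shortenings {l m : OrderedPartition} (h : m ∈ shortenings l) :
    m.length + 1 = l.length := by
  rw [shortenings, List.mem_append] at h
  rcases h with h | h
  · exact length_of_mem_coarsenings h
  · cases l with
    | nil => simp [reductions] at h
    | cons a t =>
      simp only [reductions, List.mem_cons, List.not_mem_nil, or_false] at h
      rcases h with rfl | rfl <;> simp

theorem length_of_mem_unitEnlargements {l m : OrderedPartition} (h : m ∈ unitEnlargements l) :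
    m.length = l.length + 1 := by
  induction l generalizing m with
  | nil => rw [unitEnlargements_nil, List.mem_singleton] at h; simp [h]
  | cons a t ih =>
    rw [unitEnlargements_cons, List.mem_cons, List.mem_map] at h
    rcases h with rfl | ⟨m', hm', rfl⟩
    · simp
    · simp [ih hm']

theorem sum_update {α : Type} (f : α → ℚ) (l : Fin n → α) (j : Fin n) (m : α) :
    ∑ i, f (Function.update l j m i) = ∑ i, f (l i) - f (l j) + f m := by
  rw [← Finset.add_sum_erase _ _ (Finset.mem_univ j),
    ← Finset.add_sum_erase _ (fun i => f (l i)) (Finset.mem_univ j), Function.update_self]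
  rw [Finset.sum_congr rfl fun i hi => by rw [Function.update_of_ne (Finset.ne_of_mem_erase hi)]]
  ring

theorem IsStartFace.degree {T T' : Triple n} {a b : Fin n} (h : IsStartFace T T' a b) :
    T'.degree = T.degree - 1 := by
  obtain ⟨h1, h2, h3, h4, h5⟩ := h
  rw [Triple.degree, Triple.degree, h2, h3, h4, h5,
    maslov_sub_left T.pos.1 (isDomain_rectChain T.x h1.1), maslov_rectChain h1]
  ring

theorem IsEndFace.degree {T T' : Triple n} {a b : Fin n} (h : IsEndFace T T' a b) :
    T'.degree = T.degree - 1 := by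
  obtain ⟨h1, h2, h3, h4, h5⟩ := h
  have h6 := maslov_rectChain h1
  rw [Equiv.mul_swap_mul_self] at h6
  rw [Triple.degree, Triple.degree, h2, h3, h4, h5,
    maslov_sub_right T.pos.1 (isDomain_rect_to T.y h1.1), h6]
  ring

theorem IsAnnulusFace.degree {T T' : Triple n} (h : IsAnnulusFace T T') :
    T'.degree = T.degree - 1 := by
  obtain ⟨h1, h2, ⟨r, h3⟩, j, m, hm, h4⟩ := h
  have h5 : maslov T'.x T'.y T'.D = maslov T.x T.y T.D - 2 := by
    rw [h1, h2]
    rcases h3 with h3 | h3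
    · rw [h3, maslov_sub_left T.pos.1 (isDomain_rowChain T.x r), maslov_rowChain]
    · rw [h3, maslov_sub_left T.pos.1 (isDomain_colChain T.x r), maslov_colChain]
  rw [Triple.degree, Triple.degree, h5, h4,
    sum_update (fun l : OrderedPartition => (l.length : ℚ)), length_of_mem_unitEnlargements hm]
  push_cast
  ring

theorem IsPartFace.degree {T T' : Triple n} {j : Fin n} {m : OrderedPartition}
    (h : IsPartFace T T' j m) : T'.degree = T.degree - 1 := by
  obtain ⟨h1, h2, h3, hm, h4⟩ := h
  rw [Triple.degree, Triple.degree, h1, h2, h3, h4,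
    sum_update (fun l : OrderedPartition => (l.length : ℚ)), ← length_of_mem_shortenings hm]
  push_cast
  ring

theorem boundary_mem_degree (G : GridDiagram n) (T : Triple n) :
    boundary G T ∈ Finsupp.supported (ZMod 2) (ZMod 2) {T' | T'.degree = T.degree - 1} :=
  boundary_mem G T _ (fun _ _ _ h => h.degree) (fun _ _ _ h => h.degree) (fun _ h => h.degree)
    fun _ _ _ h => h.degree

/-- The inclusion of the triples of degree `k` into all triples. -/
noncomputable def degreeIncl (n : ℕ) [NeZero n] (k : ℕ) :
    CDPModule n k →ₗ[ZMod 2] (Triple n →₀ ZMod 2) :=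
  Finsupp.lmapDomain (ZMod 2) (ZMod 2) Subtype.val

theorem degreeIncl_injective (k : ℕ) : Function.Injective (degreeIncl n k) :=
  Finsupp.mapDomain_injective Subtype.val_injective

theorem degreeIncl_restrict {k : ℕ} {v : Triple n →₀ ZMod 2}
    (hv : v ∈ Finsupp.supported (ZMod 2) (ZMod 2) (triplesOfDegree n k)) :
    degreeIncl n k (Finsupp.lsubtypeDomain (R := ZMod 2) (triplesOfDegree n k) v) = v := by
  ext T
  by_cases hT : T ∈ triplesOfDegree n k
  · exact Finsupp.mapDomain_apply Subtype.val_injective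
      (Finsupp.subtypeDomain (· ∈ triplesOfDegree n k) v) (⟨T, hT⟩ : triplesOfDegree n k)
  · rw [(Finsupp.mem_supported' _ _).1 hv T hT]
    refine Finsupp.mapDomain_of_notMem_range _ _ ?_
    rintro ⟨⟨T', hT'⟩, rfl⟩
    exact hT hT'

/-- Every face has degree one less, so the restriction to degree `k` in `cdpD` discards nothing. -/
theorem degreeIncl_cdpD (G : GridDiagram n) (k : ℕ) (v : CDPModule n (k + 1)) :
    degreeIncl n k (cdpD G k v) = totalD G (degreeIncl n (k + 1) v) := by
  induction v using Finsupp.induction_linear with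
  | zero => simp
  | add f g hf hg => rw [map_add, map_add, hf, hg, map_add, map_add]
  | single T c =>
    rw [cdpD, LinearMap.comp_apply, Finsupp.linearCombination_single, map_smul, map_smul,
      degreeIncl_restrict, degreeIncl, Finsupp.lmapDomain_apply, Finsupp.mapDomain_single, totalD,
      Finsupp.linearCombination_single]
    have h := boundary_mem_degree G T.1
    have hT : T.1.degree = ((k + 1 : ℕ) : ℚ) := T.2
    rw [hT] at h
    refine Finsupp.supported_mono (fun T' hT' => ?_) h
    change T'.degree = (k : ℚ)
    rw [show T'.degree = ((k + 1 : ℕ) : ℚ) - 1 from hT']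
    push_cast
    ring

theorem cdpD_comp (G : GridDiagram n) (k : ℕ) : cdpD G k ∘ₗ cdpD G (k + 1) = 0 := by
  refine LinearMap.ext fun v => degreeIncl_injective k ?_
  rw [LinearMap.comp_apply, degreeIncl_cdpD, degreeIncl_cdpD, LinearMap.zero_apply, map_zero]
  generalize degreeIncl n (k + 1 + 1) v = w
  induction w using Finsupp.induction_linear with
  | zero => simp
  | add f g hf hg => rw [map_add, map_add, hf, hg, add_zero]
  | single T c =>
    conv_lhs => rw [totalD, Finsupp.linearCombination_single, ← totalD]
    rw [map_smul, totalD_boundary, smul_zero]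

/-- The differential of a triple of degree `k + 1`, restricted to the triples of degree `k`. -/
theorem cdpD_sub_mem {G : GridDiagram n} {k : ℕ} {s : Set (Triple n)}
    (T : triplesOfDegree n (k + 1)) (w : CDPModule n k)
    (h : boundary G T.1 - degreeIncl n k w ∈ Finsupp.supported (ZMod 2) (ZMod 2) s) :
    cdpD G k (Finsupp.single T 1) - w ∈
      Finsupp.supported (ZMod 2) (ZMod 2) {T' : triplesOfDegree n k | T'.1 ∈ s} := by
  rw [Finsupp.mem_supported']
  intro T' hT'
  have h1 := (Finsupp.mem_supported' _ _).1 h T'.1 hT'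
  have h2 : (degreeIncl n k w) T'.1 = w T' := Finsupp.mapDomain_apply Subtype.val_injective w T'
  rw [Finsupp.sub_apply, h2] at h1
  rw [Finsupp.sub_apply, ← h1]
  congr 1
  rw [cdpD, LinearMap.comp_apply, Finsupp.linearCombination_single, one_smul]
  rfl

end Grid

namespace Grid

variable {n : ℕ} [NeZero n]

/-! ### Cutting the torus along the last row and the last column -/

/-- The index of the last row or column. -/
def lastIdx (n : ℕ) [NeZero n] : Fin n := 0 - 1

theorem val_lastIdx : ((lastIdx n : Fin n) : ℕ) = n - 1 := by
  rw [lastIdx, val_sub_one]; simp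

theorem ne_lastIdx_iff {i : Fin n} : i ≠ lastIdx n ↔ (i : ℕ) + 1 < n := by
  have h := i.2
  rw [ne_eq, Fin.ext_iff, val_lastIdx]; omega

theorem val_succ_of_ne {i : Fin n} (h : i ≠ lastIdx n) : ((i + 1 : Fin n) : ℕ) = (i : ℕ) + 1 := by
  rw [ne_lastIdx_iff] at h
  rw [val_add_one, if_neg (by omega)]

theorem val_pred_of_ne {i : Fin n} (h : i ≠ 0) : ((i - 1 : Fin n) : ℕ) + 1 = (i : ℕ) := by
  have h' : (i : ℕ) ≠ 0 := fun e => h (Fin.ext (by simpa using e))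
  rw [val_sub_one, if_neg h']; omega

theorem pred_ne_lastIdx {i : Fin n} (h : i ≠ 0) : i - 1 ≠ lastIdx n := by
  rw [ne_lastIdx_iff, val_pred_of_ne h]; exact i.2

/-- Crossing the cut becomes an inequality in the linear order of `Fin n`. -/
theorem inArc_lastIdx {a b : Fin n} (_h : a ≠ b) : InArc a b (lastIdx n) ↔ b < a := by
  have ha := a.2
  have hb := b.2
  rw [inArc_iff]
  simp only [Fin.lt_def, Fin.le_def, val_lastIdx, ne_eq, Fin.ext_iff] at *
  omega

/-- A function on the circle with at most two jumps. -/
theorem eq_of_jumps {f : Fin n → ℤ} {p q : Fin n}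
    (h : ∀ j, f j = f (j - 1) + (if p = j then 1 else 0) - (if q = j then 1 else 0)) (j : Fin n) :
    f j = f (lastIdx n) + (if p ≤ j then 1 else 0) - (if q ≤ j then 1 else 0) := by
  obtain ⟨v, hv⟩ : ∃ v, v = (j : ℕ) := ⟨_, rfl⟩
  induction v generalizing j with
  | zero =>
    have hj : j = 0 := Fin.ext (by simpa using hv.symm)
    subst hj
    rw [h 0]
    simp only [nonpos_iff_eq_zero, lastIdx]
  | succ v ih =>
    have hj : j ≠ 0 := fun e => by rw [e] at hv; simp at hv
    have hv' := val_pred_of_ne hj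
    have e1 : ∀ r : Fin n, (if r ≤ j then (1 : ℤ) else 0) =
        (if r ≤ j - 1 then 1 else 0) + (if r = j then 1 else 0) := by
      intro r
      simp only [Fin.le_def, Fin.ext_iff]
      split_ifs <;> first | rfl | (exfalso; omega)
    rw [h j, ih (j - 1) (by omega), e1 p, e1 q]
    ring

/-- The difference of two adjacent columns jumps only at the points of `x` and `y` between them, so
its value in the last row determines it. -/
theorem IsDomain.col_eq {x y : Generator n} {D : TwoChain n} (hD : IsDomain x y D) (i j : Fin n) :
    D i j - D (i - 1) j = D i (lastIdx n) - D (i - 1) (lastIdx n) +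
      (if x i ≤ j then 1 else 0) - (if y i ≤ j then 1 else 0) := by
  refine eq_of_jumps (f := fun j => D i j - D (i - 1) j) (p := x i) (q := y i) (fun j => ?_) j
  have := hD i j
  linarith

theorem IsDomain.row_eq {x y : Generator n} {D : TwoChain n} (hD : IsDomain x y D) (i j : Fin n) :
    D i j - D i (j - 1) = D (lastIdx n) j - D (lastIdx n) (j - 1) +
      (if x.symm j ≤ i then 1 else 0) - (if y.symm j ≤ i then 1 else 0) := by
  refine eq_of_jumps (f := fun i => D i j - D i (j - 1)) (p := x.symm j) (q := y.symm j)
    (fun i => ?_) i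
  have := hD i j
  simp only [Equiv.symm_apply_eq, eq_comm (a := j)]
  linarith

/-! ### Selectors: thin rectangles -/

/-- A row or a column, or nothing. -/
inductive Selector (n : ℕ) : Type
  | row (j : Fin n)
  | col (i : Fin n)
  | none

namespace Selector

/-- The selected row or column is not alone. -/
def Proper : Selector n → Prop
  | row j => j ≠ j + 1
  | col i => i ≠ lastIdx n
  | none => False

/-- The left column of the thin rectangle. -/
def left : Selector n → Generator n → Fin n
  | row j, x => x.symm j
  | col i, _ => i
  | none, _ => 0

/-- The right column of the thin rectangle. -/
def right : Selector n → Generator n → Fin n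
  | row j, x => x.symm (j + 1)
  | col i, _ => i + 1
  | none, _ => 0

/-- The thin rectangle starting at `x` avoids the cuts. -/
def IsUp : Selector n → Generator n → Prop
  | row j, x => x.symm j < x.symm (j + 1)
  | col i, x => x i < x (i + 1)
  | none, _ => False

/-- The rectangle `(a, b)` starting at `x` avoids the cuts. -/
def Avoids : Selector n → Generator n → Fin n → Fin n → Prop
  | row _, _, a, b => a < b
  | col _, x, a, b => x a < x b
  | none, _, _, _ => True

theorem ne_succ {i : Fin n} (h : i ≠ lastIdx n) : i ≠ i + 1 := by
  rw [ne_eq, Fin.ext_iff, val_succ_of_ne h]; omega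

theorem left_ne_right {s : Selector n} (hs : s.Proper) (x : Generator n) :
    s.left x ≠ s.right x := by
  cases s with
  | row j => exact fun e => hs (x.symm.injective e)
  | col i => exact ne_succ hs
  | none => exact hs.elim

theorem isRect {s : Selector n} (hs : s.Proper) (x : Generator n) :
    IsRect x (s.left x) (s.right x) := by
  refine ⟨left_ne_right hs x, ?_⟩
  cases s with
  | row j =>
    intro i hi hi' h
    have h2 := h.2
    simp only [left, right, Equiv.apply_symm_apply] at h2
    refine (forall_not_inArc_iff hs).2 rfl (x i) ?_ ?_ h2
    · exact fun e => hi (by rw [left, ← e, Equiv.symm_apply_apply])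
    · exact fun e => hi' (by rw [right, ← e, Equiv.symm_apply_apply])
  | col i => exact fun i hi hi' h => (forall_not_inArc_iff (ne_succ hs)).2 rfl i hi hi' h.1
  | none => exact hs.elim

theorem symm_mul_swap (x : Generator n) (a b j : Fin n) :
    (x * Equiv.swap a b).symm j = (x.symm * Equiv.swap (x a) (x b)) j := by
  rw [Equiv.symm_apply_eq, Equiv.Perm.mul_apply, Equiv.Perm.mul_apply]
  by_cases h1 : j = x a
  · subst h1; simp
  · by_cases h2 : j = x b
    · subst h2; simp
    · rw [Equiv.swap_apply_of_ne_of_ne h1 h2, Equiv.swap_apply_of_ne_of_ne]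
      · simp
      · rintro rfl; simp at h1
      · rintro rfl; simp at h2

theorem isUp_flip {s : Selector n} (hs : s.Proper) (x : Generator n) :
    s.IsUp (x * Equiv.swap (s.left x) (s.right x)) ↔ ¬ s.IsUp x := by
  have h := left_ne_right hs x
  cases s with
  | row j =>
    simp only [IsUp, symm_mul_swap, Equiv.Perm.mul_apply, left, right, Equiv.apply_symm_apply,
      Equiv.swap_apply_left, Equiv.swap_apply_right]
    exact ⟨fun h => h.not_gt, fun h' => lt_of_le_of_ne (not_lt.1 h') h.symm⟩
  | col i =>
    simp only [IsUp, Equiv.Perm.mul_apply, left, right, Equiv.swap_apply_left,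
      Equiv.swap_apply_right]
    exact ⟨fun h => h.not_gt, fun h' => lt_of_le_of_ne (not_lt.1 h')
      fun e => h (x.injective e).symm⟩
  | none => exact hs.elim

/-- The thin rectangle after exchanging the two points. -/
theorem flip_flip (s : Selector n) (x : Generator n) :
    let x' := x * Equiv.swap (s.left x) (s.right x)
    x' * Equiv.swap (s.left x') (s.right x') = x := by
  intro x'
  cases s with
  | row j =>
    have h1 : (row j).left x' = x.symm (j + 1) := by
      simp [x', left, right, symm_mul_swap]
    have h2 : (row j).right x' = x.symm j := by
      simp [x', left, right, symm_mul_swap]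
    rw [h1, h2, Equiv.swap_comm]
    exact Equiv.mul_swap_mul_self _ _ _
  | col i => exact Equiv.mul_swap_mul_self _ _ _
  | none => exact Equiv.mul_swap_mul_self _ _ _

/-- Analogue of the lifting property for covers in the Bruhat order: the exchange could reverse the
order at `i`, `i + 1` only if one of these two points were inside the rectangle. -/
theorem lt_of_isRect {x : Generator n} {a b i : Fin n} (hi : i ≠ i + 1) (hx : x i < x (i + 1))
    (h : IsRect x a b) (hab : x a < x b) (hne : ¬ (a = i ∧ b = i + 1)) :
    (x * Equiv.swap a b) i < (x * Equiv.swap a b) (i + 1) := by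
  rw [Equiv.Perm.mul_apply, Equiv.Perm.mul_apply]
  have hv := val_add_one i
  have hne' : ∀ {u v}, u ≠ v → x u ≠ x v := fun h e => h (x.injective e)
  by_cases hia : i = a
  · subst hia
    have hb : b ≠ i + 1 := fun e => hne ⟨rfl, e⟩
    rw [Equiv.swap_apply_left, Equiv.swap_apply_of_ne_of_ne hi.symm hb.symm]
    have h1 := h.2 (i + 1) hi.symm hb.symm
    have h2 : InArc i b (i + 1) := by
      have h3 := h.1
      have := b.2
      have := i.2
      rw [inArc_iff]
      simp only [Fin.lt_def, Fin.le_def, ne_eq, Fin.ext_iff] at *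
      split_ifs at hv <;> omega
    have h4 : ¬ InArc (x i) (x b) (x (i + 1)) := fun r => h1 ⟨h2, r⟩
    have h5 := hne' hb
    rw [inArc_iff] at h4
    simp only [Fin.lt_def, Fin.le_def, ne_eq, Fin.ext_iff] at *
    omega
  · by_cases hib : i = b
    · subst hib
      by_cases hsa : i + 1 = a
      · subst hsa; exact absurd (hx.trans hab) (lt_irrefl _)
      · rw [Equiv.swap_apply_right, Equiv.swap_apply_of_ne_of_ne hsa hi.symm]
        exact hab.trans hx
    · rw [Equiv.swap_apply_of_ne_of_ne hia hib]
      by_cases hsa : i + 1 = a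
      · subst hsa
        rw [Equiv.swap_apply_left]
        exact hx.trans hab
      · by_cases hsb : i + 1 = b
        · subst hsb
          rw [Equiv.swap_apply_right]
          have h1 := h.2 i hia hi
          have h2 : InArc a (i + 1) i := by
            have h3 := h.1
            have := a.2
            have := i.2
            rw [inArc_iff]
            simp only [Fin.lt_def, Fin.le_def, ne_eq, Fin.ext_iff] at *
            split_ifs at hv <;> omega
          have h4 : ¬ InArc (x a) (x (i + 1)) (x i) := fun r => h1 ⟨h2, r⟩
          have h5 := hne' hia
          rw [inArc_iff] at h4
          simp only [Fin.lt_def, Fin.le_def, ne_eq, Fin.ext_iff] at *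
          omega
        · rw [Equiv.swap_apply_of_ne_of_ne hsa hsb]
          exact hx

/-- Removing another rectangle which avoids the cuts does not change the type of a generator. -/
theorem isUp_of_isRect {s : Selector n} (hs : s.Proper) {x : Generator n} {a b : Fin n}
    (hx : s.IsUp x) (h : IsRect x a b) (hab : s.Avoids x a b)
    (hne : (a, b) ≠ (s.left x, s.right x)) : s.IsUp (x * Equiv.swap a b) := by
  cases s with
  | row j =>
    simp only [IsUp, symm_mul_swap]
    refine lt_of_isRect hs hx ⟨fun e => h.1 (x.injective e), fun i hia hib r => ?_⟩ ?_ ?_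
    · simp only [Equiv.symm_apply_apply] at r
      refine h.2 (x.symm i) (fun e => hia (by rw [← e]; simp)) (fun e => hib (by rw [← e]; simp))
        ⟨r.2, by simpa using r.1⟩
    · simpa [Avoids] using hab
    · rintro ⟨e1, e2⟩
      refine hne (Prod.ext ?_ ?_)
      · simp [left, ← e1]
      · simp [right, ← e2]
  | col i => exact lt_of_isRect (ne_succ hs) hx h hab fun r => hne (by simp [left, right, r])
  | none => exact hs.elim

/-- The thin rectangle of an `up` generator does not meet the last column. -/
theorem rectChain_lastIdx {s : Selector n} (hs : s.Proper) {x : Generator n} (hx : s.IsUp x)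
    (j : Fin n) : rectChain x (s.left x) (s.right x) (lastIdx n) j = 0 := by
  rw [rectChain_apply, arcInd, if_neg, zero_mul]
  rw [inArc_lastIdx (left_ne_right hs x), not_lt]
  cases s with
  | row j => exact le_of_lt hx
  | col i => rw [left, right, Fin.le_def, val_succ_of_ne hs]; omega
  | none => exact hs.elim

/-- The thin rectangle of an `up` generator in a column does not meet the last row. -/
theorem rectChain_col_lastIdx {i : Fin n} {x : Generator n} (hx : x i < x (i + 1)) (k : Fin n) :
    rectChain x i (i + 1) k (lastIdx n) = 0 := by
  rw [rectChain_apply, arcInd, arcInd, if_neg (c := InArc (x i) (x (i + 1)) (lastIdx n)), mul_zero]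
  rw [inArc_lastIdx hx.ne]
  exact hx.not_gt

end Selector

/-! ### The selector of a domain -/

/-- The last column of a domain is not constant at the row `j`. -/
def RowCond (c : Fin n → ℤ) (j : Fin n) : Prop := c (j - 1) < c j

/-- The first nonzero coefficient of the last row is in column `i`. -/
def ColCond (d : Fin n → ℤ) (i : Fin n) : Prop := i ≠ lastIdx n ∧ 1 ≤ d i ∧ (i = 0 ∨ d (i - 1) = 0)

/-- A descent of a permutation. -/
def Descent (y : Generator n) (i : Fin n) : Prop := i ≠ lastIdx n ∧ y (i + 1) < y i

open Classical in
/-- The row or column in which a domain is matched, in terms of its last column, its last row, and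
its final generator. -/
noncomputable def selector (c d : Fin n → ℤ) (y : Generator n) : Selector n :=
  if h : ∃ j, RowCond c j then Selector.row h.choose
  else if h : ∃ i, ColCond d i then Selector.col h.choose
  else if h : ∃ i, Descent y i then Selector.col h.choose
  else Selector.none

theorem selector_cases (c d : Fin n → ℤ) (y : Generator n) :
    ((∃ j, RowCond c j) ∧ ∃ j, selector c d y = Selector.row j ∧ RowCond c j) ∨
    ((¬ ∃ j, RowCond c j) ∧ (∃ i, ColCond d i) ∧ ∃ i, selector c d y = Selector.col i ∧
      ColCond d i) ∨
    ((¬ ∃ j, RowCond c j) ∧ (¬ ∃ i, ColCond d i) ∧ (∃ i, Descent y i) ∧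
      ∃ i, selector c d y = Selector.col i ∧ Descent y i) ∨
    ((¬ ∃ j, RowCond c j) ∧ (¬ ∃ i, ColCond d i) ∧ (¬ ∃ i, Descent y i) ∧
      selector c d y = Selector.none) := by
  rw [selector]
  split_ifs with h1 h2 h3
  · exact Or.inl ⟨h1, _, rfl, h1.choose_spec⟩
  · exact Or.inr (Or.inl ⟨h1, h2, _, rfl, h2.choose_spec⟩)
  · exact Or.inr (Or.inr (Or.inl ⟨h1, h2, h3, _, rfl, h3.choose_spec⟩))
  · exact Or.inr (Or.inr (Or.inr ⟨h1, h2, h3, rfl⟩))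

theorem selector_proper {c d : Fin n → ℤ} {y : Generator n}
    (h : selector c d y ≠ Selector.none) : (selector c d y).Proper := by
  rcases selector_cases c d y with ⟨-, j, hj, hc⟩ | ⟨-, -, i, hi, hc⟩ | ⟨-, -, -, i, hi, hc⟩ | h'
  · rw [hj]
    intro e
    have e' : j - 1 = j := by rw [sub_eq_iff_eq_add]; exact e
    rw [RowCond, e'] at hc
    exact lt_irrefl _ hc
  · rw [hi]; exact hc.1
  · rw [hi]; exact hc.1
  · exact absurd h'.2.2.2 h

/-- A function that never increases around a circle is constant. -/
theorem eq_lastIdx_of_not_rowCond {c : Fin n → ℤ} (h : ¬ ∃ j, RowCond c j) (j : Fin n) :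
    c j = c (lastIdx n) := by
  have hle : ∀ j, c j ≤ c (j - 1) := fun j => not_lt.1 fun r => h ⟨j, r⟩
  have h1 : ∀ v, ∀ j : Fin n, (j : ℕ) = v → c j ≤ c (lastIdx n) := by
    intro v
    induction v with
    | zero =>
      intro j hj
      have hj : j = 0 := Fin.ext (by simpa using hj)
      subst hj
      exact hle 0
    | succ v ih =>
      intro j hj
      have hj0 : j ≠ 0 := fun e => by rw [e] at hj; simp at hj
      have := val_pred_of_ne hj0
      exact (hle j).trans (ih (j - 1) (by omega))
  have h2 : ∀ v, ∀ j : Fin n, (j : ℕ) + v = n - 1 → c (lastIdx n) ≤ c j := by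
    intro v
    induction v with
    | zero =>
      intro j hj
      have hj : j = lastIdx n := Fin.ext (by rw [val_lastIdx]; omega)
      rw [hj]
    | succ v ih =>
      intro j hj
      have hj0 : j ≠ lastIdx n := by rw [ne_lastIdx_iff]; omega
      have h3 := val_succ_of_ne hj0
      have h4 := hle (j + 1)
      rw [add_sub_cancel_right] at h4
      exact (ih (j + 1) (by omega)).trans h4
  exact le_antisymm (h1 _ j rfl) (h2 (n - 1 - j) j (by have := j.2; omega))

theorem eq_zero_of_not_colCond {d : Fin n → ℤ} (h0 : ∀ i, 0 ≤ d i) (h : ¬ ∃ i, ColCond d i)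
    {i : Fin n} (hi : i ≠ lastIdx n) : d i = 0 := by
  obtain ⟨v, hv⟩ : ∃ v, v = (i : ℕ) := ⟨_, rfl⟩
  induction v generalizing i with
  | zero =>
    by_contra hne
    exact h ⟨i, hi, by have := h0 i; omega, Or.inl (Fin.ext (by simpa using hv.symm))⟩
  | succ v ih =>
    have hj0 : i ≠ 0 := fun e => by rw [e] at hv; simp at hv
    have := val_pred_of_ne hj0
    by_contra hne
    exact h ⟨i, hi, by have := h0 i; omega, Or.inr (ih (pred_ne_lastIdx hj0) (by omega))⟩

/-- The selector of a domain ending at `y`. -/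
noncomputable def domSelector (y : Generator n) (D : TwoChain n) : Selector n :=
  selector (D (lastIdx n)) (fun i => D i (lastIdx n)) y

/-- If `x` is `up` for the selector of the domain, then the thin rectangle can be removed. -/
theorem rectChain_le {x y : Generator n} {D : TwoChain n} (hD : IsPosDomain x y D)
    (hx : (domSelector y D).IsUp x) (i j : Fin n) :
    rectChain x ((domSelector y D).left x) ((domSelector y D).right x) i j ≤ D i j := by
  rw [rectChain]
  split_ifs with h
  swap
  · exact hD.2 i j
  rcases selector_cases (D (lastIdx n)) (fun i => D i (lastIdx n)) y with
    ⟨-, k, hk, hc⟩ | ⟨hA, -, k, hk, hc⟩ | ⟨hA, hB, -, k, hk, hc⟩ | h'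
  · rw [domSelector, hk] at h hx
    simp only [Selector.left, Selector.right, Equiv.apply_symm_apply, Selector.IsUp] at h hx
    have hne : k ≠ k + 1 := fun e => by rw [← e] at hx; exact lt_irrefl _ hx
    have hj : j = k := by
      by_contra hjk
      by_cases hjk' : j = k + 1
      · rw [hjk'] at h; exact not_inArc_right _ _ h.2
      · exact (forall_not_inArc_iff hne).2 rfl j hjk hjk' h.2
    subst hj
    -- Compared with row `j - 1`, row `j` gains at least 1 from the increase in the last column and
    -- 1 from `x`, and loses at most 1 to `y`; hence the coefficient is at least 1.
    have h1 := hD.1.row_eq i j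
    have h2 := hD.2 i (j - 1)
    rw [RowCond] at hc
    have h3 : x.symm j ≤ i := by
      have h4 := h.1
      rw [inArc_iff] at h4
      simp only [Fin.lt_def, Fin.le_def] at *
      omega
    rw [if_pos h3] at h1
    split_ifs at h1 <;> linarith
  · rw [domSelector, hk] at h hx
    simp only [Selector.left, Selector.right, Selector.IsUp] at h hx
    have hne : k ≠ k + 1 := fun e => by rw [← e] at hx; exact lt_irrefl _ hx
    have hj : i = k := by
      by_contra hjk
      by_cases hjk' : i = k + 1
      · rw [hjk'] at h; exact not_inArc_right _ _ h.1
      · exact (forall_not_inArc_iff hne).2 rfl i hjk hjk' h.1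
    subst hj
    -- The same comparison with column `i - 1`. For `i = 0` that is the last column, constant
    -- because no row qualifies, so its contribution cancels.
    have h1 := hD.1.col_eq i j
    have h3 : x i ≤ j := by
      have h4 := h.2
      rw [inArc_iff] at h4
      simp only [Fin.lt_def, Fin.le_def] at *
      omega
    rw [if_pos h3] at h1
    obtain ⟨-, hc1, hc2⟩ := hc
    rcases hc2 with rfl | hc2
    · have h5 := eq_lastIdx_of_not_rowCond hA j
      rw [lastIdx] at h5
      rw [show (0 : Fin n) - 1 = lastIdx n from rfl] at *
      split_ifs at h1 <;> linarith
    · have h2 := hD.2 (i - 1) j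
      split_ifs at h1 <;> linarith
  · rw [domSelector, hk] at h hx
    simp only [Selector.left, Selector.right, Selector.IsUp] at h hx
    have hne : k ≠ k + 1 := fun e => by rw [← e] at hx; exact lt_irrefl _ hx
    have hj : i = k := by
      by_contra hjk
      by_cases hjk' : i = k + 1
      · rw [hjk'] at h; exact not_inArc_right _ _ h.1
      · exact (forall_not_inArc_iff hne).2 rfl i hjk hjk' h.1
    subst hj
    have hj := h.2
    rw [inArc_iff] at hj
    have h3 : x i ≤ j := by
      simp only [Fin.lt_def, Fin.le_def] at *; omega
    have h4 : ¬ x (i + 1) ≤ j := by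
      simp only [Fin.lt_def, Fin.le_def] at *; omega
    obtain ⟨hi, hy⟩ := hc
    have hcon := eq_lastIdx_of_not_rowCond hA j
    have hd : ∀ {i}, i ≠ lastIdx n → D i (lastIdx n) = 0 := fun hi =>
      eq_zero_of_not_colCond (d := fun i => D i (lastIdx n)) (fun i => hD.2 i _) hB hi
    -- If row `j` is at or above `y i`, then by the descent it is also above `y (i + 1)`, and column
    -- `i + 1` gives the lower bound 1. Otherwise `y` costs nothing in the comparison with column `i
    -- - 1`.
    by_cases hyj : y i ≤ j
    · have h1 := hD.1.col_eq (i + 1) j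
      have hyj' : y (i + 1) ≤ j := hy.le.trans hyj
      rw [if_neg h4, if_pos hyj', add_sub_cancel_right] at h1
      have h5 := hd hi
      by_cases hl : i + 1 = lastIdx n
      · rw [hl] at h1; linarith
      · have h6 := hd hl
        have h7 := hD.2 (i + 1) j
        linarith
    · have h1 := hD.1.col_eq i j
      rw [if_pos h3, if_neg hyj] at h1
      have h5 := hd hi
      by_cases hl : i = 0
      · subst hl
        rw [show (0 : Fin n) - 1 = lastIdx n from rfl] at h1
        linarith
      · have h6 := hd (pred_ne_lastIdx hl)
        have h7 := hD.2 (i - 1) j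
        linarith
  · rw [domSelector, h'.2.2.2] at hx; exact hx.elim

/-- A permutation without descents is the identity. -/
theorem eq_one_of_not_descent {y : Generator n} (h : ¬ ∃ i, Descent y i) : y = 1 := by
  have hle : ∀ i, i ≠ lastIdx n → y i < y (i + 1) := by
    intro i hi
    refine lt_of_le_of_ne (not_lt.1 fun r => h ⟨i, hi, r⟩) fun e => ?_
    exact Selector.ne_succ hi (y.injective e)
  have hmono : ∀ v, ∀ i j : Fin n, (j : ℕ) = i + 1 + v → y i < y j := by
    intro v
    induction v with
    | zero =>
      intro i j hj
      have hi : i ≠ lastIdx n := by rw [ne_lastIdx_iff]; have := j.2; omega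
      have : j = i + 1 := Fin.ext (by rw [val_succ_of_ne hi]; omega)
      rw [this]; exact hle i hi
    | succ v ih =>
      intro i j hj
      have hj0 : j ≠ 0 := fun e => by rw [e] at hj; simp at hj
      have h1 := val_pred_of_ne hj0
      have h2 := hle _ (pred_ne_lastIdx hj0)
      rw [sub_add_cancel] at h2
      exact (ih i (j - 1) (by omega)).trans h2
  have hm : StrictMono y := fun i j hij => hmono ((j : ℕ) - i - 1) i j (by
    rw [Fin.lt_def] at hij; omega)
  let e : Fin n ≃o Fin n := hm.orderIsoOfSurjective y y.surjective
  have he : e = OrderIso.refl _ := Subsingleton.elim _ _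
  ext i
  exact congrArg Fin.val (DFunLike.congr_fun he i)

/-- The domains without selector are the multiples of the last column. -/
theorem eq_of_selector_none {x y : Generator n} {D : TwoChain n} (hD : IsPosDomain x y D)
    (h : domSelector y D = Selector.none) :
    x = 1 ∧ y = 1 ∧ ∀ i j, D i j = if i = lastIdx n then D (lastIdx n) (lastIdx n) else 0 := by
  rcases selector_cases (D (lastIdx n)) (fun i => D i (lastIdx n)) y with
    ⟨-, k, hk, hc⟩ | ⟨hA, -, k, hk, hc⟩ | ⟨hA, hB, -, k, hk, hc⟩ | ⟨hA, hB, hC, -⟩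
  · rw [domSelector, hk] at h; cases h
  · rw [domSelector, hk] at h; cases h
  · rw [domSelector, hk] at h; cases h
  obtain rfl := eq_one_of_not_descent hC
  have hcon := eq_lastIdx_of_not_rowCond hA
  have hd : ∀ {i}, i ≠ lastIdx n → D i (lastIdx n) = 0 := fun hi =>
    eq_zero_of_not_colCond (d := fun i => D i (lastIdx n)) (fun i => hD.2 i _) hB hi
  -- Column by column: `x` fixes all smaller indices, so `i ≤ x i`; before the last column, a larger
  -- `x i` would make the coefficient of the square `(i, i)` equal to -1.
  have key : ∀ v, ∀ i : Fin n, (i : ℕ) = v → x i = i ∧ (i ≠ lastIdx n → ∀ j, D i j = 0) := by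
    intro v
    induction v using Nat.strong_induction_on with
    | _ v ih =>
      intro i hi
      have hge : i ≤ x i := by
        by_contra hlt
        rw [not_le] at hlt
        have h1 := (ih (x i) (by rw [Fin.lt_def] at hlt; omega) (x i) rfl).1
        exact hlt.ne (x.injective h1)
      by_cases hl : i = lastIdx n
      · refine ⟨le_antisymm ?_ hge, fun h => absurd hl h⟩
        rw [Fin.le_def, hl, val_lastIdx]
        have := (x (lastIdx n)).2
        omega
      · have h2 : ∀ j, D i j = (if x i ≤ j then 1 else 0) - (if i ≤ j then 1 else 0) := by
          intro j
          have h3 : D i j - D (i - 1) j = D i (lastIdx n) - D (i - 1) (lastIdx n) +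
              (if x i ≤ j then 1 else 0) - (if i ≤ j then 1 else 0) := by
            convert hD.1.col_eq i j
            rfl
          have h4 := hd hl
          by_cases hi0 : i = 0
          · subst hi0
            rw [show (0 : Fin n) - 1 = lastIdx n from rfl] at h3
            have h5 := hcon j
            linarith
          · have h6 := hd (pred_ne_lastIdx hi0)
            have h7 := val_pred_of_ne hi0
            have h8 := (ih ((i - 1 : Fin n) : ℕ) (by omega) (i - 1) rfl).2 (pred_ne_lastIdx hi0) j
            linarith
        have h3 : x i ≤ i := by
          by_contra hlt
          have h4 := h2 i
          have h5 := hD.2 i i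
          rw [if_neg hlt, if_pos le_rfl] at h4
          linarith
        have h4 := le_antisymm h3 hge
        refine ⟨h4, fun _ j => ?_⟩
        rw [h2 j, h4, sub_self]
  refine ⟨Equiv.ext fun i => (key i i rfl).1, rfl, fun i j => ?_⟩
  split_ifs with hi
  · rw [hi]; exact hcon j
  · exact (key i i rfl).2 hi j

end Grid

namespace Grid

variable {n : ℕ} [NeZero n]

/-! ### The level of a domain -/

/-- A weight which decreases when an inversion is removed. -/
def permWeight (y : Generator n) : ℕ := ∑ i : Fin n, (n - (i : ℕ)) * (y i : ℕ)

/-- Rearrangement inequality for the decreasing weights `n - i`. -/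
theorem permWeight_mul_swap_lt {y : Generator n} {a b : Fin n} (hab : a < b) (hy : y b < y a) :
    permWeight (y * Equiv.swap a b) < permWeight y := by
  have hb : b ∈ Finset.univ.erase a := Finset.mem_erase.2 ⟨hab.ne', Finset.mem_univ _⟩
  rw [permWeight, permWeight, ← Finset.add_sum_erase _ _ (Finset.mem_univ a),
    ← Finset.add_sum_erase _ _ hb, ← Finset.add_sum_erase _ _ (Finset.mem_univ a),
    ← Finset.add_sum_erase _ _ hb, Equiv.Perm.mul_apply, Equiv.Perm.mul_apply,
    Equiv.swap_apply_left, Equiv.swap_apply_right, ← add_assoc, ← add_assoc]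
  have h1 : ∀ i ∈ (Finset.univ.erase a).erase b,
      (n - (i : ℕ)) * ((y * Equiv.swap a b) i : ℕ) = (n - (i : ℕ)) * (y i : ℕ) := by
    intro i hi
    rw [Finset.mem_erase, Finset.mem_erase] at hi
    rw [Equiv.Perm.mul_apply, Equiv.swap_apply_of_ne_of_ne hi.2.1 hi.1]
  rw [Finset.sum_congr rfl h1]
  refine Nat.add_lt_add_right ?_ _
  rw [Fin.lt_def] at hab hy
  have h2 := b.2
  obtain ⟨u, hu⟩ : ∃ u, n - (a : ℕ) = (n - b) + (u + 1) := ⟨b - a - 1, by omega⟩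
  obtain ⟨v, hv⟩ : ∃ v, (y a : ℕ) = y b + (v + 1) := ⟨y a - y b - 1, by omega⟩
  rw [hu, hv]
  nlinarith [Nat.zero_le (u * v)]

open Classical in
/-- The level of a domain, in terms of its last column, its last row, and its final generator. -/
noncomputable def domLevel (c d : Fin n → ℤ) (y : Generator n) : ℕ ×ₗ ℕ ×ₗ ℕ :=
  toLex ((∑ j, c j).toNat, toLex
    -- Entries beyond the one that decides the selector are set to 0. For a row selector this is
    -- essential: a thin rectangle in the last row changes the last row of `D` but must not change
    -- the level.
    (if ∃ j, RowCond c j then 0 else (∑ i, d i).toNat,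
      if (∃ j, RowCond c j) ∨ ∃ i, ColCond d i then 0 else permWeight y))

theorem eq_or_sum_toNat_lt {f g : Fin n → ℤ} (hf : ∀ i, 0 ≤ f i) (h : ∀ i, f i ≤ g i) :
    f = g ∨ (∑ i, f i).toNat < (∑ i, g i).toNat := by
  by_cases e : f = g
  · exact Or.inl e
  · right
    have h1 : ∑ i, f i < ∑ i, g i := by
      obtain ⟨i, hi⟩ := Function.ne_iff.1 e
      exact Finset.sum_lt_sum (fun i _ => h i) ⟨i, Finset.mem_univ _, lt_of_le_of_ne (h i) hi⟩
    have h2 : 0 ≤ ∑ i, f i := Finset.sum_nonneg fun i _ => hf i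
    omega

theorem domLevel_congr {c d d' : Fin n → ℤ} (h : (∃ j, RowCond c j) ∨ d' = d)
    (y : Generator n) :
    domLevel c d' y = domLevel c d y ∧ selector c d' y = selector c d y := by
  rcases h with h | rfl
  · constructor
    · simp only [domLevel, h, if_true, true_or]
    · simp only [selector, h, dif_pos]
  · exact ⟨rfl, rfl⟩

/-- The entries are compared lexicographically. A change in the entry under comparison lowers the
level; if nothing has changed up to the entry that decides the selector, level and selector both
persist. -/
theorem domLevel_lt_or {c c' d d' : Fin n → ℤ} {y y' : Generator n} (hc' : ∀ j, 0 ≤ c' j)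
    (hc : ∀ j, c' j ≤ c j) (hd' : ∀ i, 0 ≤ d' i) (hd : ∀ i, d' i ≤ d i)
    (hy : c' = c → d' = d → y' = y ∨ permWeight y' < permWeight y) :
    domLevel c' d' y' < domLevel c d y ∨
      (domLevel c' d' y' = domLevel c d y ∧ selector c' d' y' = selector c d y ∧ c' = c ∧
        ((∃ j, RowCond c j) ∨ d' = d)) := by
  rcases eq_or_sum_toNat_lt hc' hc with rfl | h
  swap
  · exact Or.inl (Prod.Lex.toLex_lt_toLex.2 (Or.inl h))
  by_cases hA : ∃ j, RowCond c' j
  · right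
    refine ⟨?_, ?_, rfl, Or.inl hA⟩
    · simp only [domLevel, hA, if_true, true_or]
    · simp only [selector, hA, dif_pos]
  rcases eq_or_sum_toNat_lt hd' hd with rfl | h
  swap
  · left
    simp only [domLevel, hA, if_false]
    exact Prod.Lex.toLex_lt_toLex.2 (Or.inr ⟨rfl, Prod.Lex.toLex_lt_toLex.2 (Or.inl h)⟩)
  by_cases hB : ∃ i, ColCond d' i
  · right
    refine ⟨?_, ?_, rfl, Or.inr rfl⟩
    · simp only [domLevel, hA, hB, if_true, or_true]
    · simp only [selector, hA, hB, dif_pos, dif_neg, not_false_eq_true]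
  rcases hy rfl rfl with rfl | h
  · exact Or.inr ⟨rfl, rfl, rfl, Or.inr rfl⟩
  · left
    simp only [domLevel, hA, hB, if_false, or_self]
    exact Prod.Lex.toLex_lt_toLex.2 (Or.inr ⟨rfl, Prod.Lex.toLex_lt_toLex.2 (Or.inr ⟨rfl, h⟩)⟩)

theorem lt_of_rectChain_col {x : Generator n} {a b : Fin n} (h : a ≠ b)
    (h0 : ∀ j, rectChain x a b (lastIdx n) j = 0) : a < b := by
  have h1 := h0 (x a)
  rw [rectChain_apply, arcInd_left fun e => h (x.injective e), mul_one, arcInd] at h1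
  by_contra hlt
  rw [if_pos ((inArc_lastIdx h).2 (lt_of_le_of_ne (not_lt.1 hlt) h.symm))] at h1
  exact one_ne_zero h1

theorem lt_of_rectChain_row {x : Generator n} {a b : Fin n} (h : a ≠ b)
    (h0 : ∀ i, rectChain x a b i (lastIdx n) = 0) : x a < x b := by
  have h1 := h0 a
  have hx : x a ≠ x b := fun e => h (x.injective e)
  rw [rectChain_apply, arcInd_left h, one_mul, arcInd] at h1
  by_contra hlt
  rw [if_pos ((inArc_lastIdx hx).2 (lt_of_le_of_ne (not_lt.1 hlt) hx.symm))] at h1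
  exact one_ne_zero h1

theorem rectChain_ne_zero (x : Generator n) {a b : Fin n} (h : a ≠ b) : rectChain x a b ≠ 0 := by
  intro e
  have h1 := congrFun (congrFun e a) (x a)
  rw [rectChain_apply, arcInd_left h, arcInd_left fun e => h (x.injective e)] at h1
  exact one_ne_zero h1

theorem rowChain_ne_zero (r : Fin n) : rowChain r ≠ 0 := by
  intro e
  have h1 := congrFun (congrFun e r) r
  rw [rowChain, if_pos rfl] at h1
  exact one_ne_zero h1

theorem colChain_ne_zero (r : Fin n) : colChain r ≠ 0 := by
  intro e
  have h1 := congrFun (congrFun e r) r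
  rw [colChain, if_pos rfl] at h1
  exact one_ne_zero h1

/-- The selector of the domain of a triple. -/
noncomputable def Triple.sel (T : Triple n) : Selector n := domSelector T.y T.D

/-- The level of the domain of a triple. -/
noncomputable def Triple.domLevel (T : Triple n) : ℕ ×ₗ ℕ ×ₗ ℕ :=
  Grid.domLevel (T.D (lastIdx n)) (fun i => T.D i (lastIdx n)) T.y

/-- Equal level excludes the selector `none`: both domains would be multiples of the last column
with the same last column, forcing `E = 0`. -/
theorem Triple.domLevel_lt_or {T T' : Triple n} {E : TwoChain n} (hE : ∀ i j, 0 ≤ E i j)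
    (hE0 : E ≠ 0) (hD : T'.D = T.D - E)
    (hy : (∀ j, E (lastIdx n) j = 0) → (∀ i, E i (lastIdx n) = 0) →
      T'.y = T.y ∨ permWeight T'.y < permWeight T.y) :
    T'.domLevel < T.domLevel ∨
      (T'.domLevel = T.domLevel ∧ T'.sel = T.sel ∧ T.sel ≠ Selector.none ∧
        (∀ j, E (lastIdx n) j = 0) ∧
        ((∃ j, T.sel = Selector.row j) ∨ ∀ i, E i (lastIdx n) = 0)) := by
  have h1 : ∀ i j, T'.D i j = T.D i j - E i j := fun i j => by rw [hD]; rfl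
  have hc : T'.D (lastIdx n) = T.D (lastIdx n) → ∀ j, E (lastIdx n) j = 0 := fun e j => by
    have := h1 (lastIdx n) j
    rw [e] at this
    linarith
  have hd : (fun i => T'.D i (lastIdx n)) = (fun i => T.D i (lastIdx n)) →
      ∀ i, E i (lastIdx n) = 0 := fun e i => by
    have h2 := h1 i (lastIdx n)
    rw [show T'.D i (lastIdx n) = _ from congrFun e i] at h2
    linarith
  rcases Grid.domLevel_lt_or (y := T.y) (y' := T'.y) (fun j => T'.pos.2 (lastIdx n) j)
    (fun j => by rw [h1]; linarith [hE (lastIdx n) j]) (fun i => T'.pos.2 i (lastIdx n))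
    (fun i => by rw [h1]; linarith [hE i (lastIdx n)])
    (fun h2 h3 => hy (hc h2) (hd h3)) with h | ⟨h2, h3, h4, h5⟩
  · exact Or.inl h
  · right
    have h3' : T'.sel = T.sel := h3
    refine ⟨h2, h3', fun h0 => hE0 ?_, hc h4, ?_⟩
    · have e1 := (eq_of_selector_none T.pos h0).2.2
      have e2 := (eq_of_selector_none T'.pos (h3'.trans h0)).2.2
      funext i j
      have e3 := h1 i j
      rw [e1, e2, h4] at e3
      rw [Pi.zero_apply, Pi.zero_apply]
      linarith
    · rcases h5 with h5 | h5
      · left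
        rcases selector_cases (T.D (lastIdx n)) (fun i => T.D i (lastIdx n)) T.y with
          ⟨-, k, hk, -⟩ | h' | h' | h'
        · exact ⟨k, hk⟩
        · exact absurd h5 h'.1
        · exact absurd h5 h'.1
        · exact absurd h5 h'.1
      · exact Or.inr (hd h5)

theorem IsStartFace.domLevel {T T' : Triple n} {a b : Fin n} (h : IsStartFace T T' a b) :
    T'.domLevel < T.domLevel ∨ (T'.domLevel = T.domLevel ∧ T'.sel = T.sel ∧
      T.sel ≠ Selector.none ∧ T.sel.Avoids T.x a b) := by
  obtain ⟨h1, h2, h3, h4, h5⟩ := h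
  rcases Triple.domLevel_lt_or (rectChain_nonneg T.x a b) (rectChain_ne_zero T.x h1.1) h4
    (fun _ _ => Or.inl h3) with h | ⟨e1, e2, e3, e4, e5⟩
  · exact Or.inl h
  · refine Or.inr ⟨e1, e2, e3, ?_⟩
    have h6 := lt_of_rectChain_col h1.1 e4
    rcases e5 with ⟨j, hj⟩ | e5
    · rw [hj]; exact h6
    · have h7 := lt_of_rectChain_row h1.1 e5
      generalize T.sel = s
      cases s with
      | row j => exact h6
      | col i => exact h7
      | none => trivial

/-- A rectangle at the end which avoids both cuts removes an inversion of `y` and so lowers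
`permWeight`. -/
theorem IsEndFace.domLevel {T T' : Triple n} {a b : Fin n} (h : IsEndFace T T' a b) :
    T'.domLevel < T.domLevel ∨ (T'.domLevel = T.domLevel ∧ T'.sel = T.sel ∧
      T.sel ≠ Selector.none) := by
  obtain ⟨h1, h2, h3, h4, h5⟩ := h
  rcases Triple.domLevel_lt_or (rectChain_nonneg _ a b) (rectChain_ne_zero _ h1.1) h4
    (fun hc hd => Or.inr (by
      have h6 := lt_of_rectChain_row h1.1 hd
      rw [Equiv.Perm.mul_apply, Equiv.Perm.mul_apply, Equiv.swap_apply_left,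
        Equiv.swap_apply_right] at h6
      rw [h3]
      exact permWeight_mul_swap_lt (lt_of_rectChain_col h1.1 hc) h6)) with h | ⟨e1, e2, e3, -⟩
  · exact Or.inl h
  · exact Or.inr ⟨e1, e2, e3⟩

theorem IsAnnulusFace.domLevel {T T' : Triple n} (h : IsAnnulusFace T T') :
    T'.domLevel < T.domLevel ∨ (T'.domLevel = T.domLevel ∧ T'.sel = T.sel ∧
      T.sel ≠ Selector.none) := by
  obtain ⟨h1, h2, ⟨r, h3⟩, -⟩ := h
  have : ∃ E : TwoChain n, (∀ i j, 0 ≤ E i j) ∧ E ≠ 0 ∧ T'.D = T.D - E := by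
    rcases h3 with h3 | h3
    · exact ⟨_, rowChain_nonneg r, rowChain_ne_zero r, h3⟩
    · exact ⟨_, colChain_nonneg r, colChain_ne_zero r, h3⟩
  obtain ⟨E, hE, hE0, hD⟩ := this
  rcases Triple.domLevel_lt_or hE hE0 hD (fun _ _ => Or.inl h2) with h | ⟨e1, e2, e3, -⟩
  · exact Or.inl h
  · exact Or.inr ⟨e1, e2, e3⟩

/-- Removing or adding the thin rectangle of an `up` generator preserves the level and the
selector. -/
theorem domLevel_rectChain {s : Selector n} (hs : s.Proper) {x y : Generator n} (hx : s.IsUp x)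
    {D D' : TwoChain n} (hD : D' = D - rectChain x (s.left x) (s.right x))
    (h : domSelector y D = s ∨ domSelector y D' = s) :
    domLevel (D' (lastIdx n)) (fun i => D' i (lastIdx n)) y =
      domLevel (D (lastIdx n)) (fun i => D i (lastIdx n)) y ∧
    domSelector y D' = domSelector y D := by
  have h1 : D' (lastIdx n) = D (lastIdx n) := by
    funext j
    rw [hD, Pi.sub_apply, Pi.sub_apply, Selector.rectChain_lastIdx hs hx, sub_zero]
  rw [domSelector, domSelector, h1] at h
  rw [domSelector, domSelector, h1]
  refine domLevel_congr ?_ y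
  cases s with
  | row j =>
    left
    rcases h with h | h
    all_goals
      rcases selector_cases (D (lastIdx n)) _ y with h' | h' | h' | h'
      · exact h'.1
      · obtain ⟨i, hi, -⟩ := h'.2.2
        rw [h] at hi; cases hi
      · obtain ⟨i, hi, -⟩ := h'.2.2.2
        rw [h] at hi; cases hi
      · have hi := h'.2.2.2
        rw [h] at hi; cases hi
  | col i =>
    right
    funext k
    rw [hD, Pi.sub_apply, Pi.sub_apply, Selector.left, Selector.right,
      Selector.rectChain_col_lastIdx hx, sub_zero]
  | none => exact hs.elim

end Grid

namespace Grid

variable {n : ℕ} [NeZero n]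

/-! ### Matching tuples of ordered partitions -/

/-- The sum of all parts. -/
def partWeight (l : Fin n → OrderedPartition) : ℕ := ∑ j, ((l j).map PNat.val).sum

/-- The `j`-th ordered partition is the first one which is neither empty nor a single part `1`. -/
def IsFirst (l : Fin n → OrderedPartition) (j : Fin n) : Prop :=
  ¬ (l j = [] ∨ l j = [1]) ∧ ∀ i < j, l i = [] ∨ l i = [1]

/-- The first nontrivial ordered partition starts with a part `1`. -/
def PartUp (l : Fin n → OrderedPartition) : Prop :=
  ∃ j, IsFirst l j ∧ ∃ b t, l j = 1 :: b :: t

/-- The first nontrivial ordered partition does not start with a part `1`. -/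
def PartDown (l : Fin n → OrderedPartition) : Prop :=
  ∃ j, IsFirst l j ∧ ∃ a t, a ≠ 1 ∧ l j = a :: t

theorem IsFirst.unique {l : Fin n → OrderedPartition} {i j : Fin n} (hi : IsFirst l i)
    (hj : IsFirst l j) : i = j := by
  rcases lt_trichotomy i j with h | h | h
  · exact absurd (hj.2 i h) hi.1
  · exact h
  · exact absurd (hi.2 j h) hj.1

theorem exists_isFirst {l : Fin n → OrderedPartition} {j : Fin n} (h : ¬ (l j = [] ∨ l j = [1])) :
    ∃ i ≤ j, IsFirst l i := by
  obtain ⟨v, hv⟩ : ∃ v, v = (j : ℕ) := ⟨_, rfl⟩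
  induction v using Nat.strong_induction_on generalizing j with
  | _ v ih =>
    by_cases hj : IsFirst l j
    · exact ⟨j, le_rfl, hj⟩
    · have : ∃ i < j, ¬ (l i = [] ∨ l i = [1]) := by
        by_contra hne
        exact hj ⟨h, fun i hi => by_contra fun r => hne ⟨i, hi, r⟩⟩
      obtain ⟨i, hi, hi'⟩ := this
      obtain ⟨k, hk, hk'⟩ := ih i (by rw [hv]; exact hi) hi' rfl
      exact ⟨k, hk.trans hi.le, hk'⟩

theorem partUp_or_partDown {l : Fin n → OrderedPartition} {j : Fin n} (h : IsFirst l j) :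
    PartUp l ∨ PartDown l := by
  have h1 := h.1
  rcases e : l j with _ | ⟨a, t⟩
  · exact absurd (Or.inl e) h1
  · by_cases ha : a = 1
    · subst ha
      rcases t with _ | ⟨b, t⟩
      · exact absurd (Or.inr e) h1
      · exact Or.inl ⟨j, h, b, t, e⟩
    · exact Or.inr ⟨j, h, a, t, ha, e⟩

theorem PartUp.not_partDown {l : Fin n → OrderedPartition} (h : PartUp l) : ¬ PartDown l := by
  rintro ⟨j, hj, a, t, ha, e⟩
  obtain ⟨i, hi, b, t', e'⟩ := h
  obtain rfl := hi.unique hj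
  rw [e'] at e
  exact ha (List.cons.inj e).1.symm

theorem trivial_of_not_partUp_partDown {l : Fin n → OrderedPartition} (h : ¬ PartUp l)
    (h' : ¬ PartDown l) (j : Fin n) : l j = [] ∨ l j = [1] := by
  by_contra hj
  obtain ⟨i, -, hi⟩ := exists_isFirst hj
  exact (partUp_or_partDown hi).elim h h'

theorem IsFirst.update {l : Fin n → OrderedPartition} {j : Fin n} (h : IsFirst l j)
    {m : OrderedPartition} (hm : ¬ (m = [] ∨ m = [1])) : IsFirst (Function.update l j m) j := by
  refine ⟨by rwa [Function.update_self], fun i hi => ?_⟩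
  rw [Function.update_of_ne hi.ne]
  exact h.2 i hi

theorem partWeight_update (l : Fin n → OrderedPartition) (j : Fin n) (m : OrderedPartition) :
    partWeight (Function.update l j m) + ((l j).map PNat.val).sum =
      partWeight l + (m.map PNat.val).sum := by
  have h1 := Finset.add_sum_erase Finset.univ
    (fun i => ((Function.update l j m i).map PNat.val).sum) (Finset.mem_univ j)
  have h2 := Finset.add_sum_erase Finset.univ
    (fun i => ((l i).map PNat.val).sum) (Finset.mem_univ j)
  have h3 : ∑ i ∈ Finset.univ.erase j, ((Function.update l j m i).map PNat.val).sum =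
      ∑ i ∈ Finset.univ.erase j, ((l i).map PNat.val).sum :=
    Finset.sum_congr rfl fun i hi => by rw [Function.update_of_ne (Finset.ne_of_mem_erase hi)]
  simp only [Function.update_self] at h1
  rw [partWeight, partWeight]
  omega

theorem sum_of_mem_coarsenings {l m : OrderedPartition} (h : m ∈ coarsenings l) :
    (m.map PNat.val).sum = (l.map PNat.val).sum := by
  induction l generalizing m with
  | nil => simp [coarsenings] at h
  | cons a l ih =>
    match l with
    | [] => simp [coarsenings] at h
    | b :: t =>
      rw [coarsenings, List.mem_cons, List.mem_map] at h
      rcases h with rfl | ⟨m', hm', rfl⟩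
      · simp [PNat.add_coe, add_assoc]
      · rw [List.map_cons, List.sum_cons, ih hm', List.map_cons (l := b :: t), List.sum_cons]

theorem sum_of_mem_reductions {l m : OrderedPartition} (h : m ∈ reductions l) :
    (m.map PNat.val).sum < (l.map PNat.val).sum := by
  cases l with
  | nil => simp [reductions] at h
  | cons a t =>
    simp only [reductions, List.mem_cons, List.not_mem_nil, or_false] at h
    rcases h with rfl | rfl
    · simp
    · have h1 := List.dropLast_append_getLast (List.cons_ne_nil a t)
      conv_rhs => rw [← h1]
      simp only [List.map_append, List.sum_append, List.map_cons, List.map_nil, List.sum_cons,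
        List.sum_nil]
      have := ((a :: t).getLast (List.cons_ne_nil a t)).pos
      change _ < _ + (((a :: t).getLast (List.cons_ne_nil a t) : ℕ) + 0)
      omega

/-- A coarsening other than the one which defines the matching does not change the type. -/
theorem PartUp.coarsening {l : Fin n → OrderedPartition} (h : PartUp l) {i : Fin n}
    {m : OrderedPartition} (hm : m ∈ coarsenings (l i))
    (hs : ∀ b t, IsFirst l i → l i = 1 :: b :: t → ∃ m' ∈ coarsenings (b :: t), m = 1 :: m') :
    PartUp (Function.update l i m) := by
  obtain ⟨j, hj, b, t, e⟩ := h
  have hlen := length_of_mem_coarsenings hm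
  rcases lt_trichotomy i j with hij | rfl | hij
  · rcases hj.2 i hij with h' | h' <;> rw [h'] at hm <;> simp [coarsenings] at hm
  · obtain ⟨m', hm', rfl⟩ := hs b t hj e
    have h1 := length_of_mem_coarsenings hm'
    rcases m' with _ | ⟨b', t'⟩
    · exact absurd hm' (by
        rw [e] at hlen
        simp at hlen h1
        subst h1
        simp [coarsenings])
    · exact ⟨i, hj.update (by simp), b', t', by rw [Function.update_self]⟩
  · refine ⟨j, ⟨by rw [Function.update_of_ne hij.ne]; exact hj.1, fun k hk => ?_⟩, b, t, by
      rw [Function.update_of_ne hij.ne]; exact e⟩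
    rw [Function.update_of_ne (hk.trans hij).ne]
    exact hj.2 k hk

theorem exists_isFirst_of_coarsening {l : Fin n → OrderedPartition} {i : Fin n}
    {m : OrderedPartition} (hm : m ∈ coarsenings (l i)) : ∃ j, IsFirst l j := by
  have : ¬ (l i = [] ∨ l i = [1]) := by
    rintro (h | h) <;> rw [h] at hm <;> simp [coarsenings] at hm
  obtain ⟨j, -, hj⟩ := exists_isFirst this
  exact ⟨j, hj⟩

/-! ### Matching triples -/

/-- A triple which is matched with a triple in the next smaller degree. -/
def Triple.IsUp (T : Triple n) : Prop :=
  T.sel.IsUp T.x ∨ (T.sel = Selector.none ∧ PartUp T.part)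

/-- A triple which is matched with a triple in the next larger degree. -/
def Triple.IsDown (T : Triple n) : Prop :=
  (T.sel ≠ Selector.none ∧ ¬ T.sel.IsUp T.x) ∨ (T.sel = Selector.none ∧ PartDown T.part)

theorem Selector.ne_none_of_isUp {s : Selector n} {x : Generator n} (h : s.IsUp x) :
    s ≠ Selector.none := by
  rintro rfl; exact h

theorem Triple.IsUp.not_isDown {T : Triple n} (h : T.IsUp) : ¬ T.IsDown := by
  rcases h with h | ⟨h, h'⟩
  · rintro (h1 | h1)
    · exact h1.2 h
    · exact Selector.ne_none_of_isUp h h1.1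
  · rintro (h1 | h1)
    · exact h1.1 h
    · exact h'.not_partDown h1.2

open Classical in
/-- The level of a triple, without its degree. -/
noncomputable def Triple.level (T : Triple n) : (ℕ ×ₗ ℕ ×ₗ ℕ) ×ₗ ℕ :=
  toLex (T.domLevel, if T.sel = Selector.none then partWeight T.part else 0)

/-- The condition on a face of a triple under which it has smaller level. -/
def IsLower (T T' : Triple n) : Prop :=
  T'.level < T.level ∨ (T'.level = T.level ∧ (T'.IsDown → T.IsDown))

theorem isLower_of_domLevel_lt {T T' : Triple n} (h : T'.domLevel < T.domLevel) : IsLower T T' :=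
  Or.inl (Prod.Lex.toLex_lt_toLex.2 (Or.inl h))

theorem level_eq_of_sel_ne_none {T T' : Triple n} (h : T'.domLevel = T.domLevel)
    (h1 : T'.sel = T.sel) (h2 : T.sel ≠ Selector.none) : T'.level = T.level := by
  rw [Triple.level, Triple.level, h, h1, if_neg h2, if_neg h2]

theorem isLower_of_isUp {T T' : Triple n} (h : T'.domLevel = T.domLevel)
    (h1 : T'.sel = T.sel) (h2 : T.sel ≠ Selector.none) (h3 : T.sel.IsUp T.x → T.sel.IsUp T'.x) :
    IsLower T T' := by
  refine Or.inr ⟨level_eq_of_sel_ne_none h h1 h2, ?_⟩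
  rintro (h4 | h4)
  · refine Or.inl ⟨h2, fun h5 => h4.2 ?_⟩
    rw [h1]; exact h3 h5
  · exact absurd (h1.symm.trans h4.1) h2

/-- At equal level the rectangle avoids the relevant cuts, and being different from the thin one it
leaves an `up` generator `up`. -/
theorem IsStartFace.isLower {T T' : Triple n} {a b : Fin n} (h : IsStartFace T T' a b)
    (hne : T.sel.IsUp T.x → (a, b) ≠ (T.sel.left T.x, T.sel.right T.x)) : IsLower T T' := by
  rcases h.domLevel with h1 | ⟨h1, h2, h3, h4⟩
  · exact isLower_of_domLevel_lt h1
  · refine isLower_of_isUp h1 h2 h3 fun hu => ?_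
    rw [h.2.1]
    exact Selector.isUp_of_isRect (selector_proper h3) hu h.1 h4 (hne hu)

theorem IsEndFace.isLower {T T' : Triple n} {a b : Fin n} (h : IsEndFace T T' a b) :
    IsLower T T' := by
  rcases h.domLevel with h1 | ⟨h1, h2, h3⟩
  · exact isLower_of_domLevel_lt h1
  · exact isLower_of_isUp h1 h2 h3 fun hu => by rwa [h.2.1]

theorem IsAnnulusFace.isLower {T T' : Triple n} (h : IsAnnulusFace T T') : IsLower T T' := by
  rcases h.domLevel with h1 | ⟨h1, h2, h3⟩
  · exact isLower_of_domLevel_lt h1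
  · exact isLower_of_isUp h1 h2 h3 fun hu => by rwa [h.1]

theorem domLevel_sel_eq {T T' : Triple n} (hy : T'.y = T.y) (hD : T'.D = T.D) :
    T'.domLevel = T.domLevel ∧ T'.sel = T.sel := by
  rw [Triple.domLevel, Triple.domLevel, Triple.sel, Triple.sel, hy, hD]
  exact ⟨rfl, rfl⟩

/-- With a selector the partitions play no role. Without one, a reduction lowers the total weight,
while a coarsening preserves it and, except for the matched one, preserves `PartUp`. -/
theorem IsPartFace.isLower {T T' : Triple n} {j : Fin n} {m : OrderedPartition}
    (h : IsPartFace T T' j m)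
    (hs : ∀ b t, T.sel = Selector.none → IsFirst T.part j → T.part j = 1 :: b :: t →
      m ∈ reductions (1 :: b :: t) ∨ ∃ m' ∈ coarsenings (b :: t), m = 1 :: m') : IsLower T T' := by
  obtain ⟨h1, h2, h3, h4, h5⟩ := h
  obtain ⟨e1, e2⟩ := domLevel_sel_eq h2 h3
  by_cases hn : T.sel = Selector.none
  swap
  · exact isLower_of_isUp e1 e2 hn fun hu => by rwa [h1]
  have h6 := partWeight_update T.part j m
  rw [← h5] at h6
  by_cases hred : m ∈ reductions (T.part j)
  · left
    rw [Triple.level, Triple.level, e1, e2, if_pos hn, if_pos hn]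
    have h7 := sum_of_mem_reductions hred
    exact Prod.Lex.toLex_lt_toLex.2 (Or.inr ⟨rfl, by dsimp only; omega⟩)
  · rw [shortenings, List.mem_append, or_iff_left hred] at h4
    right
    rw [Triple.level, Triple.level, e1, e2, if_pos hn, if_pos hn]
    have h7 := sum_of_mem_coarsenings h4
    refine ⟨by rw [show partWeight T'.part = partWeight T.part by omega], ?_⟩
    rintro (h8 | h8)
    · exact absurd (e2.trans hn) h8.1
    · refine Or.inr ⟨hn, ?_⟩
      obtain ⟨i, hi⟩ := exists_isFirst_of_coarsening h4
      rcases partUp_or_partDown hi with hu | hd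
      · refine absurd h8.2 (PartUp.not_partDown ?_)
        rw [h5]
        refine hu.coarsening h4 fun b t hf e => ?_
        rcases hs b t hn hf e with h9 | h9
        · exact absurd (by rwa [e]) hred
        · exact h9
      · exact hd

/-- The matching: removing a thin rectangle at the start, or combining a first part `1` with the
second part in the first nontrivial ordered partition. -/
def Matched (T T₀ : Triple n) : Prop :=
  (T.sel.IsUp T.x ∧ IsStartFace T T₀ (T.sel.left T.x) (T.sel.right T.x)) ∨
  (T.sel = Selector.none ∧ T₀.x = T.x ∧ T₀.y = T.y ∧ T₀.D = T.D ∧ ∃ j b t, IsFirst T.part j ∧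
    T.part j = 1 :: b :: t ∧ T₀.part = Function.update T.part j ((1 + b) :: t))

theorem Triple.IsUp.exists_matched {T : Triple n} (h : T.IsUp) : ∃ T₀, Matched T T₀ := by
  rcases h with h | ⟨h, j, hj, b, t, e⟩
  · have hp : T.sel.Proper := selector_proper (Selector.ne_none_of_isUp h)
    have hr := Selector.isRect hp T.x
    refine ⟨⟨T.x * Equiv.swap (T.sel.left T.x) (T.sel.right T.x), T.y,
      T.D - rectChain T.x (T.sel.left T.x) (T.sel.right T.x), ⟨?_, fun i j => ?_⟩, T.part⟩,
      Or.inl ⟨h, hr, rfl, rfl, rfl, rfl⟩⟩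
    · exact T.pos.1.sub_left (isDomain_rectChain T.x hr.1)
    · exact sub_nonneg.2 (rectChain_le T.pos h i j)
  · exact ⟨⟨T.x, T.y, T.D, T.pos, Function.update T.part j ((1 + b) :: t)⟩,
      Or.inr ⟨h, rfl, rfl, rfl, j, b, t, hj, e, rfl⟩⟩

theorem Matched.isUp {T T₀ : Triple n} (h : Matched T T₀) : T.IsUp := by
  rcases h with h | ⟨h, -, -, -, j, b, t, hj, e, -⟩
  · exact Or.inl h.1
  · exact Or.inr ⟨h, j, hj, b, t, e⟩

theorem one_add_ne_one (b : ℕ+) : 1 + b ≠ 1 := by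
  intro e
  have := congrArg PNat.val e
  rw [PNat.add_coe] at this
  have hb := b.pos
  simp at this

theorem one_add_cons_nontrivial (b : ℕ+) (t : OrderedPartition) :
    ¬ ((1 + b) :: t = [] ∨ (1 + b) :: t = [1]) := by
  rintro (h | h)
  · cases h
  · exact one_add_ne_one b (List.cons.inj h).1

theorem Matched.isPartFace_of_eq_none {T T₀ : Triple n} (h : Matched T T₀)
    (hn : T.sel = Selector.none) : ∃ j b t, IsFirst T.part j ∧ T.part j = 1 :: b :: t ∧
      IsPartFace T T₀ j ((1 + b) :: t) := by
  rcases h with h | ⟨-, h1, h2, h3, j, b, t, hj, e, h4⟩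
  · exact absurd hn (Selector.ne_none_of_isUp h.1)
  · refine ⟨j, b, t, hj, e, h1, h2, h3, ?_, h4⟩
    rw [e, shortenings, coarsenings]
    exact List.mem_append_left _ List.mem_cons_self

theorem Matched.degree {T T₀ : Triple n} (h : Matched T T₀) : T₀.degree = T.degree - 1 := by
  by_cases hn : T.sel = Selector.none
  · obtain ⟨j, b, t, -, -, h'⟩ := h.isPartFace_of_eq_none hn
    exact h'.degree
  · rcases h with h | h
    · exact h.2.degree
    · exact absurd h.1 hn

theorem Matched.domLevel_sel {T T₀ : Triple n} (h : Matched T T₀) :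
    T₀.domLevel = T.domLevel ∧ T₀.sel = T.sel := by
  rcases h with ⟨h, -, -, h3, h4, -⟩ | ⟨-, h1, h2, h3, -⟩
  · have := domLevel_rectChain (y := T.y) (selector_proper (Selector.ne_none_of_isUp h)) h h4
      (Or.inl rfl)
    rw [Triple.domLevel, Triple.sel, h3]
    exact this
  · exact domLevel_sel_eq h2 h3

theorem Matched.level {T T₀ : Triple n} (h : Matched T T₀) : T₀.level = T.level := by
  obtain ⟨e1, e2⟩ := h.domLevel_sel
  by_cases hn : T.sel = Selector.none
  · obtain ⟨j, b, t, -, e, -, -, -, h4, h5⟩ := h.isPartFace_of_eq_none hn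
    rw [Triple.level, Triple.level, e1, e2, if_pos hn, if_pos hn]
    have h6 := partWeight_update T.part j ((1 + b) :: t)
    rw [← h5, e] at h6
    simp only [List.map_cons, List.sum_cons, PNat.val_ofNat, PNat.add_coe] at h6
    rw [show partWeight T₀.part = partWeight T.part by omega]
  · exact level_eq_of_sel_ne_none e1 e2 hn

theorem Matched.isDown {T T₀ : Triple n} (h : Matched T T₀) : T₀.IsDown := by
  obtain ⟨e1, e2⟩ := h.domLevel_sel
  by_cases hn : T.sel = Selector.none
  · obtain ⟨j, b, t, hj, e, -, -, -, h4, h5⟩ := h.isPartFace_of_eq_none hn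
    refine Or.inr ⟨e2.trans hn, j, ?_, 1 + b, t, one_add_ne_one b, by rw [h5, Function.update_self]⟩
    rw [h5]
    exact hj.update (one_add_cons_nontrivial b t)
  · rcases h with h | h
    · refine Or.inl ⟨by rwa [e2], ?_⟩
      rw [e2, h.2.2.1]
      exact fun h' => (Selector.isUp_flip (selector_proper hn) T.x).1 h' h.1
    · exact absurd h.1 hn

theorem Matched.unique_right {T T₁ T₂ : Triple n} (h₁ : Matched T T₁) (h₂ : Matched T T₂) :
    T₁ = T₂ := by
  by_cases hn : T.sel = Selector.none
  · obtain ⟨j, b, t, hj, e, a1, a2, a3, -, a5⟩ := h₁.isPartFace_of_eq_none hn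
    obtain ⟨j', b', t', hj', e', b1, b2, b3, -, b5⟩ := h₂.isPartFace_of_eq_none hn
    obtain rfl := hj.unique hj'
    rw [e] at e'
    obtain ⟨rfl, rfl⟩ := List.cons.inj (List.cons.inj e').2
    exact Triple.ext (a1.trans b1.symm) (a2.trans b2.symm) (a3.trans b3.symm) (a5.trans b5.symm)
  · rcases h₁ with ⟨-, -, a1, a2, a3, a5⟩ | h
    · rcases h₂ with ⟨-, -, b1, b2, b3, b5⟩ | h
      · exact Triple.ext (a1.trans b1.symm) (a2.trans b2.symm) (a3.trans b3.symm) (a5.trans b5.symm)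
      · exact absurd h.1 hn
    · exact absurd h.1 hn

/-- The selector is the same for both members of a pair, so `T₀` alone determines which thin
rectangle to put back, or which part to split into `1` and the rest. -/
theorem Matched.unique_left {T₁ T₂ T₀ : Triple n} (h₁ : Matched T₁ T₀) (h₂ : Matched T₂ T₀) :
    T₁ = T₂ := by
  have e1 := h₁.domLevel_sel.2
  have e2 := h₂.domLevel_sel.2
  by_cases hn : T₀.sel = Selector.none
  · obtain ⟨j, b, t, hj, e, a1, a2, a3, -, a5⟩ := h₁.isPartFace_of_eq_none (e1.symm.trans hn)
    obtain ⟨j', b', t', hj', e', b1, b2, b3, -, b5⟩ := h₂.isPartFace_of_eq_none (e2.symm.trans hn)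
    have hf := hj.update (one_add_cons_nontrivial b t)
    have hf' := hj'.update (one_add_cons_nontrivial b' t')
    rw [← a5] at hf
    rw [← b5] at hf'
    obtain rfl := hf.unique hf'
    have h3 := congrFun (a5.symm.trans b5) j
    rw [Function.update_self, Function.update_self] at h3
    obtain ⟨h4, rfl⟩ := List.cons.inj h3
    obtain rfl := add_left_cancel h4
    refine Triple.ext (a1.symm.trans b1) (a2.symm.trans b2) (a3.symm.trans b3) ?_
    funext i
    by_cases hi : i = j
    · rw [hi, e, e']
    · have h5 := congrFun (a5.symm.trans b5) i
      rwa [Function.update_of_ne hi, Function.update_of_ne hi] at h5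
  · rcases h₁ with ⟨-, -, a1, a2, a3, a5⟩ | h
    swap
    · exact absurd (e1.trans h.1) hn
    rcases h₂ with ⟨-, -, b1, b2, b3, b5⟩ | h
    swap
    · exact absurd (e2.trans h.1) hn
    rw [← e1] at a1 a3
    rw [← e2] at b1 b3
    have hx : T₁.x = T₂.x := by
      have f1 := Selector.flip_flip T₀.sel T₁.x
      have f2 := Selector.flip_flip T₀.sel T₂.x
      dsimp only at f1 f2
      rw [← a1] at f1
      rw [← b1] at f2
      exact f1.symm.trans f2
    refine Triple.ext hx (a2.symm.trans b2) ?_ (a5.symm.trans b5)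
    rw [hx] at a3
    exact sub_left_injective (a3.symm.trans b3)

theorem Triple.IsDown.exists_matched {T₀ : Triple n} (h : T₀.IsDown) : ∃ T, Matched T T₀ := by
  rcases h with ⟨hn, hu⟩ | ⟨hn, j, hj, a, t, ha, e⟩
  · obtain ⟨s, hs⟩ : ∃ s, s = T₀.sel := ⟨_, rfl⟩
    rw [← hs] at hn hu
    have hp : s.Proper := by
      rw [hs] at hn ⊢
      exact selector_proper hn
    obtain ⟨x, hx⟩ : ∃ x, x = T₀.x * Equiv.swap (s.left T₀.x) (s.right T₀.x) := ⟨_, rfl⟩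
    have hxu : s.IsUp x := by rw [hx, Selector.isUp_flip hp]; exact hu
    have hx' : x * Equiv.swap (s.left x) (s.right x) = T₀.x := by
      rw [hx]; exact Selector.flip_flip s T₀.x
    have hr := Selector.isRect hp x
    have hdom := isDomain_rectChain x hr.1
    rw [hx'] at hdom
    have hD : T₀.D = T₀.D + rectChain x (s.left x) (s.right x) -
      rectChain x (s.left x) (s.right x) := (add_sub_cancel_right _ _).symm
    have hpos : IsPosDomain x T₀.y (T₀.D + rectChain x (s.left x) (s.right x)) :=
      IsPosDomain.of_sub_left (by rw [← hD]; exact T₀.pos) hdom (rectChain_nonneg _ _ _)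
    have hsel := (domLevel_rectChain (y := T₀.y) hp hxu hD (Or.inr hs.symm)).2
    have hsel' : (⟨x, T₀.y, _, hpos, T₀.part⟩ : Triple n).sel = s := hsel.symm.trans hs.symm
    refine ⟨⟨x, T₀.y, _, hpos, T₀.part⟩, Or.inl ?_⟩
    rw [hsel']
    exact ⟨hxu, hr, hx'.symm, rfl, hD, rfl⟩
  -- A first part different from `1` is at least 2, so splitting off a `1` leaves a positive part.
  · obtain ⟨b, rfl⟩ : ∃ b, a = 1 + b :=
      ⟨a - 1, by rw [PNat.add_sub_of_lt (lt_of_le_of_ne one_le ha.symm)]⟩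
    refine ⟨⟨T₀.x, T₀.y, T₀.D, T₀.pos, Function.update T₀.part j (1 :: b :: t)⟩,
      Or.inr ⟨hn, rfl, rfl, rfl, j, b, t, hj.update (by simp), Function.update_self .., ?_⟩⟩
    rw [Function.update_idem, ← e, Function.update_eq_self]

theorem boundary_mem_isLower (G : GridDiagram n) {T : Triple n} (h : ¬ T.IsUp) :
    boundary G T ∈ Finsupp.supported (ZMod 2) (ZMod 2) {T' | IsLower T T'} :=
  boundary_mem G T _ (fun _ _ _ h' => h'.isLower fun hu => absurd (Or.inl hu) h)
    (fun _ _ _ h' => h'.isLower) (fun _ h' => h'.isLower)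
    fun _ j _ h' => h'.isLower fun b t hn hj e => absurd (Or.inr ⟨hn, j, hj, b, t, e⟩) h

theorem Matched.boundary_sub_mem (G : GridDiagram n) {T T₀ : Triple n} (h : Matched T T₀) :
    boundary G T - Finsupp.single T₀ 1 ∈
      Finsupp.supported (ZMod 2) (ZMod 2) {T' | IsLower T T'} := by
  by_cases hn : T.sel = Selector.none
  · obtain ⟨j, b, t, hj, e, a1, a2, a3, -, a5⟩ := h.isPartFace_of_eq_none hn
    refine boundary_sub_part_mem G T _ T₀ j 1 b t e a1 a2 a3 a5
      (fun _ _ _ h' => h'.isLower fun hu => absurd hn (Selector.ne_none_of_isUp hu))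
      (fun _ _ _ h' => h'.isLower) (fun _ h' => h'.isLower)
      (fun _ i _ h' hij => h'.isLower fun _ _ _ hi _ => absurd (hi.unique hj) hij)
      fun _ m h' hm => h'.isLower fun b' t' _ _ e' => ?_
    rw [e] at e'
    obtain ⟨rfl, rfl⟩ := List.cons.inj (List.cons.inj e').2
    exact hm
  · rcases h with ⟨-, h⟩ | h
    · exact boundary_sub_start_mem G T _ T₀ _ _ h
        (fun _ _ _ h' hne => h'.isLower fun _ => hne)
        (fun _ _ _ h' => h'.isLower) (fun _ h' => h'.isLower)
        fun _ _ _ h' => h'.isLower fun _ _ hn' => absurd hn' hn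
    · exact absurd h.1 hn

end Grid

namespace Grid

variable {n : ℕ} [NeZero n]

/-! ### The acyclic matching on the triples -/

theorem pointMeasure_nonneg (x : Generator n) {D : TwoChain n} (hD : ∀ i j, 0 ≤ D i j) :
    0 ≤ pointMeasure x D := by
  refine Finset.sum_nonneg fun i _ => div_nonneg ?_ (by norm_num)
  have h : 0 ≤ D i (x i) + D (i - 1) (x i) + D i (x i - 1) + D (i - 1) (x i - 1) :=
    add_nonneg (add_nonneg (add_nonneg (hD _ _) (hD _ _)) (hD _ _)) (hD _ _)
  exact_mod_cast h

theorem Triple.degree_nonneg (T : Triple n) : 0 ≤ T.degree :=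
  add_nonneg (add_nonneg (pointMeasure_nonneg _ T.pos.2) (pointMeasure_nonneg _ T.pos.2))
    (Finset.sum_nonneg fun _ _ => Nat.cast_nonneg _)

open Classical in
/-- The triple with which a triple is matched. -/
noncomputable def partner (k : ℕ) (T : triplesOfDegree n (k + 1)) : triplesOfDegree n k :=
  if h : ∃ T₀ : triplesOfDegree n k, Matched T.1 T₀.1 then h.choose else
    -- Irrelevant default value; it must still have degree `k`, hence the zero domain with `k` parts
    -- `1` in one partition.
    ⟨⟨1, 1, 0, ⟨fun i j => by simp, fun i j => le_rfl⟩,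
      fun j => if j = 0 then List.replicate k 1 else []⟩, by
      change maslov 1 1 0 + _ = _
      simp [maslov, pointMeasure, apply_ite]⟩

theorem matched_partner {k : ℕ} {T : triplesOfDegree n (k + 1)} (h : T.1.IsUp) :
    Matched T.1 (partner k T).1 := by
  have h' : ∃ T₀ : triplesOfDegree n k, Matched T.1 T₀.1 := by
    obtain ⟨T₀, h₀⟩ := h.exists_matched
    refine ⟨⟨T₀, ?_⟩, h₀⟩
    have hT : T.1.degree = ((k + 1 : ℕ) : ℚ) := T.2
    change T₀.degree = k
    rw [h₀.degree, hT]
    push_cast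
    ring
  rw [partner, dif_pos h']
  exact h'.choose_spec

open Classical in
/-- The level of a triple of degree `k`. -/
noncomputable def gradedLevel (k : ℕ) (T : triplesOfDegree n k) : ((ℕ ×ₗ ℕ ×ₗ ℕ) ×ₗ ℕ) ×ₗ ℕ :=
  -- The last entry breaks ties: an `up` triple of degree `k + 1` and its `down` partner of degree
  -- `k` both get `k + 1`, while a face of equal level gets less unless it is `down` and the triple
  -- is not.
  toLex (T.1.level, k + if T.1.IsDown then 1 else 0)

theorem gradedLevel_lt {k : ℕ} {T : triplesOfDegree n (k + 1)} {T' : triplesOfDegree n k}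
    (h : IsLower T.1 T'.1) : gradedLevel k T' < gradedLevel (k + 1) T := by
  rcases h with h | ⟨h, h'⟩
  · exact Prod.Lex.toLex_lt_toLex.2 (Or.inl h)
  · refine Prod.Lex.toLex_lt_toLex.2 (Or.inr ⟨h, ?_⟩)
    dsimp only
    split_ifs with h1 h2
    · omega
    · exact absurd (h' h1) h2
    · omega
    · omega

/-- The acyclic matching on the triples. -/
noncomputable def matching (G : GridDiagram n) :
    AcyclicMatching (S := fun k => triplesOfDegree n k) (cdpD G)
      (((ℕ ×ₗ ℕ ×ₗ ℕ) ×ₗ ℕ) ×ₗ ℕ) where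
  lev := gradedLevel
  up _ T := T.1.IsUp
  down _ T := T.1.IsDown
  partner := partner
  -- A partner would have degree -1.
  not_up_zero T h := by
    obtain ⟨T₀, h₀⟩ := h.exists_matched
    have h1 := T₀.degree_nonneg
    have h2 : T.1.degree = ((0 : ℕ) : ℚ) := T.2
    rw [h₀.degree, h2] at h1
    norm_num at h1
  not_down_of_up _ _ h := h.not_isDown
  down_partner _ _ h := (matched_partner h).isDown
  lev_partner k T h := by
    rw [gradedLevel, gradedLevel, (matched_partner h).level, if_neg h.not_isDown,
      if_pos (matched_partner h).isDown]
  partner_inj k s t hs ht e := by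
    have h := matched_partner ht
    rw [← e] at h
    exact Subtype.ext ((matched_partner hs).unique_left h)
  exists_partner k t ht := by
    obtain ⟨T, hT⟩ := ht.exists_matched
    have hdeg : T.degree = ((k + 1 : ℕ) : ℚ) := by
      have h1 := hT.degree
      rw [show t.1.degree = (k : ℚ) from t.2] at h1
      push_cast
      linarith
    exact ⟨⟨T, hdeg⟩, hT.isUp, Subtype.ext ((matched_partner (T := ⟨T, hdeg⟩) hT.isUp).unique_right hT)⟩
  d_up k T h := by
    refine Finsupp.supported_mono (fun T' h' => gradedLevel_lt h')
      (cdpD_sub_mem (s := {T' | IsLower T.1 T'}) T _ ?_)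
    rw [degreeIncl, Finsupp.lmapDomain_apply, Finsupp.mapDomain_single]
    exact (matched_partner h).boundary_sub_mem G
  d_not_up k T h := by
    refine Finsupp.supported_mono (fun T' h' => gradedLevel_lt h') ?_
    rw [← sub_zero (cdpD G k _)]
    refine cdpD_sub_mem (s := {T' | IsLower T.1 T'}) T 0 ?_
    rw [map_zero, sub_zero]
    exact boundary_mem_isLower G h

/-! ### The critical triples -/

theorem isDomain_smul_colChain (m : ℕ) (c : Fin n) : IsDomain 1 1 ((m : ℤ) • colChain c) := by
  intro i j
  simp [colChain]

theorem maslov_smul_colChain (m : ℕ) (c : Fin n) :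
    maslov 1 1 ((m : ℤ) • colChain c) = 2 * m := by
  induction m with
  | zero => simp [maslov, pointMeasure]
  | succ m ih =>
    have h := maslov_sub_left (isDomain_smul_colChain (m + 1) c) (isDomain_colChain 1 c)
    rw [maslov_colChain, show (((m + 1 : ℕ) : ℤ) • colChain c - colChain c) = (m : ℤ) • colChain c by
      push_cast; rw [add_smul, one_smul, add_sub_cancel_right], ih] at h
    push_cast at h ⊢
    linarith

/-- The critical triple with `m` copies of the last column, and with the parts `1` in `s`. -/
def critTriple (m : ℕ) (s : Finset (Fin n)) : Triple n where
  x := 1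
  y := 1
  D := (m : ℤ) • colChain (lastIdx n)
  pos := ⟨isDomain_smul_colChain m _, fun i j =>
    mul_nonneg (Int.natCast_nonneg m) (colChain_nonneg _ i j)⟩
  part j := if j ∈ s then [1] else []

theorem critTriple_degree (m : ℕ) (s : Finset (Fin n)) :
    (critTriple m s).degree = ((2 * m + s.card : ℕ) : ℚ) := by
  rw [Triple.degree]
  change maslov 1 1 ((m : ℤ) • colChain (lastIdx n)) + _ = _
  rw [maslov_smul_colChain]
  simp [critTriple, apply_ite]

theorem critTriple_D (m : ℕ) (s : Finset (Fin n)) (i j : Fin n) :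
    (critTriple m s).D i j = if i = lastIdx n then (m : ℤ) else 0 := by
  simp [critTriple, colChain]

theorem critTriple_sel (m : ℕ) (s : Finset (Fin n)) :
    (critTriple m s).sel = Selector.none := by
  have hA : ¬ ∃ j, RowCond ((critTriple m s).D (lastIdx n)) j := by
    rintro ⟨j, hj⟩
    rw [RowCond, critTriple_D, critTriple_D] at hj
    exact lt_irrefl _ hj
  have hB : ¬ ∃ i, ColCond (fun i => (critTriple m s).D i (lastIdx n)) i := by
    rintro ⟨i, hi, h1, -⟩
    simp only [critTriple_D, if_neg hi] at h1
    norm_num at h1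
  have hC : ¬ ∃ i, Descent (critTriple m s).y i := by
    rintro ⟨i, hi, h1⟩
    change i + 1 < i at h1
    rw [Fin.lt_def, val_succ_of_ne hi] at h1
    omega
  rw [Triple.sel, domSelector, selector, dif_neg hA, dif_neg hB, dif_neg hC]

theorem critTriple_injective {m m' : ℕ} {s s' : Finset (Fin n)}
    (h : critTriple m s = critTriple m' s') : m = m' ∧ s = s' := by
  constructor
  · have h1 := critTriple_D m s (lastIdx n) (lastIdx n)
    rw [h, critTriple_D, if_pos rfl, if_pos rfl] at h1
    exact_mod_cast h1.symm
  · ext j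
    have h1 := congrFun (congrArg Triple.part h) j
    simp only [critTriple] at h1
    split_ifs at h1 <;> simp_all

theorem critTriple_not_isUp (m : ℕ) (s : Finset (Fin n)) :
    ¬ (critTriple m s).IsUp ∧ ¬ (critTriple m s).IsDown := by
  have h : ∀ j, (critTriple m s).part j = [] ∨ (critTriple m s).part j = [1] := fun j => by
    simp only [critTriple]
    split_ifs <;> simp
  constructor
  · rintro (h1 | ⟨-, j, hj, -⟩)
    · exact Selector.ne_none_of_isUp h1 (critTriple_sel m s)
    · exact hj.1 (h j)
  · rintro (h1 | ⟨-, j, hj, -⟩)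
    · exact h1.1 (critTriple_sel m s)
    · exact hj.1 (h j)

theorem exists_eq_critTriple {T : Triple n} (h : ¬ T.IsUp) (h' : ¬ T.IsDown) :
    ∃ m s, T = critTriple m s := by
  have hn : T.sel = Selector.none := by
    by_contra hn
    by_cases hu : T.sel.IsUp T.x
    · exact h (Or.inl hu)
    · exact h' (Or.inl ⟨hn, hu⟩)
  have hp := trivial_of_not_partUp_partDown (fun r => h (Or.inr ⟨hn, r⟩))
    (fun r => h' (Or.inr ⟨hn, r⟩))
  obtain ⟨hx, hy, hD⟩ := eq_of_selector_none T.pos hn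
  refine ⟨(T.D (lastIdx n) (lastIdx n)).toNat, Finset.univ.filter fun j => T.part j = [1],
    Triple.ext hx hy ?_ ?_⟩
  · funext i j
    rw [critTriple_D, hD, Int.toNat_of_nonneg (T.pos.2 _ _)]
  · funext j
    simp only [critTriple, Finset.mem_filter, Finset.mem_univ, true_and]
    split_ifs with h1
    · exact h1
    · exact (hp j).resolve_right h1

/-- The data of the critical triples of degree `k`. -/
def critData (n k : ℕ) : Finset (Σ _ : ℕ, Finset (Fin n)) :=
  (Finset.range (k / 2 + 1)).sigma fun m => Finset.powersetCard (k - 2 * m) Finset.univ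

theorem mem_critData {k : ℕ} {p : Σ _ : ℕ, Finset (Fin n)} :
    p ∈ critData n k ↔ 2 * p.1 + p.2.card = k := by
  rw [critData, Finset.mem_sigma, Finset.mem_range, Finset.mem_powersetCard]
  simp only [Finset.subset_univ, true_and]
  omega

theorem card_critData (n k : ℕ) :
    (critData n k).card = ∑ l ∈ Finset.range (k / 2 + 1), n.choose (k - 2 * l) := by
  rw [critData, Finset.card_sigma]
  simp

theorem nonempty_crit_equiv (G : GridDiagram n) (k : ℕ) :
    Nonempty (critData n k ≃ (matching G).crit k) := by
  let f : critData n k → (matching G).crit k := fun p =>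
    ⟨⟨critTriple p.1.1 p.1.2, (critTriple_degree _ _).trans (by rw [mem_critData.1 p.2])⟩,
      critTriple_not_isUp _ _⟩
  refine ⟨Equiv.ofBijective f ⟨fun p q h => ?_, fun T => ?_⟩⟩
  · have h1 := critTriple_injective (congrArg (fun T => T.1.1) h)
    exact Subtype.ext (Sigma.ext h1.1 (heq_of_eq h1.2))
  · obtain ⟨m, s, h⟩ := exists_eq_critTriple T.2.1 T.2.2
    have hd : T.1.1.degree = (k : ℚ) := T.1.2
    rw [h, critTriple_degree] at hd
    exact ⟨⟨⟨m, s⟩, mem_critData.2 (by exact_mod_cast hd)⟩, Subtype.ext (Subtype.ext h.symm)⟩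

end Grid

/-! ### Dimension count and conclusion -/

theorem finrank_cubeTensorPolyU (n k : ℕ) :
    Module.finrank (ZMod 2) (cubeTensorPolyU (ZMod 2) n k) =
      ∑ l ∈ Finset.range (k / 2 + 1), n.choose (k - 2 * l) := by
  rw [Module.finrank_directSum]
  simp only [Module.finrank_tensorProduct, Module.finrank_fin_fun]
  rw [Finset.sum_coe_sort (Finset.HasAntidiagonal.antidiagonal k)
    (fun ij => n.choose ij.1 * if Even ij.2 then 1 else 0), ← Finset.Nat.sum_antidiagonal_swap,
    Finset.Nat.sum_antidiagonal_eq_sum_range_succ_mk]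
  simp only [Prod.swap_prod_mk, mul_ite, mul_one, mul_zero]
  rw [← Finset.sum_filter]
  -- The index is the degree in `U`, and only the even degrees `2 * l` contribute.
  refine Finset.sum_nbij' (fun j => j / 2) (fun l => 2 * l) ?_ ?_ ?_ ?_ ?_
  · intro j hj
    simp only [Finset.mem_filter, Finset.mem_range] at hj ⊢
    omega
  · intro l hl
    simp only [Finset.mem_filter, Finset.mem_range] at hl ⊢
    exact ⟨by omega, even_two_mul l⟩
  · intro j hj
    exact Nat.two_mul_div_two_of_even (Finset.mem_filter.1 hj).2
  · intro l _
    simp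
  · intro j hj
    rw [Nat.two_mul_div_two_of_even (Finset.mem_filter.1 hj).2]

theorem mainTheorem7 (n : ℕ) [NeZero n] (G : GridDiagram n) :
    ∃ h : ∀ k, Grid.cdpD G k ∘ₗ Grid.cdpD G (k + 1) = 0,
      (∃ (P : Type) (_ : LinearOrder P) (_ : WellFoundedLT P)
          (F : ChainFiltration (Grid.CDP G h) P),
        Grid.SpannedByTriples F ∧
        ∀ k : ℕ, Nonempty
          (F.assocGraded.homology k ≃ₗ[ZMod 2] cubeTensorPolyU (ZMod 2) n k)) ∧
      ∀ k : ℕ, Module.rank (ZMod 2) ((Grid.CDP G h).homology k) ≤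
        ((∑ l ∈ Finset.range (k / 2 + 1), n.choose (k - 2 * l) : ℕ) : Cardinal) := by
  have h := Grid.cdpD_comp G
  have hd : ∀ k, (Grid.CDP G h).d (k + 1) k = ModuleCat.ofHom (Grid.cdpD G k) := fun k =>
    ChainComplex.of_d (fun k => ModuleCat.of (ZMod 2) (Grid.CDPModule n k))
      (fun k => ModuleCat.ofHom (Grid.cdpD G k)) k
  let e : ∀ k, (Grid.CDP G h).X k ≃ₗ[ZMod 2] (Grid.triplesOfDegree n k →₀ ZMod 2) :=
    fun k => LinearEquiv.refl (ZMod 2) (Grid.CDPModule n k)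
  have he : ∀ k v, e k (((Grid.CDP G h).d (k + 1) k).hom v) = Grid.cdpD G k (e (k + 1) v) :=
    fun k v => by rw [hd k]; rfl
  have hcrit := fun k => Grid.nonempty_crit_equiv G k
  refine ⟨h, ⟨((ℕ ×ₗ ℕ ×ₗ ℕ) ×ₗ ℕ) ×ₗ ℕ, inferInstance, inferInstance,
    (Grid.matching G).filtration (Grid.CDP G h) e he,
    fun p k => (Grid.matching G).filtration_sub_eq_span (Grid.CDP G h) e he p k, fun k => ?_⟩,
    fun k => ?_⟩
  · obtain ⟨f⟩ := (Grid.matching G).nonempty_assocGraded_homology_equiv (Grid.CDP G h) e he k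
    obtain ⟨g⟩ := hcrit k
    obtain ⟨l⟩ : Nonempty ((Grid.critData n k →₀ ZMod 2) ≃ₗ[ZMod 2]
        cubeTensorPolyU (ZMod 2) n k) := by
      refine FiniteDimensional.nonempty_linearEquiv_of_finrank_eq ?_
      rw [finrank_cubeTensorPolyU, Module.finrank_finsupp_self, Fintype.card_coe,
        Grid.card_critData]
    exact ⟨f.trans ((Finsupp.domLCongr g.symm).trans l)⟩
  · obtain ⟨f⟩ := FreeComplex.nonempty_homology_equiv (Grid.CDP G h) (Grid.cdpD G) e he k
    obtain ⟨g⟩ := hcrit k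
    rw [f.rank_eq]
    refine ((Grid.matching G).rank_homology_le k ?_).trans ?_
    · cases k with
      | zero => exact le_top
      | succ k =>
        rw [FreeComplex.boundaries, FreeComplex.cycles, LinearMap.range_le_ker_iff]
        exact h k
    · rw [← Cardinal.mk_congr g, Cardinal.mk_coe_finset, Grid.card_critData]
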